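/- Let $X$ be a closed smooth manifold (compact, without boundary) with a smooth positive density $|dx|$, and let $P$ be a linear differential operator on $C^\infty(X,\mathbb{C})$ of order at most $2$ with smooth complex coefficients, which is formally self-adjoint: $\int_X Pu\,\bar v\,|dx|=\int_X u\,\overline{Pv}\,|dx|$ for all $u,v\in C^\infty(X,\mathbb{C})$. Let $Z\subset X$ be the set of points where $P$ is not elliptic as an operator of order two, i.e. the points $x$ at which the order-two principal symbol $-\sum_{i,j}a_{ij}(x)\xi_i\xi_j$ of $P=\sum_{i,j}a_{ij}\partial_i\partial_j+\sum_i b_i\partial_i+c$ (in local coordinates) vanishes for some real $\xi\neq 0$. Let $U\supset Z$ be an open set with smooth boundary, meaning that near each point of $\partial U$ there are smooth local coordinates in which $U$ is one side of a coordinate hyperplane. Let $P_U$ be the Dirichlet restriction of $P$ to $U$: the operator on $L^2(U,|dx|)$ acting as $P$, whose domain is the space of smooth functions on $\bar U$ (restrictions to $\bar U$ of functions in $C^\infty(X,\mathbb{C})$) that vanish on $\partial U$. Call a densely defined operator $A$ on a Hilbert space essentially self-adjoint if the closure of its graph is the graph of its adjoint $A^\star$. Then $P$, with domain $C^\infty(X,\mathbb{C})$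 in $L^2(X,|dx|)$, is essentially self-adjoint if and only if $P_U$ is essentially self-adjoint. -/

import Mathlib

open scoped Manifold ContDiff ComplexConjugate Topology
open MeasureTheory

noncomputable section

namespace ESALoc

section Operators

variable (n : ℕ) (X : Type*) [TopologicalSpace X]
  [ChartedSpace (EuclideanSpace ℝ (Fin n)) X]

/-- The complex vector space `C^∞(X, ℂ)` of smooth complex-valued functions on the
`n`-dimensional manifold `X`. -/
def SmoothFun : Submodule ℂ (X → ℂ) where
  carrier := {u | ContMDiff (𝓡 n) 𝓘(ℝ, ℂ) ∞ u}
  zero_mem' := contMDiff_const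
  add_mem' := fun hu hv => ContMDiff.add hu hv
  smul_mem' := fun c u hu =>
    (c • ContinuousLinearMap.id ℝ ℂ).contMDiff.comp (g := (c • ContinuousLinearMap.id ℝ ℂ))
      (f := u) hu

variable {n}

/-- The partial derivative `∂f/∂yᵢ` of a function on (an open subset of) `ℝⁿ`. -/
def partialDeriv (i : Fin n) (f : EuclideanSpace ℝ (Fin n) → ℂ) :
    EuclideanSpace ℝ (Fin n) → ℂ :=
  fun y => fderiv ℝ f y (EuclideanSpace.single i 1)

variable {X}

/-- In the chart `φ`, the operator `P` is
`∑ᵢⱼ aᵢⱼ(y) ∂ᵢ∂ⱼ + ∑ᵢ bᵢ(y) ∂ᵢ + c(y)`, with coefficients smooth on the domain `φ.target` of the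
coordinates `y`. -/
structure HasLocalForm (P : SmoothFun n X →ₗ[ℂ] SmoothFun n X)
    (φ : OpenPartialHomeomorph X (EuclideanSpace ℝ (Fin n)))
    (a : Fin n → Fin n → EuclideanSpace ℝ (Fin n) → ℂ)
    (b : Fin n → EuclideanSpace ℝ (Fin n) → ℂ)
    (c : EuclideanSpace ℝ (Fin n) → ℂ) : Prop where
  smooth_a : ∀ i j, ContDiffOn ℝ ∞ (a i j) φ.target
  smooth_b : ∀ i, ContDiffOn ℝ ∞ (b i) φ.target
  smooth_c : ContDiffOn ℝ ∞ c φ.target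
  eq : ∀ (u : SmoothFun n X), ∀ y ∈ φ.target,
    (P u : X → ℂ) (φ.symm y) =
      ∑ i, ∑ j, a i j y * partialDeriv i (partialDeriv j ((u : X → ℂ) ∘ φ.symm)) y
        + ∑ i, b i y * partialDeriv i ((u : X → ℂ) ∘ φ.symm) y
        + c y * (u : X → ℂ) (φ.symm y)

/-- `P` is a linear differential operator of order at most two with smooth complex coefficients
on `X`: it has the expected form in every smooth chart. -/
def IsDiffOpOrderTwo (P : SmoothFun n X →ₗ[ℂ] SmoothFun n X) : Prop :=
  ∀ φ ∈ IsManifold.maximalAtlas (𝓡 n) ∞ X, ∃ a b c, HasLocalForm P φ a b c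

/-- `P` is elliptic at `x` (as an operator of order two): in local coordinates, the principal symbol
`-∑ᵢⱼ aᵢⱼ ξᵢ ξⱼ` does not vanish for `ξ ∈ ℝⁿ`, `ξ ≠ 0`. -/
def IsEllipticAt (P : SmoothFun n X →ₗ[ℂ] SmoothFun n X) (x : X) : Prop :=
  ∀ φ ∈ IsManifold.maximalAtlas (𝓡 n) ∞ X, x ∈ φ.source →
    ∀ a b c, HasLocalForm P φ a b c →
      ∀ ξ : Fin n → ℝ, ξ ≠ 0 → ∑ i, ∑ j, a i j (φ x) * (ξ i : ℂ) * (ξ j : ℂ) ≠ 0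

/-- The set `Z` of points where `P` is not elliptic. -/
def nonEllipticSet (P : SmoothFun n X →ₗ[ℂ] SmoothFun n X) : Set X :=
  {x | ¬ IsEllipticAt P x}

variable (n) in
/-- The measure `μ` is a smooth (positive) density on `X`: in every smooth chart it is
`ρ(y) dy` with `ρ` smooth and positive. -/
def IsSmoothDensity [MeasurableSpace X] (μ : Measure X) : Prop :=
  ∀ φ ∈ IsManifold.maximalAtlas (𝓡 n) ∞ X, ∃ ρ : EuclideanSpace ℝ (Fin n) → ℝ,
    ContDiffOn ℝ ∞ ρ φ.target ∧ (∀ y ∈ φ.target, 0 < ρ y) ∧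
      (μ.restrict φ.source).map φ =
        (volume.restrict φ.target).withDensity (fun y => ENNReal.ofReal (ρ y))

/-- `P` is formally self-adjoint with respect to `μ`: `∫ Pu · v̄ dμ = ∫ u · conj (Pv) dμ` for all
smooth `u`, `v`. -/
def IsFormallySelfAdjoint [MeasurableSpace X] (μ : Measure X)
    (P : SmoothFun n X →ₗ[ℂ] SmoothFun n X) : Prop :=
  ∀ u v : SmoothFun n X,
    ∫ x, (P u : X → ℂ) x * conj ((v : X → ℂ) x) ∂μ =
      ∫ x, (u : X → ℂ) x * conj ((P v : X → ℂ) x) ∂μ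

variable (n) in
/-- The open set `U` has a smooth boundary: near each boundary point there is a smooth chart in
which `U` is one side of a coordinate hyperplane. Equivalently, the closure of `U` is a smooth
manifold with boundary of codimension zero, with interior `U`. -/
def HasSmoothBoundary (U : Set X) : Prop :=
  ∀ x ∈ frontier U, ∃ φ ∈ IsManifold.maximalAtlas (𝓡 n) ∞ X, x ∈ φ.source ∧
    ∃ i : Fin n, ∀ y ∈ φ.source, y ∈ U ↔ 0 < φ y i

/-- The graph in `L²(X) × L²(X)` of the operator `P` with domain `C^∞(X, ℂ)`. -/
def graphL2 [MeasurableSpace X] (μ : Measure X)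
    (P : SmoothFun n X →ₗ[ℂ] SmoothFun n X) :
    Submodule ℂ (Lp ℂ 2 μ × Lp ℂ 2 μ) where
  carrier := {p | ∃ u : SmoothFun n X,
    (p.1 : X → ℂ) =ᵐ[μ] (u : X → ℂ) ∧ (p.2 : X → ℂ) =ᵐ[μ] (P u : X → ℂ)}
  zero_mem' := ⟨0, by simpa using Lp.coeFn_zero ℂ 2 μ, by simpa using Lp.coeFn_zero ℂ 2 μ⟩
  add_mem' := by
    rintro p q ⟨u, hu, hPu⟩ ⟨v, hv, hPv⟩
    refine ⟨u + v, (Lp.coeFn_add _ _).trans (hu.add hv), ?_⟩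
    rw [map_add]
    exact (Lp.coeFn_add _ _).trans (hPu.add hPv)
  smul_mem' := by
    rintro k p ⟨u, hu, hPu⟩
    refine ⟨k • u, (Lp.coeFn_smul _ _).trans (hu.const_smul k), ?_⟩
    rw [map_smul]
    exact (Lp.coeFn_smul _ _).trans (hPu.const_smul k)

/-- The graph in `L²(U) × L²(U)` of the Dirichlet restriction `P_U` of `P` to `U`. Its domain
consists of the smooth functions on the closure of `U` (restrictions of smooth functions on `X`)
which vanish on the boundary of `U`. -/
def dirichletGraphL2 [MeasurableSpace X] (μ : Measure X)
    (P : SmoothFun n X →ₗ[ℂ] SmoothFun n X) (U : Set X) :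
    Submodule ℂ (Lp ℂ 2 (μ.restrict U) × Lp ℂ 2 (μ.restrict U)) where
  carrier := {p | ∃ u : SmoothFun n X, (∀ x ∈ frontier U, (u : X → ℂ) x = 0) ∧
    (p.1 : X → ℂ) =ᵐ[μ.restrict U] (u : X → ℂ) ∧
    (p.2 : X → ℂ) =ᵐ[μ.restrict U] (P u : X → ℂ)}
  zero_mem' := ⟨0, by simp, by simpa using Lp.coeFn_zero ℂ 2 (μ.restrict U),
    by simpa using Lp.coeFn_zero ℂ 2 (μ.restrict U)⟩
  add_mem' := by
    rintro p q ⟨u, hu0, hu, hPu⟩ ⟨v, hv0, hv, hPv⟩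
    refine ⟨u + v, fun x hx => by simp [hu0 x hx, hv0 x hx],
      (Lp.coeFn_add _ _).trans (hu.add hv), ?_⟩
    rw [map_add]
    exact (Lp.coeFn_add _ _).trans (hPu.add hPv)
  smul_mem' := by
    rintro k p ⟨u, hu0, hu, hPu⟩
    refine ⟨k • u, fun x hx => by simp [hu0 x hx],
      (Lp.coeFn_smul _ _).trans (hu.const_smul k), ?_⟩
    rw [map_smul]
    exact (Lp.coeFn_smul _ _).trans (hPu.const_smul k)

end Operators

/-- An operator in a Hilbert space `H`, given by its graph `G ⊆ H × H`, is essentially self-adjoint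
if the closure of its graph is the graph of its adjoint, which consists of the pairs `(u, v)` with
`⟪g, u⟫ = ⟪f, v⟫` for all `(f, g) ∈ G`. -/
def IsEssentiallySelfAdjoint {H : Type*} [NormedAddCommGroup H] [InnerProductSpace ℂ H]
    [CompleteSpace H] (G : Submodule ℂ (H × H)) : Prop :=
  G.topologicalClosure = G.adjoint

end ESALoc

end

/-!
An operator `A` which is symmetric on its domain is essentially self-adjoint if and only if
`A - i m` has dense range for large `|m|`, with `m` of both signs; for this it is enough to solve
`(A - i m) w = f` with an `L²` error of at most `1 / 2` for all `f` in the unit ball. The point is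
that approximate solvability for `|m| → ∞` can be localized. Call a cutoff function `η` solvable
(`ApproxSolvable`) if `(A - i m) w = η f` can be solved with an error which tends to `0` as
`|m| → ∞`, uniformly for `f` in the unit ball. Sums of solvable functions are solvable, so by a
partition of unity essential self-adjointness follows if every point has a neighbourhood in which
all cutoff functions are solvable (`approxSolvable_one_of_locally`,
`ApproxSolvable.isEssentiallySelfAdjoint`). No regularity theory is needed.

Solvability holds near an elliptic point, in the interior and, for the Dirichlet problem, at the
boundary (`exists_approxSolvable_of_chart`). The double commutator `[[P, f], f]` with a real
function `f` is a formally self-adjoint multiplication operator, so the principal symbol is real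
and, at an elliptic point, definite. After freezing the leading coefficients the operator minus `i m`
is inverted by the Fourier transform, with a gain of `|m|^{-1/2}` for derivatives of order one;
in a half-space, odd reflection along a direction adapted to the coefficients commutes with the
frozen operator and yields functions which vanish on the boundary. The variable coefficients are a
relatively small perturbation, and cutting off the solution costs a commutator of order one, which
is small for large `|m|`.

Solvability inside `U`, where `P` may degenerate, is transferred from one of the two operators to
the other (`approxSolvable_of_isEssentiallySelfAdjoint`). Essential self-adjointness of the first
operator gives a solution `w` with `‖P w‖ = O(1)` and `‖w‖ = O(1 / |m|)`. It is multiplied by a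
cutoff `χ'` supported in `U` and equal to `1` near the non-elliptic set. The error `[P, χ'] w` lives
where `P` is elliptic, and there formal self-adjointness gives a Caccioppoli inequality
`‖[P, χ'] w‖² ≤ C (‖P w‖ ‖w‖ + ‖w‖²) = O(1 / |m|)` (`exists_commutator_energy`).

The Dirichlet restriction is symmetric by Green's formula (`integral_green_dirichlet`), which is
derived from formal self-adjointness on `X` by cutting off near the boundary.
-/

noncomputable section

namespace ESALoc

/-! ### Essential self-adjointness and dense ranges -/

section Abstract

variable {H V : Type*} [NormedAddCommGroup H] [InnerProductSpace ℂ H]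
  [AddCommMonoid V] [Module ℂ V]

theorem denseRange_of_forall_inner_eq_zero [CompleteSpace H] (T : V →ₗ[ℂ] H)
    (hT : ∀ z, (∀ v, inner ℂ (T v) z = 0) → z = 0) : DenseRange T := by
  have key : (LinearMap.range T)ᗮ = ⊥ := by
    rw [Submodule.eq_bot_iff]
    exact fun z hz => hT z fun v => hz _ ⟨v, rfl⟩
  have := (Submodule.topologicalClosure_eq_top_iff (K := LinearMap.range T)).mpr key
  rw [← Submodule.dense_iff_topologicalClosure_eq_top] at this
  exact this

/-- A small relative perturbation of an operator with dense range has dense range: a vector `z`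
orthogonal to the perturbed range would be too close to some `T v`. -/
theorem denseRange_add_of_norm_le_half [CompleteSpace H] (T B : V →ₗ[ℂ] H) (hT : DenseRange T)
    (hB : ∀ v, ‖B v‖ ≤ (1 / 2) * ‖T v‖) : DenseRange (T + B) := by
  refine denseRange_of_forall_inner_eq_zero _ fun z hz => ?_
  by_contra hz0
  have hzpos : 0 < ‖z‖ := norm_pos_iff.mpr hz0
  obtain ⟨v, hv⟩ := Metric.denseRange_iff.mp hT z (‖z‖ / 4) (by positivity)
  have h1 : inner ℂ ((T + B) v) z = 0 := hz v
  rw [dist_eq_norm] at hv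
  have h2 : inner ℂ z z = inner ℂ (z - T v) z - inner ℂ (B v) z := by
    rw [LinearMap.add_apply, inner_add_left] at h1
    rw [inner_sub_left]
    linear_combination h1
  have h3 : ‖z‖ ^ 2 ≤ ‖z - T v‖ * ‖z‖ + ‖B v‖ * ‖z‖ := by
    calc ‖z‖ ^ 2 = ‖inner ℂ z z‖ := by
          rw [inner_self_eq_norm_sq_to_K]; simp
      _ ≤ ‖inner ℂ (z - T v) z‖ + ‖inner ℂ (B v) z‖ := by rw [h2]; exact norm_sub_le _ _
      _ ≤ _ := add_le_add (norm_inner_le_norm _ _) (norm_inner_le_norm _ _)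
  have h4 : ‖T v‖ ≤ ‖z‖ + ‖z‖ / 4 := by
    have : T v = z - (z - T v) := by abel
    rw [this]
    exact (norm_sub_le _ _).trans (by linarith)
  have h5 := hB v
  nlinarith

/-- Solvability of `T v = z` with relative error `1 / 2` suffices for dense range, because a vector
orthogonal to the range is no farther from `0` than from any point of the range. -/
theorem denseRange_of_forall_exists_norm_sub_le_half [CompleteSpace H] (T : V →ₗ[ℂ] H)
    (hT : ∀ z, ∃ v, ‖T v - z‖ ≤ (1 / 2) * ‖z‖) : DenseRange T := by
  refine denseRange_of_forall_inner_eq_zero _ fun z hz => ?_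
  obtain ⟨v, hv⟩ := hT z
  have h1 : inner ℂ (T v) z = 0 := hz v
  have h2 : ‖z‖ ^ 2 ≤ ‖T v - z‖ * ‖z‖ := by
    calc ‖z‖ ^ 2 = ‖inner ℂ (T v - z) z‖ := by
          rw [inner_sub_left, h1, inner_self_eq_norm_sq_to_K]; simp
      _ ≤ _ := norm_inner_le_norm _ _
  have h3 : ‖z‖ = 0 := by
    by_contra h
    have : 0 < ‖z‖ := lt_of_le_of_ne (norm_nonneg _) (Ne.symm h)
    nlinarith
  exact norm_eq_zero.mp h3

variable (j p : V →ₗ[ℂ] H)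

/-- The operator `p - i m j`, for `j` the inclusion of the domain `V` of the operator `p`. -/
def shifted (m : ℝ) : V →ₗ[ℂ] H := p - ((m : ℂ) * Complex.I) • j

theorem shifted_apply (m : ℝ) (v : V) : shifted j p m v = p v - ((m : ℂ) * Complex.I) • j v := rfl

variable {j p}

/-- Symmetry makes the cross terms cancel, as `⟪p v, j v⟫` is real. -/
theorem norm_sq_shifted (hsym : ∀ u v, inner ℂ (p u) (j v) = inner ℂ (j u) (p v)) (m : ℝ) (v : V) :
    ‖shifted j p m v‖ ^ 2 = ‖p v‖ ^ 2 + m ^ 2 * ‖j v‖ ^ 2 := by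
  have h0 : (inner ℂ (p v) (j v)).im = 0 := by
    have h := hsym v v
    rw [← inner_conj_symm (j v) (p v)] at h
    have := congrArg Complex.im h
    rw [Complex.conj_im] at this
    linarith
  have h1 : ‖((m : ℂ) * Complex.I) • j v‖ ^ 2 = m ^ 2 * ‖j v‖ ^ 2 := by
    rw [norm_smul, mul_pow]; simp
  rw [shifted_apply, @norm_sub_sq ℂ, h1, inner_smul_right]
  have : RCLike.re ((m : ℂ) * Complex.I * inner ℂ (p v) (j v)) = 0 := by
    simp [h0]
  rw [this]; ring

theorem norm_le_norm_shifted (hsym : ∀ u v, inner ℂ (p u) (j v) = inner ℂ (j u) (p v))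
    (m : ℝ) (v : V) : ‖p v‖ ≤ ‖shifted j p m v‖ := by
  have := norm_sq_shifted hsym m v
  apply le_of_sq_le_sq _ (norm_nonneg _)
  nlinarith [mul_nonneg (sq_nonneg m) (sq_nonneg ‖j v‖)]

theorem abs_mul_norm_le_norm_shifted (hsym : ∀ u v, inner ℂ (p u) (j v) = inner ℂ (j u) (p v))
    (m : ℝ) (v : V) : |m| * ‖j v‖ ≤ ‖shifted j p m v‖ := by
  have := norm_sq_shifted hsym m v
  apply le_of_sq_le_sq _ (norm_nonneg _)
  rw [mul_pow, sq_abs]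
  nlinarith [sq_nonneg ‖p v‖]

theorem mem_adjoint_range_prod_iff [CompleteSpace H] (x : H × H) :
    x ∈ (LinearMap.range (j.prod p)).adjoint ↔ ∀ v, inner ℂ (p v) x.1 = inner ℂ (j v) x.2 := by
  rw [Submodule.mem_adjoint_iff]
  constructor
  · intro h v
    exact sub_eq_zero.mp (h (j v) (p v) ⟨v, rfl⟩)
  · rintro h a b ⟨v, hv⟩
    have ha : j v = a := congrArg Prod.fst hv
    have hb : p v = b := congrArg Prod.snd hv
    rw [← ha, ← hb, h v, sub_self]

theorem adjoint_range_prod_isClosed [CompleteSpace H] :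
    IsClosed ((LinearMap.range (j.prod p)).adjoint : Set (H × H)) := by
  have : ((LinearMap.range (j.prod p)).adjoint : Set (H × H)) =
      ⋂ v, {x | inner ℂ (p v) x.1 = inner ℂ (j v) x.2} := by
    ext x
    simp only [SetLike.mem_coe, mem_adjoint_range_prod_iff, Set.mem_iInter, Set.mem_ofPred_eq]
  rw [this]
  refine isClosed_iInter fun v => isClosed_eq ?_ ?_ <;> fun_prop

theorem IsEssentiallySelfAdjoint.symmetric [CompleteSpace H]
    (h : IsEssentiallySelfAdjoint (LinearMap.range (j.prod p))) (u v : V) :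
    inner ℂ (p u) (j v) = inner ℂ (j u) (p v) := by
  have : (j v, p v) ∈ (LinearMap.range (j.prod p)).adjoint := by
    rw [← h]
    exact Submodule.le_topologicalClosure _ ⟨v, rfl⟩
  exact (mem_adjoint_range_prod_iff _).mp this u

/-- A vector orthogonal to the range of `p - i m j` is an eigenvector of the adjoint with a nonreal
eigenvalue. There is none, because the adjoint is the closure of a symmetric operator. -/
theorem IsEssentiallySelfAdjoint.denseRange_shifted [CompleteSpace H]
    (h : IsEssentiallySelfAdjoint (LinearMap.range (j.prod p))) {m : ℝ} (hm : m ≠ 0) :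
    DenseRange (shifted j p m) := by
  have hsym := h.symmetric
  refine denseRange_of_forall_inner_eq_zero _ fun z hz => ?_
  have h1 : (z, -((m : ℂ) * Complex.I) • z) ∈ (LinearMap.range (j.prod p)).adjoint := by
    rw [mem_adjoint_range_prod_iff]
    intro v
    have h2 : inner ℂ (shifted j p m v) z = 0 := hz v
    rw [shifted_apply, inner_sub_left, inner_smul_left] at h2
    rw [inner_smul_right]
    simp only [map_mul, Complex.conj_ofReal, Complex.conj_I] at h2
    linear_combination h2
  rw [← h] at h1
  have hcl : IsClosed {x : H × H | (inner ℂ x.2 x.1).im = 0} := by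
    refine isClosed_eq (Complex.continuous_im.comp ?_) continuous_const
    fun_prop
  have h4 : closure ((LinearMap.range (j.prod p) : Submodule ℂ (H × H)) : Set (H × H)) ⊆
      {x : H × H | (inner ℂ x.2 x.1).im = 0} := by
    refine closure_minimal ?_ hcl
    rintro _ ⟨v, rfl⟩
    have h5 := hsym v v
    rw [← inner_conj_symm (j v) (p v)] at h5
    have := congrArg Complex.im h5
    rw [Complex.conj_im] at this
    change (inner ℂ (p v) (j v)).im = 0
    linarith
  have h5 : (inner ℂ (-((m : ℂ) * Complex.I) • z) z).im = 0 := h4 h1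
  rw [inner_smul_left, inner_self_eq_norm_sq_to_K] at h5
  have h6 : m * ‖z‖ ^ 2 = 0 := by
    simpa [← Complex.ofReal_pow] using h5
  simpa [hm] using h6

/-- The basic criterion: a symmetric operator is essentially self-adjoint as soon as its
translates by `± i m` have dense ranges. -/
theorem isEssentiallySelfAdjoint_of_denseRange_shifted [CompleteSpace H]
    (hsym : ∀ u v, inner ℂ (p u) (j v) = inner ℂ (j u) (p v)) {m : ℝ} (hm : m ≠ 0)
    (h₁ : DenseRange (shifted j p m)) (h₂ : DenseRange (shifted j p (-m))) :
    IsEssentiallySelfAdjoint (LinearMap.range (j.prod p)) := by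
  have hle : (LinearMap.range (j.prod p)).topologicalClosure ≤
      (LinearMap.range (j.prod p)).adjoint := by
    refine Submodule.topologicalClosure_minimal _ ?_ adjoint_range_prod_isClosed
    rintro _ ⟨v, rfl⟩
    rw [mem_adjoint_range_prod_iff]
    exact fun u => hsym u v
  have hsub (f : V →ₗ[ℂ] H) (a b : V) : f a - f b = f (a + (-1 : ℂ) • b) := by
    rw [map_add, map_smul, neg_one_smul, sub_eq_add_neg]
  refine le_antisymm hle ?_
  rintro ⟨u, v⟩ huv
  -- The closure contains some `(u', v')` with `v' - i m u' = v - i m u`. The difference of the two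
  -- pairs then gives an eigenvector of the adjoint, which is excluded by the density `h₂`.
  obtain ⟨s, hs, hlim⟩ := mem_closure_iff_seq_limit.mp (h₁ (v - ((m : ℂ) * Complex.I) • u))
  choose w hw using hs
  have hCs : CauchySeq fun k => shifted j p m (w k) := by
    simp_rw [hw]; exact hlim.cauchySeq
  have hCp : CauchySeq fun k => p (w k) := by
    rw [Metric.cauchySeq_iff] at hCs ⊢
    intro ε hε
    obtain ⟨N, hN⟩ := hCs ε hε
    refine ⟨N, fun a ha b hb => lt_of_le_of_lt ?_ (hN a ha b hb)⟩
    rw [dist_eq_norm, dist_eq_norm, hsub, hsub]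
    exact norm_le_norm_shifted hsym m _
  have hCj : CauchySeq fun k => j (w k) := by
    rw [Metric.cauchySeq_iff] at hCs ⊢
    intro ε hε
    have hm' : 0 < |m| := abs_pos.mpr hm
    obtain ⟨N, hN⟩ := hCs (|m| * ε) (by positivity)
    refine ⟨N, fun a ha b hb => ?_⟩
    have := hN a ha b hb
    rw [dist_eq_norm, hsub] at this ⊢
    have h3 := abs_mul_norm_le_norm_shifted hsym m (w a + (-1 : ℂ) • w b)
    exact lt_of_mul_lt_mul_left (h3.trans_lt this) hm'.le
  obtain ⟨v', hv'⟩ := cauchySeq_tendsto_of_complete hCp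
  obtain ⟨u', hu'⟩ := cauchySeq_tendsto_of_complete hCj
  have hmem : (u', v') ∈ (LinearMap.range (j.prod p)).topologicalClosure := by
    refine mem_closure_of_tendsto (hu'.prodMk_nhds hv') (Filter.Eventually.of_forall fun k => ?_)
    exact ⟨w k, rfl⟩
  have heq : v' - ((m : ℂ) * Complex.I) • u' = v - ((m : ℂ) * Complex.I) • u := by
    refine tendsto_nhds_unique (hv'.sub (hu'.const_smul ((m : ℂ) * Complex.I))) ?_
    exact hlim.congr fun k => (hw k).symm
  have hdiff := Submodule.sub_mem _ huv (hle hmem)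
  rw [mem_adjoint_range_prod_iff] at hdiff
  simp only [Prod.mk_sub_mk] at hdiff
  have hvv : v - v' = ((m : ℂ) * Complex.I) • (u - u') := by
    rw [smul_sub]
    have : v = v' - ((m : ℂ) * Complex.I) • u' + ((m : ℂ) * Complex.I) • u := by rw [heq]; abel
    rw [this]; abel
  have hz : u - u' = 0 := by
    refine Dense.eq_zero_of_inner_right (𝕜 := ℂ) (S := LinearMap.range (shifted j p (-m))) h₂ ?_
    rintro _ ⟨x, rfl⟩
    have := hdiff x
    rw [hvv, inner_smul_right] at this
    rw [shifted_apply, inner_sub_left, inner_smul_left, this]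
    simp
  have h1 : u = u' := sub_eq_zero.mp hz
  rw [hz, smul_zero, sub_eq_zero] at hvv
  rw [h1, hvv]
  exact hmem

end Abstract

/-! ### `L²` norms of functions -/

section L2Norm

variable {α : Type*} [MeasurableSpace α] {ν : Measure α} {f g : α → ℂ}

/-- The `L²` norm of a function, as a real number; it is only meaningful for functions in `L²`. -/
def l2norm (ν : Measure α) (f : α → ℂ) : ℝ := (eLpNorm f 2 ν).toReal

theorem l2norm_nonneg : 0 ≤ l2norm ν f := ENNReal.toReal_nonneg

theorem l2norm_congr_ae (h : f =ᵐ[ν] g) : l2norm ν f = l2norm ν g := by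
  rw [l2norm, eLpNorm_congr_ae h, l2norm]

theorem norm_toLp_eq_l2norm (hf : MemLp f 2 ν) : ‖hf.toLp f‖ = l2norm ν f := Lp.norm_toLp f hf

theorem l2norm_coeFn (f : Lp ℂ 2 ν) : l2norm ν f = ‖f‖ := rfl

theorem l2norm_add_le (hf : MemLp f 2 ν) (hg : MemLp g 2 ν) :
    l2norm ν (f + g) ≤ l2norm ν f + l2norm ν g := by
  rw [l2norm, l2norm, l2norm, ← ENNReal.toReal_add hf.2.ne hg.2.ne]
  exact ENNReal.toReal_mono (by simp [hf.2.ne, hg.2.ne])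
    (eLpNorm_add_le hf.1 hg.1 (by norm_num))

theorem l2norm_neg : l2norm ν (-f) = l2norm ν f := by
  rw [l2norm, eLpNorm_neg, l2norm]

theorem l2norm_sub_le (hf : MemLp f 2 ν) (hg : MemLp g 2 ν) :
    l2norm ν (f - g) ≤ l2norm ν f + l2norm ν g := by
  rw [sub_eq_add_neg, ← l2norm_neg (f := g)]
  exact l2norm_add_le hf hg.neg

theorem l2norm_zero : l2norm ν (0 : α → ℂ) = 0 := by simp [l2norm]

theorem l2norm_sum_le {ι : Type*} (s : Finset ι) {F : ι → α → ℂ} (hF : ∀ i ∈ s, MemLp (F i) 2 ν) :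
    l2norm ν (∑ i ∈ s, F i) ≤ ∑ i ∈ s, l2norm ν (F i) := by
  classical
  induction s using Finset.induction_on with
  | empty => simp [l2norm_zero]
  | insert a s ha ih =>
    rw [Finset.sum_insert ha, Finset.sum_insert ha]
    have h1 : ∀ i ∈ s, MemLp (F i) 2 ν := fun i hi => hF i (Finset.mem_insert_of_mem hi)
    exact (l2norm_add_le (hF a (Finset.mem_insert_self _ _)) (memLp_finsetSum' s h1)).trans
      (add_le_add le_rfl (ih h1))

theorem l2norm_le_mul (hg : MemLp g 2 ν) {C : ℝ} (hC : 0 ≤ C)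
    (h : ∀ᵐ x ∂ν, ‖f x‖ ≤ C * ‖g x‖) : l2norm ν f ≤ C * l2norm ν g := by
  have h1 : eLpNorm f 2 ν ≤ ENNReal.ofReal C * eLpNorm g 2 ν :=
    eLpNorm_le_mul_eLpNorm_of_ae_le_mul h 2
  have h2 := ENNReal.toReal_mono (ENNReal.mul_ne_top ENNReal.ofReal_ne_top hg.2.ne) h1
  rwa [ENNReal.toReal_mul, ENNReal.toReal_ofReal hC] at h2

theorem l2norm_restrict_le (s : Set α) (hf : MemLp f 2 ν) :
    l2norm (ν.restrict s) f ≤ l2norm ν f :=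
  ENNReal.toReal_mono hf.2.ne (eLpNorm_restrict_le f 2 ν s)

theorem l2norm_sq (hf : MemLp f 2 ν) : l2norm ν f ^ 2 = ∫ x, ‖f x‖ ^ 2 ∂ν := by
  rw [l2norm, hf.eLpNorm_eq_integral_rpow_norm (by norm_num) (by norm_num),
    ENNReal.toReal_ofReal (by positivity), ← Real.rpow_natCast, ← Real.rpow_mul]
  · simp
  · exact integral_nonneg fun x => by positivity

end L2Norm

/-! ### Elliptic operators with constant coefficients -/

section ConstantCoefficients

open SchwartzMap FourierTransform LineDeriv

/-- Complex-valued Schwartz functions on `ℝⁿ`. -/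
abbrev Schw (n : ℕ) : Type := 𝓢(EuclideanSpace ℝ (Fin n), ℂ)

variable {n : ℕ}

/-- The partial derivative `∂ᵢ` of Schwartz functions. -/
def schwPartial (i : Fin n) : Schw n →ₗ[ℂ] Schw n :=
  (lineDerivOpCLM ℂ (Schw n) (EuclideanSpace.single i (1 : ℝ))).toLinearMap

theorem schwPartial_eq (i : Fin n) (W : Schw n) :
    schwPartial i W = ∂_{EuclideanSpace.single i (1 : ℝ)} W := rfl

theorem coe_schwPartial (i : Fin n) (W : Schw n) :
    ⇑(schwPartial i W) = partialDeriv i W := rfl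

/-- The operator `∑ᵢⱼ Aᵢⱼ ∂ᵢ∂ⱼ` with constant real coefficients on Schwartz functions. -/
def constOp (A : Fin n → Fin n → ℝ) : Schw n →ₗ[ℂ] Schw n :=
  ∑ i, ∑ j, (A i j : ℂ) • (schwPartial i ∘ₗ schwPartial j)

/-- `∑ᵢⱼ Aᵢⱼ ∂ᵢ∂ⱼ - i m` on Schwartz functions. -/
def constOpShift (A : Fin n → Fin n → ℝ) (m : ℝ) : Schw n →ₗ[ℂ] Schw n :=
  constOp A - ((m : ℂ) * Complex.I) • LinearMap.id

theorem constOp_apply (A : Fin n → Fin n → ℝ) (W : Schw n) :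
    constOp A W = ∑ i, ∑ j, (A i j : ℂ) • schwPartial i (schwPartial j W) := by
  simp [constOp]

theorem constOpShift_apply (A : Fin n → Fin n → ℝ) (m : ℝ) (W : Schw n) :
    constOpShift A m W = constOp A W - ((m : ℂ) * Complex.I) • W := rfl

/-- The real quadratic form `∑ᵢⱼ Aᵢⱼ ξᵢ ξⱼ`. -/
def quadForm (A : Fin n → Fin n → ℝ) (ξ : EuclideanSpace ℝ (Fin n)) : ℝ :=
  ∑ i, ∑ j, A i j * ξ i * ξ j

/-- The symbol of `∑ᵢⱼ Aᵢⱼ ∂ᵢ∂ⱼ - i m`. -/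
def constSymbol (A : Fin n → Fin n → ℝ) (m : ℝ) (ξ : EuclideanSpace ℝ (Fin n)) : ℂ :=
  ⟨-(4 * Real.pi ^ 2 * quadForm A ξ), -m⟩

theorem fourier_schwPartial (W : Schw n) (i : Fin n) (ξ : EuclideanSpace ℝ (Fin n)) :
    𝓕 (schwPartial i W) ξ = (2 * Real.pi * Complex.I) * (ξ i : ℂ) * 𝓕 W ξ := by
  rw [schwPartial_eq, SchwartzMap.fourier_lineDerivOp_eq]
  have : (fun x : EuclideanSpace ℝ (Fin n) =>
    inner ℝ x (EuclideanSpace.single i (1 : ℝ))).HasTemperateGrowth := by fun_prop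
  rw [smul_apply, SchwartzMap.smulLeftCLM_apply_apply this]
  simp [EuclideanSpace.inner_single_right]
  ring

theorem fourier_constOpShift (A : Fin n → Fin n → ℝ) (m : ℝ)
    (W : Schw n) (ξ : EuclideanSpace ℝ (Fin n)) :
    𝓕 (constOpShift A m W) ξ = constSymbol A m ξ * 𝓕 W ξ := by
  have h1 : 𝓕 (constOpShift A m W) = (∑ i, ∑ j, (A i j : ℂ) •
      𝓕 (schwPartial i (schwPartial j W))) - ((m : ℂ) * Complex.I) • 𝓕 W := by
    rw [constOpShift_apply, constOp_apply]
    change fourierTransformCLM ℂ _ = _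
    rw [map_sub, map_sum, map_smul]
    simp only [map_sum, map_smul, fourierTransformCLM_apply]
  have h2 : constSymbol A m ξ =
      (-(4 * Real.pi ^ 2 * ∑ i, ∑ j, A i j * ξ i * ξ j) : ℝ) - (m : ℂ) * Complex.I := by
    apply Complex.ext
    · simp only [constSymbol, quadForm, Complex.sub_re, Complex.ofReal_re, Complex.mul_re,
        Complex.I_re, Complex.ofReal_im, Complex.I_im]
      ring
    · simp only [constSymbol, quadForm, Complex.sub_im, Complex.ofReal_re, Complex.mul_im,
        Complex.I_re, Complex.ofReal_im, Complex.I_im]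
      ring
  rw [h1, h2]
  simp only [sub_apply, smul_apply, sum_apply,
    fourier_schwPartial, smul_eq_mul, sub_mul]
  congr 1
  push_cast
  rw [Finset.mul_sum, ← Finset.sum_neg_distrib, Finset.sum_mul]
  refine Finset.sum_congr rfl fun i _ => ?_
  rw [Finset.mul_sum, ← Finset.sum_neg_distrib, Finset.sum_mul]
  refine Finset.sum_congr rfl fun j _ => ?_
  ring_nf
  simp

theorem l2norm_fourier (u : Schw n) : l2norm volume (𝓕 u : Schw n) = l2norm volume u := by
  have := SchwartzMap.norm_fourier_toL2_eq u
  rwa [SchwartzMap.norm_toLp, SchwartzMap.norm_toLp] at this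

theorem l2norm_le_of_fourier_le {f g : Schw n} {C : ℝ} (hC : 0 ≤ C)
    (h : ∀ ξ, ‖𝓕 f ξ‖ ≤ C * ‖𝓕 g ξ‖) : l2norm volume f ≤ C * l2norm volume g := by
  rw [← l2norm_fourier f, ← l2norm_fourier g]
  exact l2norm_le_mul ((𝓕 g).memLp 2 volume) hC (Filter.Eventually.of_forall h)

variable {A : Fin n → Fin n → ℝ} {c : ℝ}

theorem norm_sq_le_norm_constSymbol (hA : ∀ ξ, c * ‖ξ‖ ^ 2 ≤ |quadForm A ξ|) (m : ℝ)
    (ξ : EuclideanSpace ℝ (Fin n)) :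
    4 * Real.pi ^ 2 * (c * ‖ξ‖ ^ 2) ≤ ‖constSymbol A m ξ‖ := by
  refine le_trans ?_ (Complex.abs_re_le_norm _)
  rw [constSymbol, abs_neg, abs_mul, abs_of_nonneg (by positivity : 0 ≤ 4 * Real.pi ^ 2)]
  exact mul_le_mul_of_nonneg_left (hA ξ) (by positivity)

theorem abs_le_norm_constSymbol (m : ℝ) (ξ : EuclideanSpace ℝ (Fin n)) :
    |m| ≤ ‖constSymbol A m ξ‖ := by
  refine le_trans ?_ (Complex.abs_im_le_norm _)
  rw [constSymbol, abs_neg]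

theorem abs_apply_le_norm (ξ : EuclideanSpace ℝ (Fin n)) (i : Fin n) : |ξ i| ≤ ‖ξ‖ := by
  simpa using PiLp.norm_apply_le ξ i

/-- The inverse of `∑ᵢⱼ Aᵢⱼ ∂ᵢ∂ⱼ - i m` gains a factor `1 / |m|`. For its first derivatives the gain
is `1 / √|m|` by `l2norm_schwPartial_le`, and second derivatives are bounded uniformly in `m` by
`l2norm_schwPartial_schwPartial_le`. -/
theorem l2norm_le_constOpShift {m : ℝ} (hm : m ≠ 0) (W : Schw n) :
    l2norm volume W ≤ |m|⁻¹ * l2norm volume (constOpShift A m W) := by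
  refine l2norm_le_of_fourier_le (by positivity) fun ξ => ?_
  rw [fourier_constOpShift, norm_mul]
  have h1 := abs_le_norm_constSymbol (A := A) m ξ
  have hm' : 0 < |m| := abs_pos.mpr hm
  rw [← mul_assoc, inv_mul_eq_div]
  refine le_mul_of_one_le_left (norm_nonneg _) ?_
  rwa [one_le_div hm']

theorem norm_two_pi_I_mul (t : ℝ) : ‖(2 * Real.pi * Complex.I) * (t : ℂ)‖ = 2 * Real.pi * |t| := by
  simp [abs_of_pos Real.pi_pos]

theorem l2norm_schwPartial_schwPartial_le (hc : 0 < c) (hA : ∀ ξ, c * ‖ξ‖ ^ 2 ≤ |quadForm A ξ|)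
    (m : ℝ) (W : Schw n) (i j : Fin n) :
    l2norm volume (schwPartial i (schwPartial j W)) ≤
      c⁻¹ * l2norm volume (constOpShift A m W) := by
  refine l2norm_le_of_fourier_le (by positivity) fun ξ => ?_
  rw [fourier_constOpShift, fourier_schwPartial, fourier_schwPartial, ← mul_assoc,
    norm_mul, norm_mul (constSymbol A m ξ), ← mul_assoc c⁻¹]
  refine mul_le_mul_of_nonneg_right ?_ (norm_nonneg _)
  have h1 := norm_sq_le_norm_constSymbol hA m ξ
  refine le_trans ?_ (mul_le_mul_of_nonneg_left h1 (by positivity))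
  have : c⁻¹ * (4 * Real.pi ^ 2 * (c * ‖ξ‖ ^ 2)) = 4 * Real.pi ^ 2 * ‖ξ‖ ^ 2 := by
    field_simp
  rw [this, norm_mul, norm_two_pi_I_mul, norm_two_pi_I_mul]
  have h2 := mul_le_mul (abs_apply_le_norm ξ i) (abs_apply_le_norm ξ j) (abs_nonneg _)
    (norm_nonneg _)
  calc 2 * Real.pi * |ξ i| * (2 * Real.pi * |ξ j|) = 4 * Real.pi ^ 2 * (|ξ i| * |ξ j|) := by ring
    _ ≤ 4 * Real.pi ^ 2 * (‖ξ‖ * ‖ξ‖) := by gcongr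
    _ = _ := by ring

theorem l2norm_schwPartial_le (hc : 0 < c) (hA : ∀ ξ, c * ‖ξ‖ ^ 2 ≤ |quadForm A ξ|)
    {m : ℝ} (hm : m ≠ 0) (W : Schw n) (i : Fin n) :
    l2norm volume (schwPartial i W) ≤
      (√(c * |m|))⁻¹ * l2norm volume (constOpShift A m W) := by
  refine l2norm_le_of_fourier_le (by positivity) fun ξ => ?_
  rw [fourier_constOpShift, fourier_schwPartial,
    norm_mul, norm_mul _ (𝓕 W ξ), ← mul_assoc]
  refine mul_le_mul_of_nonneg_right ?_ (norm_nonneg _)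
  have h1 := norm_sq_le_norm_constSymbol hA m ξ
  have h2 := abs_le_norm_constSymbol (A := A) m ξ
  have hm' : 0 < |m| := abs_pos.mpr hm
  rw [inv_mul_eq_div, le_div_iff₀ (by positivity), norm_two_pi_I_mul]
  apply le_of_sq_le_sq _ (norm_nonneg _)
  rw [mul_pow, Real.sq_sqrt (by positivity)]
  have h3 : |ξ i| ^ 2 ≤ ‖ξ‖ ^ 2 := pow_le_pow_left₀ (abs_nonneg _) (abs_apply_le_norm ξ i) 2
  calc (2 * Real.pi * |ξ i|) ^ 2 * (c * |m|) = (4 * Real.pi ^ 2 * (c * |ξ i| ^ 2)) * |m| := by ring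
    _ ≤ (4 * Real.pi ^ 2 * (c * ‖ξ‖ ^ 2)) * |m| := by gcongr
    _ ≤ ‖constSymbol A m ξ‖ * ‖constSymbol A m ξ‖ := mul_le_mul h1 h2 hm'.le (norm_nonneg _)
    _ = _ := by ring

theorem constSymbol_ne_zero {m : ℝ} (hm : m ≠ 0) (ξ : EuclideanSpace ℝ (Fin n)) :
    constSymbol A m ξ ≠ 0 := by
  intro h
  have := congrArg Complex.im h
  exact hm (neg_eq_zero.mp this)

theorem continuous_constSymbol (A : Fin n → Fin n → ℝ) (m : ℝ) : Continuous (constSymbol A m) := by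
  have h : constSymbol A m = fun ξ => ((-(4 * Real.pi ^ 2 * quadForm A ξ) : ℝ) : ℂ) +
      ((-m : ℝ) : ℂ) * Complex.I := by
    funext ξ
    exact Complex.mk_eq_add_mul_I _ _
  rw [h]
  unfold quadForm
  fun_prop

/-- The inclusion of Schwartz functions in `L²(ℝⁿ)`. -/
def schwToL2 (n : ℕ) : Schw n →ₗ[ℂ] Lp ℂ 2 (volume : Measure (EuclideanSpace ℝ (Fin n))) :=
  (toLpCLM ℂ ℂ 2 (volume : Measure (EuclideanSpace ℝ (Fin n)))).toLinearMap

theorem schwToL2_apply (W : Schw n) : schwToL2 n W = W.toLp 2 volume := rfl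

/-- The range of `∑ᵢⱼ Aᵢⱼ ∂ᵢ∂ⱼ - i m` on Schwartz functions is dense in `L²(ℝⁿ)`: the Fourier
transform of a function orthogonal to the range is annihilated by a nowhere vanishing symbol. -/
theorem denseRange_constOpShift {m : ℝ} (hm : m ≠ 0) :
    DenseRange (schwToL2 n ∘ₗ constOpShift A m) := by
  refine denseRange_of_forall_inner_eq_zero _ fun z hz => ?_
  set y : Lp ℂ 2 (volume : Measure (EuclideanSpace ℝ (Fin n))) := 𝓕 z with hy
  have hae : ∀ᵐ ξ, conj (constSymbol A m ξ) * y ξ = 0 := by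
    refine ae_eq_zero_of_integral_contDiff_smul_eq_zero ?_ fun g hg hgs => ?_
    · have h1 : LocallyIntegrable y volume := (Lp.memLp y).locallyIntegrable (by norm_num)
      exact h1.continuous_mul (Complex.continuous_conj.comp (continuous_constSymbol A m))
    · have hg' : ContDiff ℝ ∞ (fun ξ => (g ξ : ℂ)) := Complex.ofRealCLM.contDiff.comp hg
      have hgs' : HasCompactSupport (fun ξ => (g ξ : ℂ)) :=
        hgs.comp_left (g := fun t : ℝ => (t : ℂ)) Complex.ofReal_zero
      set G : Schw n := hgs'.toSchwartzMap hg' with hG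
      have h1 := hz (𝓕⁻ G)
      rw [← Lp.inner_fourier_eq, LinearMap.comp_apply, schwToL2_apply,
        SchwartzMap.toLp_fourier_eq, MeasureTheory.L2.inner_def, ← hy] at h1
      rw [← h1]
      refine integral_congr_ae ?_
      filter_upwards [(𝓕 (constOpShift A m (𝓕⁻ G))).coeFn_toLp 2 volume] with ξ hξ
      rw [hξ, fourier_constOpShift, FourierTransform.fourier_fourierInv_eq]
      have : G ξ = (g ξ : ℂ) := rfl
      rw [this]
      simp only [RCLike.inner_apply, map_mul, Complex.conj_ofReal, Complex.real_smul]
      ring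
  have h0 : y = 0 := by
    rw [Lp.eq_zero_iff_ae_eq_zero]
    filter_upwards [hae] with ξ hξ
    simpa [constSymbol_ne_zero hm ξ] using hξ
  have := Lp.norm_fourier_eq z
  rw [← hy, h0, norm_zero] at this
  exact norm_eq_zero.mp this.symm

end ConstantCoefficients

/-! ### The whole space and half-spaces with Dirichlet conditions -/

section Cores

open SchwartzMap LineDeriv

variable {n : ℕ}

/-- A space `C` of Schwartz functions is adapted to the constant coefficient operator given by `A`
on the set `S` if the operator preserves `C`, if `L²` norms on `ℝⁿ` of functions of `C` are
controlled by `L²` norms on `S`, and if the operator shifted by `i m` maps `C` onto a dense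
subspace of `L²(S)`. The factor `2` leaves room for odd extension from a half-space. -/
structure IsAdaptedCore (A : Fin n → Fin n → ℝ) (S : Set (EuclideanSpace ℝ (Fin n)))
    (C : Submodule ℂ (Schw n)) : Prop where
  shift_mem : ∀ m, ∀ W ∈ C, constOpShift A m W ∈ C
  norm_le : ∀ W ∈ C, l2norm volume W ≤ 2 * l2norm (volume.restrict S) W
  dense : ∀ m : ℝ, m ≠ 0 → ∀ F : EuclideanSpace ℝ (Fin n) → ℂ, MemLp F 2 (volume.restrict S) →
    ∀ ε > 0, ∃ W ∈ C, l2norm (volume.restrict S) (⇑(constOpShift A m W) - F) ≤ ε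

theorem exists_l2norm_constOpShift_sub_le (A : Fin n → Fin n → ℝ) {m : ℝ} (hm : m ≠ 0)
    {F : EuclideanSpace ℝ (Fin n) → ℂ} (hF : MemLp F 2 volume) {ε : ℝ} (hε : 0 < ε) :
    ∃ W : Schw n, l2norm volume (⇑(constOpShift A m W) - F) ≤ ε := by
  obtain ⟨W, hW⟩ := Metric.denseRange_iff.mp (denseRange_constOpShift (A := A) hm) (hF.toLp F) ε hε
  refine ⟨W, ?_⟩
  rw [dist_comm, dist_eq_norm, LinearMap.comp_apply, schwToL2_apply] at hW
  have h1 := norm_toLp_eq_l2norm (((constOpShift A m W).memLp 2 volume).sub hF)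
  rw [← h1, MemLp.toLp_sub]
  exact hW.le

theorem isAdaptedCore_univ (A : Fin n → Fin n → ℝ) : IsAdaptedCore A Set.univ ⊤ where
  shift_mem := fun _ _ _ => Submodule.mem_top
  norm_le := fun W _ => by
    rw [Measure.restrict_univ]
    linarith [l2norm_nonneg (ν := (volume : Measure (EuclideanSpace ℝ (Fin n)))) (f := W)]
  dense := fun m hm F hF ε hε => by
    rw [Measure.restrict_univ] at hF ⊢
    obtain ⟨W, hW⟩ := exists_l2norm_constOpShift_sub_le A hm hF hε
    exact ⟨W, Submodule.mem_top, hW⟩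

/-- The column `k` of the matrix `A`, as a vector. -/
def column (A : Fin n → Fin n → ℝ) (k : Fin n) : EuclideanSpace ℝ (Fin n) :=
  ∑ i, A i k • EuclideanSpace.single i (1 : ℝ)

theorem column_apply (A : Fin n → Fin n → ℝ) (k i : Fin n) : column A k i = A i k := by
  simp [column, Finset.sum_apply, Pi.single_apply]

/-- The reflection in the hyperplane `yₖ = 0` which is orthogonal for the quadratic form `A⁻¹`:
it is the reflection which commutes with `∑ᵢⱼ Aᵢⱼ ∂ᵢ∂ⱼ`. -/
def reflection (A : Fin n → Fin n → ℝ) (k : Fin n) :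
    EuclideanSpace ℝ (Fin n) →L[ℝ] EuclideanSpace ℝ (Fin n) :=
  ContinuousLinearMap.id ℝ _ -
    (2 / A k k) • (EuclideanSpace.proj k : EuclideanSpace ℝ (Fin n) →L[ℝ] ℝ).smulRight (column A k)

theorem reflection_apply (A : Fin n → Fin n → ℝ) (k : Fin n) (y : EuclideanSpace ℝ (Fin n)) :
    reflection A k y = y - (2 / A k k) • y k • column A k := rfl

variable {A : Fin n → Fin n → ℝ} {k : Fin n}

theorem reflection_apply_self (hk : A k k ≠ 0) (y : EuclideanSpace ℝ (Fin n)) :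
    reflection A k y k = - y k := by
  rw [reflection_apply, PiLp.sub_apply, PiLp.smul_apply, PiLp.smul_apply, column_apply, smul_eq_mul,
    smul_eq_mul]
  field_simp
  ring

theorem reflection_reflection (hk : A k k ≠ 0) (y : EuclideanSpace ℝ (Fin n)) :
    reflection A k (reflection A k y) = y := by
  rw [reflection_apply, reflection_apply_self hk, reflection_apply, neg_smul, smul_neg]
  abel

/-- The reflection as a linear equivalence. -/
def reflectionEquiv (hk : A k k ≠ 0) :
    EuclideanSpace ℝ (Fin n) ≃L[ℝ] EuclideanSpace ℝ (Fin n) :=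
  ContinuousLinearEquiv.equivOfInverse (reflection A k) (reflection A k)
    (reflection_reflection hk) (reflection_reflection hk)

/-- The reflection is an involution, so its determinant has modulus `1`. -/
theorem measurePreserving_reflection (hk : A k k ≠ 0) :
    MeasurePreserving (reflection A k) volume volume := by
  refine ⟨(reflection A k).continuous.measurable, ?_⟩
  have hcomp : (reflection A k : EuclideanSpace ℝ (Fin n) →ₗ[ℝ] EuclideanSpace ℝ (Fin n)) ∘ₗ
      (reflection A k : EuclideanSpace ℝ (Fin n) →ₗ[ℝ] EuclideanSpace ℝ (Fin n)) =
        LinearMap.id := by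
    ext1 y
    exact reflection_reflection hk y
  have hdet := congrArg LinearMap.det hcomp
  rw [LinearMap.det_comp, LinearMap.det_id] at hdet
  have hne : LinearMap.det
      (reflection A k : EuclideanSpace ℝ (Fin n) →ₗ[ℝ] EuclideanSpace ℝ (Fin n)) ≠ 0 := by
    intro h
    rw [h] at hdet
    simp at hdet
  have habs : |LinearMap.det
      (reflection A k : EuclideanSpace ℝ (Fin n) →ₗ[ℝ] EuclideanSpace ℝ (Fin n))| = 1 := by
    have h2 := congrArg abs hdet
    rw [abs_mul, abs_one] at h2
    nlinarith [abs_nonneg (LinearMap.det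
      (reflection A k : EuclideanSpace ℝ (Fin n) →ₗ[ℝ] EuclideanSpace ℝ (Fin n)))]
  have := Measure.map_linearMap_addHaar_eq_smul_addHaar volume hne
  rw [abs_inv, habs] at this
  simpa using this

/-- Composition of Schwartz functions with the reflection. -/
def compReflection (hk : A k k ≠ 0) : Schw n →ₗ[ℂ] Schw n :=
  (compCLMOfContinuousLinearEquiv ℂ (reflectionEquiv hk)).toLinearMap

theorem compReflection_apply (hk : A k k ≠ 0) (W : Schw n) (y : EuclideanSpace ℝ (Fin n)) :
    compReflection hk W y = W (reflection A k y) := rfl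

theorem lineDerivOp_compReflection (hk : A k k ≠ 0) (m : EuclideanSpace ℝ (Fin n)) (W : Schw n) :
    ∂_{m} (compReflection hk W) = compReflection hk (∂_{reflection A k m} W) :=
  lineDerivOp_compCLMOfContinuousLinearEquiv ℂ m (reflectionEquiv hk) W

/-- The reflection preserves the tensor `∑ᵢⱼ Aᵢⱼ eᵢ ⊗ eⱼ`. -/
theorem sum_bilin_reflection {M : Type*} [AddCommGroup M] [Module ℝ M] (hk : A k k ≠ 0)
    (hsymm : ∀ i j, A i j = A j i)
    (B : EuclideanSpace ℝ (Fin n) →ₗ[ℝ] EuclideanSpace ℝ (Fin n) →ₗ[ℝ] M) :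
    ∑ i, ∑ j, A i j • B (reflection A k (EuclideanSpace.single i (1 : ℝ)))
      (reflection A k (EuclideanSpace.single j (1 : ℝ))) =
    ∑ i, ∑ j, A i j • B (EuclideanSpace.single i (1 : ℝ)) (EuclideanSpace.single j (1 : ℝ)) := by
  set a := column A k with ha
  set t := 2 / A k k with ht
  have hR (i : Fin n) : reflection A k (EuclideanSpace.single i (1 : ℝ)) =
      EuclideanSpace.single i (1 : ℝ) - (if k = i then t else 0) • a := by
    rw [reflection_apply, PiLp.single_apply, ← ht, ← ha]
    split_ifs <;> simp
  have h1 : ∑ j, A k j • B a (EuclideanSpace.single j (1 : ℝ)) = B a a := by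
    have : B a a = B a (∑ i, A i k • EuclideanSpace.single i (1 : ℝ)) := rfl
    simp_rw [this, map_sum, map_smul, hsymm k]
  have h2 : ∑ i, A i k • B (EuclideanSpace.single i (1 : ℝ)) a = B a a := by
    have : B a a = B (∑ i, A i k • EuclideanSpace.single i (1 : ℝ)) a := rfl
    simp [this, LinearMap.sum_apply]
  have h3 (i j : Fin n) : A i j • B (reflection A k (EuclideanSpace.single i (1 : ℝ)))
      (reflection A k (EuclideanSpace.single j (1 : ℝ))) =
      A i j • B (EuclideanSpace.single i (1 : ℝ)) (EuclideanSpace.single j (1 : ℝ)) -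
      (if k = i then t • A k j • B a (EuclideanSpace.single j (1 : ℝ)) else 0) -
      (if k = j then t • A i k • B (EuclideanSpace.single i (1 : ℝ)) a else 0) +
      (if k = i then (if k = j then (t * t * A k k) • B a a else 0) else 0) := by
    rw [hR, hR]
    by_cases hi : k = i <;> by_cases hj : k = j
    · subst hi
      subst hj
      simp only [if_true, map_sub, LinearMap.sub_apply, map_smul, LinearMap.smul_apply]
      module
    · subst hi
      simp only [hj, if_true, if_false, map_sub, LinearMap.sub_apply, map_smul,
        LinearMap.smul_apply, zero_smul, map_zero]
      module
    · subst hj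
      simp only [hi, if_true, if_false, map_sub, LinearMap.sub_apply, map_smul,
        zero_smul, map_zero, LinearMap.zero_apply]
      module
    · simp [hi, hj]
  simp_rw [h3, Finset.sum_add_distrib, Finset.sum_sub_distrib]
  have e1 : ∑ i, ∑ j, (if k = i then t • A k j • B a (EuclideanSpace.single j (1 : ℝ)) else 0) =
      t • B a a := by
    rw [Finset.sum_comm]
    simp only [Finset.sum_ite_eq, Finset.mem_univ, if_true]
    rw [← Finset.smul_sum, h1]
  have e2 : ∑ i, ∑ j, (if k = j then t • A i k • B (EuclideanSpace.single i (1 : ℝ)) a else 0) =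
      t • B a a := by
    simp only [Finset.sum_ite_eq, Finset.mem_univ, if_true]
    rw [← Finset.smul_sum, h2]
  have e3 : ∑ i, ∑ j, (if k = i then (if k = j then (t * t * A k k) • B a a else 0) else 0) =
      (t * t * A k k) • B a a := by
    rw [Finset.sum_comm]
    simp
  rw [e1, e2, e3]
  have : t * t * A k k = 2 * t := by
    rw [ht]; field_simp
  rw [this]
  module

theorem constOp_compReflection (hk : A k k ≠ 0) (hsymm : ∀ i j, A i j = A j i) (W : Schw n) :
    constOp A (compReflection hk W) = compReflection hk (constOp A W) := by
  have h := sum_bilin_reflection hk hsymm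
    (bilinearLineDerivTwo ℝ (E := EuclideanSpace ℝ (Fin n)) W)
  rw [constOp_apply, constOp_apply]
  simp only [schwPartial_eq, lineDerivOp_compReflection, map_sum, map_smul]
  have h' := congrArg (compReflection hk) h
  simp only [map_sum] at h'
  have hc (r : ℝ) (V : Schw n) : compReflection hk (r • V) = (r : ℂ) • compReflection hk V := by
    rw [← map_smul, Complex.coe_smul]
  simp only [hc] at h'
  exact h'

theorem constOpShift_compReflection (hk : A k k ≠ 0) (hsymm : ∀ i j, A i j = A j i) (m : ℝ)
    (W : Schw n) :
    constOpShift A m (compReflection hk W) = compReflection hk (constOpShift A m W) := by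
  rw [constOpShift_apply, constOpShift_apply, constOp_compReflection hk hsymm, map_sub, map_smul]

/-- The open half-space `yₖ > 0`. -/
def halfSpace (k : Fin n) : Set (EuclideanSpace ℝ (Fin n)) := {y | 0 < y k}

theorem isOpen_halfSpace (k : Fin n) : IsOpen (halfSpace k) :=
  isOpen_lt continuous_const (EuclideanSpace.proj k : EuclideanSpace ℝ (Fin n) →L[ℝ] ℝ).continuous

/-- Schwartz functions which are odd for the reflection. -/
def oddSchw (hk : A k k ≠ 0) : Submodule ℂ (Schw n) :=
  LinearMap.ker (compReflection hk + LinearMap.id)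

theorem mem_oddSchw (hk : A k k ≠ 0) (W : Schw n) :
    W ∈ oddSchw hk ↔ compReflection hk W = - W := by
  rw [oddSchw, LinearMap.mem_ker, LinearMap.add_apply, LinearMap.id_apply, add_eq_zero_iff_eq_neg]

theorem oddSchw_apply_reflection {hk : A k k ≠ 0} {W : Schw n} (hW : W ∈ oddSchw hk)
    (y : EuclideanSpace ℝ (Fin n)) : W (reflection A k y) = - W y := by
  rw [← compReflection_apply hk, (mem_oddSchw hk W).mp hW]; rfl

/-- Odd functions satisfy the Dirichlet condition. -/
theorem oddSchw_apply_eq_zero {hk : A k k ≠ 0} {W : Schw n} (hW : W ∈ oddSchw hk)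
    {y : EuclideanSpace ℝ (Fin n)} (hy : y k = 0) : W y = 0 := by
  have h := oddSchw_apply_reflection hW y
  rw [reflection_apply, hy, zero_smul, smul_zero, sub_zero] at h
  exact self_eq_neg.mp h

theorem l2norm_comp_reflection (hk : A k k ≠ 0) {f : EuclideanSpace ℝ (Fin n) → ℂ}
    (hf : MemLp f 2 volume) : l2norm volume (f ∘ reflection A k) = l2norm volume f := by
  rw [l2norm, eLpNorm_comp_measurePreserving hf.1 (measurePreserving_reflection hk), l2norm]

theorem l2norm_indicator {α : Type*} [MeasurableSpace α] {ν : Measure α} {s : Set α}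
    (hs : MeasurableSet s) (f : α → ℂ) :
    l2norm ν (s.indicator f) = l2norm (ν.restrict s) f := by
  rw [l2norm, eLpNorm_indicator_eq_eLpNorm_restrict hs, l2norm]

/-- Odd Schwartz functions form an adapted core in the half-space. -/
theorem isAdaptedCore_halfSpace (hk : A k k ≠ 0) (hsymm : ∀ i j, A i j = A j i) :
    IsAdaptedCore A (halfSpace k) (oddSchw hk) where
  shift_mem := fun m W hW => by
    rw [mem_oddSchw] at hW ⊢
    rw [← constOpShift_compReflection hk hsymm, hW, map_neg]
  norm_le := fun W hW => by
    have hmeas := (isOpen_halfSpace k).measurableSet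
    set G := (halfSpace k).indicator W with hG
    have hGm : MemLp G 2 volume := (W.memLp 2 volume).indicator hmeas
    have heq : (W : EuclideanSpace ℝ (Fin n) → ℂ) = G - G ∘ reflection A k := by
      funext y
      rw [Pi.sub_apply, Function.comp_apply, hG]
      rcases lt_trichotomy (y k) 0 with h | h | h
      · have h1 : y ∉ halfSpace k := fun h' => lt_asymm h h'
        have h2 : reflection A k y ∈ halfSpace k := by
          change 0 < reflection A k y k
          rw [reflection_apply_self hk]; linarith
        rw [Set.indicator_of_notMem h1, Set.indicator_of_mem h2, oddSchw_apply_reflection hW]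
        ring
      · have h1 : y ∉ halfSpace k := fun h' => h'.ne' h
        have h2 : reflection A k y ∉ halfSpace k := by
          intro h'
          change 0 < reflection A k y k at h'
          rw [reflection_apply_self hk] at h'; linarith
        rw [Set.indicator_of_notMem h1, Set.indicator_of_notMem h2, oddSchw_apply_eq_zero hW h]
        ring
      · have h1 : y ∈ halfSpace k := h
        have h2 : reflection A k y ∉ halfSpace k := by
          intro h'
          change 0 < reflection A k y k at h'
          rw [reflection_apply_self hk] at h'; linarith
        rw [Set.indicator_of_mem h1, Set.indicator_of_notMem h2]
        ring
    have h1 := l2norm_sub_le hGm (hGm.comp_measurePreserving (measurePreserving_reflection hk))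
    rw [← heq, l2norm_comp_reflection hk hGm, hG, l2norm_indicator hmeas] at h1
    linarith
  dense := fun m hm F hF ε hε => by
    have hmeas := (isOpen_halfSpace k).measurableSet
    set F' := (halfSpace k).indicator F with hF'
    have hF'm : MemLp F' 2 volume := (memLp_indicator_iff_restrict hmeas).mpr hF
    obtain ⟨W, hW⟩ := exists_l2norm_constOpShift_sub_le A hm hF'm (half_pos hε)
    -- Solve for the extension of `F` by zero, and take twice the odd part of the solution.
    refine ⟨W - compReflection hk W, ?_, ?_⟩
    · rw [mem_oddSchw, map_sub]
      have : compReflection hk (compReflection hk W) = W := by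
        ext y
        rw [compReflection_apply, compReflection_apply, reflection_reflection hk]
      rw [this, neg_sub]
    · set D := ⇑(constOpShift A m W) - F' with hD
      have hDm : MemLp D 2 volume := ((constOpShift A m W).memLp 2 volume).sub hF'm
      have hae : (⇑(constOpShift A m (W - compReflection hk W)) - F)
          =ᵐ[volume.restrict (halfSpace k)] D - D ∘ reflection A k := by
        refine (ae_restrict_iff' hmeas).mpr (Filter.Eventually.of_forall fun y hy => ?_)
        have h2 : reflection A k y ∉ halfSpace k := by
          intro h'
          change 0 < reflection A k y k at h'
          change 0 < y k at hy
          rw [reflection_apply_self hk] at h'; linarith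
        rw [map_sub, constOpShift_compReflection hk hsymm]
        simp only [Pi.sub_apply, Function.comp_apply, hD, hF', Set.indicator_of_mem hy,
          Set.indicator_of_notMem h2, sub_apply, compReflection_apply]
        ring
      have hDr := hDm.comp_measurePreserving (measurePreserving_reflection hk)
      rw [l2norm_congr_ae hae]
      have h3 := l2norm_restrict_le (halfSpace k) (hDm.sub hDr)
      have h4 := l2norm_sub_le hDm hDr
      rw [l2norm_comp_reflection hk hDm] at h4
      linarith

end Cores

/-! ### Operators with variable coefficients close to constant ones -/

section VariableCoefficients

/-- The linear map to `L²` induced by a linear map to square integrable functions. -/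
def toL2Map {α V : Type*} [MeasurableSpace α] {ν : Measure α} [AddCommMonoid V] [Module ℂ V]
    (L : V →ₗ[ℂ] (α → ℂ)) (h : ∀ v, MemLp (L v) 2 ν) : V →ₗ[ℂ] Lp ℂ 2 ν where
  toFun v := (h v).toLp (L v)
  map_add' u v := by
    rw [← MemLp.toLp_add (h u) (h v)]
    simp only [map_add]
  map_smul' k v := by
    rw [RingHom.id_apply, ← MemLp.toLp_const_smul k (h v)]
    simp only [map_smul]

theorem norm_toL2Map {α V : Type*} [MeasurableSpace α] {ν : Measure α} [AddCommMonoid V]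
    [Module ℂ V] (L : V →ₗ[ℂ] (α → ℂ)) (h : ∀ v, MemLp (L v) 2 ν) (v : V) :
    ‖toL2Map L h v‖ = l2norm ν (L v) := norm_toLp_eq_l2norm (h v)

theorem coeFn_toL2Map {α V : Type*} [MeasurableSpace α] {ν : Measure α} [AddCommMonoid V]
    [Module ℂ V] (L : V →ₗ[ℂ] (α → ℂ)) (h : ∀ v, MemLp (L v) 2 ν) (v : V) :
    toL2Map L h v =ᵐ[ν] L v := MemLp.coeFn_toLp (h v)

variable {n : ℕ}

/-- The differential expression `∑ᵢⱼ aᵢⱼ ∂ᵢ∂ⱼ f + ∑ᵢ bᵢ ∂ᵢ f + c f`. -/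
def diffExpr (a : Fin n → Fin n → EuclideanSpace ℝ (Fin n) → ℂ)
    (b : Fin n → EuclideanSpace ℝ (Fin n) → ℂ) (c : EuclideanSpace ℝ (Fin n) → ℂ)
    (f : EuclideanSpace ℝ (Fin n) → ℂ) (y : EuclideanSpace ℝ (Fin n)) : ℂ :=
  ∑ i, ∑ j, a i j y * partialDeriv i (partialDeriv j f) y + ∑ i, b i y * partialDeriv i f y
    + c y * f y

/-- A differential expression as a linear map on Schwartz functions. -/
def schwDiffExpr (a : Fin n → Fin n → EuclideanSpace ℝ (Fin n) → ℂ)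
    (b : Fin n → EuclideanSpace ℝ (Fin n) → ℂ) (c : EuclideanSpace ℝ (Fin n) → ℂ) :
    Schw n →ₗ[ℂ] (EuclideanSpace ℝ (Fin n) → ℂ) where
  toFun W := diffExpr a b c W
  map_add' W V := by
    funext y
    simp only [diffExpr, ← coe_schwPartial, Pi.add_apply, map_add, add_apply, mul_add,
      Finset.sum_add_distrib]
    ring
  map_smul' k W := by
    funext y
    simp only [diffExpr, ← coe_schwPartial, Pi.smul_apply, map_smul, smul_apply, smul_eq_mul,
      RingHom.id_apply, mul_add, Finset.mul_sum]
    congr 1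
    · congr 1
      · exact Finset.sum_congr rfl fun i _ => Finset.sum_congr rfl fun j _ => by ring
      · exact Finset.sum_congr rfl fun i _ => by ring
    · ring

theorem schwDiffExpr_eq_sum (a : Fin n → Fin n → EuclideanSpace ℝ (Fin n) → ℂ)
    (b : Fin n → EuclideanSpace ℝ (Fin n) → ℂ) (c : EuclideanSpace ℝ (Fin n) → ℂ) (W : Schw n) :
    schwDiffExpr a b c W = ∑ i, ∑ j, a i j * ⇑(schwPartial i (schwPartial j W)) +
      ∑ i, b i * ⇑(schwPartial i W) + c * ⇑W := by
  funext y
  simp only [Pi.add_apply, Finset.sum_apply, Pi.mul_apply]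
  rfl

theorem memLp_mul_of_bound {α : Type*} [MeasurableSpace α] {ν : Measure α} {f g : α → ℂ} {K : ℝ}
    (hf : AEStronglyMeasurable f ν) (hK : ∀ᵐ x ∂ν, ‖f x‖ ≤ K) (hg : MemLp g 2 ν) :
    MemLp (f * g) 2 ν := by
  refine MemLp.of_le_mul (c := K) hg (hf.mul hg.1) ?_
  filter_upwards [hK] with x hx
  rw [Pi.mul_apply, norm_mul]
  exact mul_le_mul_of_nonneg_right hx (norm_nonneg _)

theorem l2norm_mul_le {α : Type*} [MeasurableSpace α] {ν : Measure α} {f g : α → ℂ} {K : ℝ}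
    (hK0 : 0 ≤ K) (hK : ∀ᵐ x ∂ν, ‖f x‖ ≤ K) (hg : MemLp g 2 ν) :
    l2norm ν (f * g) ≤ K * l2norm ν g := by
  refine l2norm_le_mul hg hK0 ?_
  filter_upwards [hK] with x hx
  rw [Pi.mul_apply, norm_mul]
  exact mul_le_mul_of_nonneg_right hx (norm_nonneg _)

variable {a : Fin n → Fin n → EuclideanSpace ℝ (Fin n) → ℂ}
  {b : Fin n → EuclideanSpace ℝ (Fin n) → ℂ} {c : EuclideanSpace ℝ (Fin n) → ℂ}
  {S : Set (EuclideanSpace ℝ (Fin n))}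

theorem schw_memLp_restrict (S : Set (EuclideanSpace ℝ (Fin n))) (W : Schw n) :
    MemLp W 2 (volume.restrict S) := (W.memLp 2 volume).restrict S

theorem memLp_schwDiffExpr {δ K : ℝ} (hac : ∀ i j, Continuous (a i j))
    (hbc : ∀ i, Continuous (b i)) (hcc : Continuous c)
    (ha : ∀ i j y, ‖a i j y‖ ≤ δ) (hb : ∀ i y, ‖b i y‖ ≤ K) (hc : ∀ y, ‖c y‖ ≤ K)
    (W : Schw n) : MemLp (schwDiffExpr a b c W) 2 (volume.restrict S) := by
  rw [schwDiffExpr_eq_sum]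
  refine ((memLp_finsetSum' _ fun i _ => memLp_finsetSum' _ fun j _ => ?_).add
    (memLp_finsetSum' _ fun i _ => ?_)).add ?_
  · exact memLp_mul_of_bound (hac i j).aestronglyMeasurable
      (Filter.Eventually.of_forall (ha i j)) (schw_memLp_restrict S _)
  · exact memLp_mul_of_bound (hbc i).aestronglyMeasurable
      (Filter.Eventually.of_forall (hb i)) (schw_memLp_restrict S _)
  · exact memLp_mul_of_bound hcc.aestronglyMeasurable
      (Filter.Eventually.of_forall hc) (schw_memLp_restrict S _)

theorem l2norm_schwDiffExpr_le {δ K : ℝ} (hδ : 0 ≤ δ) (hK : 0 ≤ K)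
    (hac : ∀ i j, Continuous (a i j)) (hbc : ∀ i, Continuous (b i)) (hcc : Continuous c)
    (ha : ∀ i j y, ‖a i j y‖ ≤ δ) (hb : ∀ i y, ‖b i y‖ ≤ K) (hc : ∀ y, ‖c y‖ ≤ K)
    (W : Schw n) : l2norm (volume.restrict S) (schwDiffExpr a b c W) ≤
      δ * (∑ i, ∑ j, l2norm (volume.restrict S) (schwPartial i (schwPartial j W))) +
      K * (∑ i, l2norm (volume.restrict S) (schwPartial i W)) +
      K * l2norm (volume.restrict S) W := by
  rw [schwDiffExpr_eq_sum]
  have m1 (i j) : MemLp (a i j * ⇑(schwPartial i (schwPartial j W))) 2 (volume.restrict S) :=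
    memLp_mul_of_bound (hac i j).aestronglyMeasurable
      (Filter.Eventually.of_forall (ha i j)) (schw_memLp_restrict S _)
  have m2 (i) : MemLp (b i * ⇑(schwPartial i W)) 2 (volume.restrict S) :=
    memLp_mul_of_bound (hbc i).aestronglyMeasurable
      (Filter.Eventually.of_forall (hb i)) (schw_memLp_restrict S _)
  have m3 : MemLp (c * ⇑W) 2 (volume.restrict S) :=
    memLp_mul_of_bound hcc.aestronglyMeasurable
      (Filter.Eventually.of_forall hc) (schw_memLp_restrict S _)
  have m1' (i) := memLp_finsetSum' (Finset.univ : Finset (Fin n)) fun j _ => m1 i j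
  have m1'' := memLp_finsetSum' (Finset.univ : Finset (Fin n)) fun i _ => m1' i
  have m2' := memLp_finsetSum' (Finset.univ : Finset (Fin n)) fun i _ => m2 i
  refine (l2norm_add_le (m1''.add m2') m3).trans (add_le_add
    ((l2norm_add_le m1'' m2').trans (add_le_add ?_ ?_)) ?_)
  · refine (l2norm_sum_le _ fun i _ => m1' i).trans ?_
    rw [Finset.mul_sum]
    refine Finset.sum_le_sum fun i _ => (l2norm_sum_le _ fun j _ => m1 i j).trans ?_
    rw [Finset.mul_sum]
    exact Finset.sum_le_sum fun j _ => l2norm_mul_le hδ (Filter.Eventually.of_forall (ha i j))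
      (schw_memLp_restrict S _)
  · refine (l2norm_sum_le _ fun i _ => m2 i).trans ?_
    rw [Finset.mul_sum]
    exact Finset.sum_le_sum fun i _ => l2norm_mul_le hK (Filter.Eventually.of_forall (hb i))
      (schw_memLp_restrict S _)
  · exact l2norm_mul_le hK (Filter.Eventually.of_forall hc) (schw_memLp_restrict S _)

variable {A : Fin n → Fin n → ℝ} {c₀ : ℝ} {C : Submodule ℂ (Schw n)}

theorem IsAdaptedCore.l2norm_schwPartial_schwPartial_le (hC : IsAdaptedCore A S C) (hc₀ : 0 < c₀)
    (hA : ∀ ξ, c₀ * ‖ξ‖ ^ 2 ≤ |quadForm A ξ|) (m : ℝ) {W : Schw n} (hW : W ∈ C) (i j : Fin n) :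
    l2norm (volume.restrict S) (schwPartial i (schwPartial j W)) ≤
      2 * c₀⁻¹ * l2norm (volume.restrict S) (constOpShift A m W) := by
  calc _ ≤ l2norm volume (schwPartial i (schwPartial j W)) :=
        l2norm_restrict_le S (SchwartzMap.memLp _ 2 volume)
    _ ≤ c₀⁻¹ * l2norm volume (constOpShift A m W) :=
        ESALoc.l2norm_schwPartial_schwPartial_le hc₀ hA m W i j
    _ ≤ c₀⁻¹ * (2 * l2norm (volume.restrict S) (constOpShift A m W)) := by
        gcongr
        exact hC.norm_le _ (hC.shift_mem m W hW)
    _ = _ := by ring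

theorem IsAdaptedCore.l2norm_schwPartial_le (hC : IsAdaptedCore A S C) (hc₀ : 0 < c₀)
    (hA : ∀ ξ, c₀ * ‖ξ‖ ^ 2 ≤ |quadForm A ξ|) {m : ℝ} (hm : 1 ≤ |m|) {W : Schw n} (hW : W ∈ C)
    (i : Fin n) : l2norm (volume.restrict S) (schwPartial i W) ≤
      2 * (1 + (√c₀)⁻¹) / √|m| * l2norm (volume.restrict S) (constOpShift A m W) := by
  have hm0 : m ≠ 0 := by
    rintro rfl
    norm_num at hm
  calc _ ≤ l2norm volume (schwPartial i W) :=
        l2norm_restrict_le S (SchwartzMap.memLp _ 2 volume)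
    _ ≤ (√(c₀ * |m|))⁻¹ * l2norm volume (constOpShift A m W) :=
        ESALoc.l2norm_schwPartial_le hc₀ hA hm0 W i
    _ ≤ (√(c₀ * |m|))⁻¹ * (2 * l2norm (volume.restrict S) (constOpShift A m W)) := by
        gcongr
        exact hC.norm_le _ (hC.shift_mem m W hW)
    _ = 2 * (√c₀)⁻¹ / √|m| * l2norm (volume.restrict S) (constOpShift A m W) := by
        rw [Real.sqrt_mul hc₀.le, mul_inv]; ring
    _ ≤ _ := by
        have := l2norm_nonneg (ν := volume.restrict S) (f := constOpShift A m W)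
        gcongr
        linarith

theorem IsAdaptedCore.l2norm_le (hC : IsAdaptedCore A S C) (c₀ : ℝ)
    {m : ℝ} (hm : 1 ≤ |m|) {W : Schw n} (hW : W ∈ C) :
    l2norm (volume.restrict S) W ≤
      2 * (1 + (√c₀)⁻¹) / √|m| * l2norm (volume.restrict S) (constOpShift A m W) := by
  have hm0 : m ≠ 0 := by
    rintro rfl
    norm_num at hm
  have hpos := l2norm_nonneg (ν := volume.restrict S) (f := constOpShift A m W)
  have hs : 1 ≤ √|m| := by rwa [Real.one_le_sqrt]
  calc _ ≤ l2norm volume W := l2norm_restrict_le S (SchwartzMap.memLp _ 2 volume)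
    _ ≤ |m|⁻¹ * l2norm volume (constOpShift A m W) := l2norm_le_constOpShift hm0 W
    _ ≤ |m|⁻¹ * (2 * l2norm (volume.restrict S) (constOpShift A m W)) := by
        gcongr
        exact hC.norm_le _ (hC.shift_mem m W hW)
    _ ≤ (√|m|)⁻¹ * (2 * l2norm (volume.restrict S) (constOpShift A m W)) := by
        gcongr
        calc √|m| ≤ √|m| * √|m| := le_mul_of_one_le_left (by positivity) hs
          _ = |m| := Real.mul_self_sqrt (abs_nonneg _)
    _ = 2 * (1 + 0) / √|m| * l2norm (volume.restrict S) (constOpShift A m W) := by ring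
    _ ≤ _ := by
        gcongr
        positivity

/-- Solvability, up to small errors and with estimates, for a small perturbation of an elliptic
operator with constant coefficients: the Kato–Rellich argument. -/
theorem IsAdaptedCore.exists_approx_solution (hC : IsAdaptedCore A S C) (hc₀ : 0 < c₀)
    (hA : ∀ ξ, c₀ * ‖ξ‖ ^ 2 ≤ |quadForm A ξ|) {δ K : ℝ} (hδ : 0 ≤ δ) (hK : 0 ≤ K)
    (hδc : δ * (n * n) * (2 * c₀⁻¹) ≤ 1 / 4)
    (hac : ∀ i j, Continuous (a i j)) (hbc : ∀ i, Continuous (b i)) (hcc : Continuous c)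
    (ha : ∀ i j y, ‖a i j y‖ ≤ δ) (hb : ∀ i y, ‖b i y‖ ≤ K) (hc : ∀ y, ‖c y‖ ≤ K) :
    ∃ M > 0, ∃ m₀ ≥ (1 : ℝ), ∀ m : ℝ, m₀ ≤ |m| → ∀ F : EuclideanSpace ℝ (Fin n) → ℂ,
      MemLp F 2 (volume.restrict S) → ∀ ε > 0, ∃ W ∈ C,
        l2norm (volume.restrict S) (⇑(constOpShift A m W) + schwDiffExpr a b c W - F) ≤ ε ∧
        l2norm (volume.restrict S) W ≤ M / √|m| * (l2norm (volume.restrict S) F + ε) ∧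
        ∀ i, l2norm (volume.restrict S) (schwPartial i W) ≤
          M / √|m| * (l2norm (volume.restrict S) F + ε) := by
  -- `M₁ / √|m|` bounds `W` and its first derivatives. For `√|m| ≥ Q` the terms of order at most one
  -- contribute at most a quarter, as do the terms of order two, by the choice of `δ`.
  set M₁ := 2 * (1 + (√c₀)⁻¹) with hM₁
  have hM₁pos : 0 < M₁ := by positivity
  set Q := 4 * (K * n * M₁ + K * M₁) with hQ
  have hQ0 : 0 ≤ Q := by positivity
  refine ⟨2 * M₁, by positivity, 1 + Q ^ 2, by nlinarith [sq_nonneg Q], fun m hm F hF ε hε => ?_⟩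
  have hm1 : 1 ≤ |m| := le_trans (by nlinarith [sq_nonneg Q]) hm
  have hm0 : m ≠ 0 := by
    rintro rfl
    norm_num at hm1
  have hs : Q ≤ √|m| := Real.le_sqrt_of_sq_le (by linarith)
  have hspos : 0 < √|m| := Real.sqrt_pos.mpr (by linarith)
  have hBM : ∀ W, MemLp (schwDiffExpr a b c W) 2 (volume.restrict S) :=
    memLp_schwDiffExpr hac hbc hcc ha hb hc
  have hhalf (W : Schw n) (hW : W ∈ C) : l2norm (volume.restrict S) (schwDiffExpr a b c W) ≤
      1 / 2 * l2norm (volume.restrict S) (constOpShift A m W) := by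
    refine (l2norm_schwDiffExpr_le hδ hK hac hbc hcc ha hb hc W).trans ?_
    set t := l2norm (volume.restrict S) (constOpShift A m W) with ht
    have ht0 : 0 ≤ t := l2norm_nonneg
    have e1 : δ * (∑ i, ∑ j, l2norm (volume.restrict S) (schwPartial i (schwPartial j W))) ≤
        1 / 4 * t := by
      calc _ ≤ δ * (∑ i : Fin n, ∑ j : Fin n, 2 * c₀⁻¹ * t) := by
            gcongr with i _ j _
            exact hC.l2norm_schwPartial_schwPartial_le hc₀ hA m hW i j
        _ = δ * (n * n) * (2 * c₀⁻¹) * t := by simp; ring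
        _ ≤ _ := by gcongr
    have e2 : K * (∑ i, l2norm (volume.restrict S) (schwPartial i W)) ≤
        K * n * M₁ / √|m| * t := by
      calc _ ≤ K * (∑ i : Fin n, M₁ / √|m| * t) := by
            gcongr with i _
            exact hC.l2norm_schwPartial_le hc₀ hA hm1 hW i
        _ = _ := by simp; ring
    have e3 : K * l2norm (volume.restrict S) W ≤ K * M₁ / √|m| * t := by
      calc _ ≤ K * (M₁ / √|m| * t) := by
            gcongr
            exact hC.l2norm_le c₀ hm1 hW
        _ = _ := by ring
    have e4 : K * n * M₁ / √|m| * t + K * M₁ / √|m| * t ≤ 1 / 4 * t := by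
      rw [← add_mul, ← add_div]
      refine mul_le_mul_of_nonneg_right ?_ ht0
      rw [div_le_iff₀ hspos]
      linarith
    linarith
  have hTM : ∀ W : Schw n, MemLp (constOpShift A m W) 2 (volume.restrict S) :=
    fun W => schw_memLp_restrict S _
  let coeLin : Schw n →ₗ[ℂ] (EuclideanSpace ℝ (Fin n) → ℂ) :=
    { toFun := fun W => ⇑W, map_add' := fun _ _ => rfl, map_smul' := fun _ _ => rfl }
  let T : C →ₗ[ℂ] Lp ℂ 2 (volume.restrict S) :=
    toL2Map (coeLin ∘ₗ constOpShift A m) hTM ∘ₗ C.subtype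
  let B : C →ₗ[ℂ] Lp ℂ 2 (volume.restrict S) := toL2Map (schwDiffExpr a b c) hBM ∘ₗ C.subtype
  have hTn (W : C) : ‖T W‖ = l2norm (volume.restrict S) (constOpShift A m (W : Schw n)) :=
    norm_toL2Map (coeLin ∘ₗ constOpShift A m) hTM W
  have hBn (W : C) : ‖B W‖ = l2norm (volume.restrict S) (schwDiffExpr a b c (W : Schw n)) :=
    norm_toL2Map (schwDiffExpr a b c) hBM W
  have hT : DenseRange T := by
    rw [Metric.denseRange_iff]
    intro f r hr
    obtain ⟨W, hW, hWf⟩ := hC.dense m hm0 f (Lp.memLp f) (r / 2) (by positivity)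
    refine ⟨⟨W, hW⟩, ?_⟩
    rw [dist_comm, dist_eq_norm, ← l2norm_coeFn]
    have hae : (T ⟨W, hW⟩ - f : Lp ℂ 2 (volume.restrict S)) =ᵐ[volume.restrict S]
        ⇑(constOpShift A m W) - f :=
      (Lp.coeFn_sub _ _).trans ((coeFn_toL2Map (coeLin ∘ₗ constOpShift A m) hTM W).sub
        (Filter.EventuallyEq.refl _ _))
    rw [l2norm_congr_ae hae]
    linarith
  have hTB := denseRange_add_of_norm_le_half T B hT fun v => by
    rw [hTn, hBn]
    exact hhalf _ v.2
  obtain ⟨⟨W, hW⟩, hWF⟩ := Metric.denseRange_iff.mp hTB (hF.toLp F) ε hε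
  have hWF' : l2norm (volume.restrict S)
      (⇑(constOpShift A m W) + schwDiffExpr a b c W - F) ≤ ε := by
    rw [dist_comm, dist_eq_norm, ← l2norm_coeFn] at hWF
    refine le_trans (le_of_eq (l2norm_congr_ae ?_)) hWF.le
    refine ((Lp.coeFn_sub _ _).trans (((Lp.coeFn_add _ _).trans
      ((coeFn_toL2Map (coeLin ∘ₗ constOpShift A m) hTM W).add
        (coeFn_toL2Map (schwDiffExpr a b c) hBM W))).sub hF.coeFn_toLp)).symm
  have hTW : l2norm (volume.restrict S) (constOpShift A m W) ≤
      2 * (l2norm (volume.restrict S) F + ε) := by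
    have h1 : ⇑(constOpShift A m W) =
        (⇑(constOpShift A m W) + schwDiffExpr a b c W - F) + F - schwDiffExpr a b c W := by
      funext y
      simp only [Pi.add_apply, Pi.sub_apply]
      ring
    have h2 : MemLp (⇑(constOpShift A m W) + schwDiffExpr a b c W - F) 2 (volume.restrict S) :=
      ((hTM W).add (hBM W)).sub hF
    have h3 := (l2norm_sub_le (h2.add hF) (hBM W)).trans
      (add_le_add (l2norm_add_le h2 hF) (hhalf W hW))
    rw [← h1] at h3
    linarith
  refine ⟨W, hW, hWF', ?_, fun i => ?_⟩
  · calc _ ≤ M₁ / √|m| * l2norm (volume.restrict S) (constOpShift A m W) := hC.l2norm_le c₀ hm1 hW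
      _ ≤ M₁ / √|m| * (2 * (l2norm (volume.restrict S) F + ε)) := by gcongr
      _ = _ := by ring
  · calc _ ≤ M₁ / √|m| * l2norm (volume.restrict S) (constOpShift A m W) :=
          hC.l2norm_schwPartial_le hc₀ hA hm1 hW i
      _ ≤ M₁ / √|m| * (2 * (l2norm (volume.restrict S) F + ε)) := by gcongr
      _ = _ := by ring

end VariableCoefficients

/-! ### Differential expressions in coordinates -/

section Coordinates

theorem two_le_infty : (2 : WithTop ℕ∞) ≤ ∞ := ENat.LEInfty.out

variable {n : ℕ} {f g : EuclideanSpace ℝ (Fin n) → ℂ} {y : EuclideanSpace ℝ (Fin n)}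

theorem partialDeriv_congr (h : f =ᶠ[𝓝 y] g) (i : Fin n) :
    partialDeriv i f =ᶠ[𝓝 y] partialDeriv i g := by
  filter_upwards [h.fderiv (𝕜 := ℝ)] with z hz
  simp only [partialDeriv, hz]

theorem partialDeriv_mul (hf : DifferentiableAt ℝ f y) (hg : DifferentiableAt ℝ g y) (i : Fin n) :
    partialDeriv i (f * g) y = f y * partialDeriv i g y + g y * partialDeriv i f y := by
  simp only [partialDeriv]
  rw [fderiv_mul hf hg]
  simp

theorem partialDeriv_add (hf : DifferentiableAt ℝ f y) (hg : DifferentiableAt ℝ g y) (i : Fin n) :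
    partialDeriv i (f + g) y = partialDeriv i f y + partialDeriv i g y := by
  simp only [partialDeriv]
  rw [fderiv_add hf hg]
  simp

theorem contDiffAt_partialDeriv {m : WithTop ℕ∞} (hf : ContDiffAt ℝ (m + 1) f y) (i : Fin n) :
    ContDiffAt ℝ m (partialDeriv i f) y :=
  (hf.fderiv_right le_rfl).clm_apply contDiffAt_const

theorem partialDeriv_comm (hf : ContDiffAt ℝ 2 f y) (i j : Fin n) :
    partialDeriv i (partialDeriv j f) y = partialDeriv j (partialDeriv i f) y := by
  have h1 : DifferentiableAt ℝ (fderiv ℝ f) y :=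
    (hf.fderiv_right (m := 1) (by norm_num)).differentiableAt (by norm_num)
  have h2 : IsSymmSndFDerivAt ℝ f y := hf.isSymmSndFDerivAt (by simp)
  have h3 (i j : Fin n) : partialDeriv i (partialDeriv j f) y =
      fderiv ℝ (fderiv ℝ f) y (EuclideanSpace.single i 1) (EuclideanSpace.single j 1) := by
    unfold partialDeriv
    rw [fderiv_clm_apply h1 (differentiableAt_const _)]
    simp
  rw [h3, h3]
  exact h2 _ _

variable (a : Fin n → Fin n → EuclideanSpace ℝ (Fin n) → ℂ)
    (b : Fin n → EuclideanSpace ℝ (Fin n) → ℂ) (c : EuclideanSpace ℝ (Fin n) → ℂ)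

/-- The symmetric bilinear form `∑ᵢⱼ aᵢⱼ (∂ᵢf ∂ⱼg + ∂ⱼf ∂ᵢg)` attached to the leading coefficients
of a second order operator. -/
def gammaExpr (f g : EuclideanSpace ℝ (Fin n) → ℂ) (y : EuclideanSpace ℝ (Fin n)) : ℂ :=
  ∑ i, ∑ j, a i j y * (partialDeriv i f y * partialDeriv j g y +
    partialDeriv j f y * partialDeriv i g y)

variable {a b c}

theorem diffExpr_congr (h : f =ᶠ[𝓝 y] g) : diffExpr a b c f y = diffExpr a b c g y := by
  have h1 (i) := (partialDeriv_congr h i).eq_of_nhds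
  have h2 (i j) := (partialDeriv_congr (partialDeriv_congr h j) i).eq_of_nhds
  simp only [diffExpr, h1, h2, h.eq_of_nhds]

theorem gammaExpr_congr {f' g' : EuclideanSpace ℝ (Fin n) → ℂ} (hf : f =ᶠ[𝓝 y] f')
    (hg : g =ᶠ[𝓝 y] g') : gammaExpr a f g y = gammaExpr a f' g' y := by
  have h1 (i) := (partialDeriv_congr hf i).eq_of_nhds
  have h2 (i) := (partialDeriv_congr hg i).eq_of_nhds
  simp only [gammaExpr, h1, h2]

theorem partialDeriv_partialDeriv_mul (hf : ContDiffAt ℝ 2 f y) (hg : ContDiffAt ℝ 2 g y)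
    (i j : Fin n) : partialDeriv i (partialDeriv j (f * g)) y =
      f y * partialDeriv i (partialDeriv j g) y + (partialDeriv i f y * partialDeriv j g y +
        partialDeriv j f y * partialDeriv i g y) + g y * partialDeriv i (partialDeriv j f) y := by
  have hf1 : ∀ᶠ z in 𝓝 y, ContDiffAt ℝ 2 f z := hf.eventually (by simp)
  have hg1 : ∀ᶠ z in 𝓝 y, ContDiffAt ℝ 2 g z := hg.eventually (by simp)
  have h1 : partialDeriv j (f * g) =ᶠ[𝓝 y] f * partialDeriv j g + g * partialDeriv j f := by
    filter_upwards [hf1, hg1] with z hz hz'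
    exact partialDeriv_mul (hz.differentiableAt (by norm_num))
      (hz'.differentiableAt (by norm_num)) j
  have df := hf.differentiableAt (by norm_num)
  have dg := hg.differentiableAt (by norm_num)
  have df' : DifferentiableAt ℝ (partialDeriv j f) y :=
    (contDiffAt_partialDeriv (m := 1) (by simpa [one_add_one_eq_two] using hf) j).differentiableAt
      (by norm_num)
  have dg' : DifferentiableAt ℝ (partialDeriv j g) y :=
    (contDiffAt_partialDeriv (m := 1) (by simpa [one_add_one_eq_two] using hg) j).differentiableAt
      (by norm_num)
  rw [(partialDeriv_congr h1 i).eq_of_nhds, partialDeriv_add (df.mul dg') (dg.mul df'),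
    partialDeriv_mul df dg', partialDeriv_mul dg df']
  ring

/-- The Leibniz rule for a second order expression; `diffExpr a b c f y - c y * f y` is the part of
the expression without its zeroth order term, applied to `f`. -/
theorem diffExpr_mul (hf : ContDiffAt ℝ 2 f y) (hg : ContDiffAt ℝ 2 g y) :
    diffExpr a b c (f * g) y = f y * diffExpr a b c g y + gammaExpr a f g y +
      g y * (diffExpr a b c f y - c y * f y) := by
  have df := hf.differentiableAt (by norm_num)
  have dg := hg.differentiableAt (by norm_num)
  have h1 : ∑ i, ∑ j, a i j y * partialDeriv i (partialDeriv j (f * g)) y =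
      f y * (∑ i, ∑ j, a i j y * partialDeriv i (partialDeriv j g) y) + gammaExpr a f g y +
      g y * (∑ i, ∑ j, a i j y * partialDeriv i (partialDeriv j f) y) := by
    simp only [partialDeriv_partialDeriv_mul hf hg, gammaExpr, Finset.mul_sum,
      ← Finset.sum_add_distrib]
    exact Finset.sum_congr rfl fun i _ => Finset.sum_congr rfl fun j _ => by ring
  have h2 : ∑ i, b i y * partialDeriv i (f * g) y =
      f y * (∑ i, b i y * partialDeriv i g y) + g y * (∑ i, b i y * partialDeriv i f y) := by
    simp only [partialDeriv_mul df dg, Finset.mul_sum, ← Finset.sum_add_distrib]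
    exact Finset.sum_congr rfl fun i _ => by ring
  rw [diffExpr, h1, h2, diffExpr, diffExpr, Pi.mul_apply]
  ring

theorem gammaExpr_mul_right {h : EuclideanSpace ℝ (Fin n) → ℂ} (hg : DifferentiableAt ℝ g y)
    (hh : DifferentiableAt ℝ h y) :
    gammaExpr a f (g * h) y = g y * gammaExpr a f h y + h y * gammaExpr a f g y := by
  simp only [gammaExpr, partialDeriv_mul hg hh, Finset.mul_sum, ← Finset.sum_add_distrib]
  exact Finset.sum_congr rfl fun i _ => Finset.sum_congr rfl fun j _ => by ring

theorem eventuallyEq_comp_symm {X : Type*} [TopologicalSpace X]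
    {φ : OpenPartialHomeomorph X (EuclideanSpace ℝ (Fin n))} {u v : X → ℂ} {x : X}
    (hx : x ∈ φ.source) (huv : u =ᶠ[𝓝 x] v) : u ∘ φ.symm =ᶠ[𝓝 (φ x)] v ∘ φ.symm :=
  huv.comp_tendsto (φ.tendsto_symm hx)

end Coordinates

/-! ### Smooth functions on the manifold -/

section SmoothFunctions

variable {n : ℕ} {X : Type*} [TopologicalSpace X]
  [ChartedSpace (EuclideanSpace ℝ (Fin n)) X]

theorem SmoothFun.continuous (u : SmoothFun n X) : Continuous (u : X → ℂ) := u.2.continuous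

theorem contMDiff_mul_complex {u v : X → ℂ} (hu : ContMDiff (𝓡 n) 𝓘(ℝ, ℂ) ∞ u)
    (hv : ContMDiff (𝓡 n) 𝓘(ℝ, ℂ) ∞ v) : ContMDiff (𝓡 n) 𝓘(ℝ, ℂ) ∞ (u * v) :=
  (contDiff_mul (𝕜 := ℝ) (𝔸 := ℂ) (n := ∞)).contMDiff.comp (hu.prodMk_space hv)

/-- The product of two smooth functions. -/
def smoothMul (u v : SmoothFun n X) : SmoothFun n X :=
  ⟨(u : X → ℂ) * (v : X → ℂ), contMDiff_mul_complex u.2 v.2⟩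

theorem coe_smoothMul (u v : SmoothFun n X) :
    (smoothMul u v : X → ℂ) = (u : X → ℂ) * (v : X → ℂ) := rfl

/-- The complex conjugate of a smooth function. -/
def smoothConj (u : SmoothFun n X) : SmoothFun n X :=
  ⟨fun x => conj ((u : X → ℂ) x), Complex.conjCLE.contDiff.contMDiff.comp u.2⟩

theorem coe_smoothConj (u : SmoothFun n X) (x : X) :
    (smoothConj u : X → ℂ) x = conj ((u : X → ℂ) x) := rfl

/-- A real-valued smooth function, as a complex-valued one. -/
def smoothOfReal (η : X → ℝ) (hη : ContMDiff (𝓡 n) 𝓘(ℝ, ℝ) ∞ η) : SmoothFun n X :=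
  ⟨fun x => (η x : ℂ), Complex.ofRealCLM.contDiff.contMDiff.comp hη⟩

theorem coe_smoothOfReal (η : X → ℝ) (hη : ContMDiff (𝓡 n) 𝓘(ℝ, ℝ) ∞ η) (x : X) :
    (smoothOfReal η hη : X → ℂ) x = (η x : ℂ) := rfl

/-- The constant function `1`. -/
def smoothOne (n : ℕ) (X : Type*) [TopologicalSpace X]
    [ChartedSpace (EuclideanSpace ℝ (Fin n)) X] : SmoothFun n X := ⟨fun _ => 1, contMDiff_const⟩

theorem coe_smoothOne (x : X) : (smoothOne n X : X → ℂ) x = 1 := rfl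

variable {φ : OpenPartialHomeomorph X (EuclideanSpace ℝ (Fin n))}

theorem SmoothFun.contDiffOn_symm (hφ : φ ∈ IsManifold.maximalAtlas (𝓡 n) ∞ X)
    (u : SmoothFun n X) : ContDiffOn ℝ ∞ ((u : X → ℂ) ∘ φ.symm) φ.target :=
  contMDiffOn_iff_contDiffOn.mp
    (u.2.comp_contMDiffOn (contMDiffOn_symm_of_mem_maximalAtlas hφ))

theorem SmoothFun.contDiffAt_symm (hφ : φ ∈ IsManifold.maximalAtlas (𝓡 n) ∞ X)
    (u : SmoothFun n X) {y : EuclideanSpace ℝ (Fin n)} (hy : y ∈ φ.target) :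
    ContDiffAt ℝ ∞ ((u : X → ℂ) ∘ φ.symm) y :=
  (SmoothFun.contDiffOn_symm hφ u).contDiffAt (φ.open_target.mem_nhds hy)

/-- The function `η · (g ∘ φ)`, extended by zero, for `η` supported in the domain of the
chart `φ`. -/
def smoothLift (hφ : φ ∈ IsManifold.maximalAtlas (𝓡 n) ∞ X) (η : SmoothFun n X)
    (hη : tsupport (η : X → ℂ) ⊆ φ.source) (g : EuclideanSpace ℝ (Fin n) → ℂ)
    (hg : ContDiff ℝ ∞ g) : SmoothFun n X :=
  ⟨fun x => (η : X → ℂ) x * g (φ x), by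
    intro x
    by_cases hx : x ∈ φ.source
    · have h1 : ContMDiffAt (𝓡 n) 𝓘(ℝ, ℂ) ∞ (fun x => g (φ x)) x :=
        hg.contMDiff.contMDiffAt.comp x (contMDiffAt_of_mem_maximalAtlas hφ hx)
      exact (contDiff_mul (𝕜 := ℝ) (𝔸 := ℂ) (n := ∞)).contMDiff.contMDiffAt.comp x
        ((η.2 x).prodMk_space h1)
    · have h1 : (fun x => (η : X → ℂ) x * g (φ x)) =ᶠ[𝓝 x] fun _ => 0 := by
        have : x ∉ tsupport (η : X → ℂ) := fun h => hx (hη h)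
        filter_upwards [(isClosed_tsupport _).isOpen_compl.mem_nhds this] with z hz
        rw [image_eq_zero_of_notMem_tsupport hz, zero_mul]
      exact contMDiffAt_const.congr_of_eventuallyEq h1⟩

theorem smoothLift_apply (hφ : φ ∈ IsManifold.maximalAtlas (𝓡 n) ∞ X) (η : SmoothFun n X)
    (hη : tsupport (η : X → ℂ) ⊆ φ.source) (g : EuclideanSpace ℝ (Fin n) → ℂ)
    (hg : ContDiff ℝ ∞ g) (x : X) :
    (smoothLift hφ η hη g hg : X → ℂ) x = (η : X → ℂ) x * g (φ x) := rfl

variable {P : SmoothFun n X →ₗ[ℂ] SmoothFun n X}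
  {a : Fin n → Fin n → EuclideanSpace ℝ (Fin n) → ℂ}
  {b : Fin n → EuclideanSpace ℝ (Fin n) → ℂ} {c : EuclideanSpace ℝ (Fin n) → ℂ}

theorem HasLocalForm.apply_eq (h : HasLocalForm P φ a b c) (u : SmoothFun n X) {x : X}
    (hx : x ∈ φ.source) :
    (P u : X → ℂ) x = diffExpr a b c ((u : X → ℂ) ∘ φ.symm) (φ x) := by
  have := h.eq u (φ x) (φ.map_source hx)
  rw [φ.left_inv hx] at this
  rw [this, diffExpr, Function.comp_apply, φ.left_inv hx]

theorem HasLocalForm.apply_symm_eq (h : HasLocalForm P φ a b c) (u : SmoothFun n X)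
    {y : EuclideanSpace ℝ (Fin n)} (hy : y ∈ φ.target) :
    (P u : X → ℂ) (φ.symm y) = diffExpr a b c ((u : X → ℂ) ∘ φ.symm) y := h.eq u y hy

/-- The leading coefficients of an operator can be taken symmetric. -/
theorem HasLocalForm.symmetrize (hφ : φ ∈ IsManifold.maximalAtlas (𝓡 n) ∞ X)
    (h : HasLocalForm P φ a b c) :
    HasLocalForm P φ (fun i j y => (1 / 2 : ℂ) * (a i j y + a j i y)) b c where
  smooth_a := fun i j => contDiffOn_const.mul ((h.smooth_a i j).add (h.smooth_a j i))
  smooth_b := h.smooth_b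
  smooth_c := h.smooth_c
  eq := fun u y hy => by
    rw [h.eq u y hy]
    congr 2
    have hu : ContDiffAt ℝ 2 ((u : X → ℂ) ∘ φ.symm) y :=
      (SmoothFun.contDiffAt_symm hφ u hy).of_le two_le_infty
    have e1 : ∑ i, ∑ j, a j i y * partialDeriv i (partialDeriv j ((u : X → ℂ) ∘ φ.symm)) y =
        ∑ i, ∑ j, a i j y * partialDeriv i (partialDeriv j ((u : X → ℂ) ∘ φ.symm)) y := by
      rw [Finset.sum_comm]
      exact Finset.sum_congr rfl fun i _ => Finset.sum_congr rfl fun j _ => by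
        rw [partialDeriv_comm hu]
    have e2 : ∑ i, ∑ j, (1 / 2 : ℂ) * (a i j y + a j i y) *
          partialDeriv i (partialDeriv j ((u : X → ℂ) ∘ φ.symm)) y =
        (1 / 2 : ℂ) *
          ∑ i, ∑ j, a i j y * partialDeriv i (partialDeriv j ((u : X → ℂ) ∘ φ.symm)) y +
        (1 / 2 : ℂ) *
          ∑ i, ∑ j, a j i y * partialDeriv i (partialDeriv j ((u : X → ℂ) ∘ φ.symm)) y := by
      simp only [Finset.mul_sum, ← Finset.sum_add_distrib]
      exact Finset.sum_congr rfl fun i _ => Finset.sum_congr rfl fun j _ => by ring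
    rw [e2, e1]
    ring

variable [IsManifold (𝓡 n) ∞ X]

/-- Differential operators are local. -/
theorem IsDiffOpOrderTwo.congr_at (hP : IsDiffOpOrderTwo P) {u v : SmoothFun n X} {x : X}
    (huv : (u : X → ℂ) =ᶠ[𝓝 x] v) : (P u : X → ℂ) x = (P v : X → ℂ) x := by
  obtain ⟨a, b, c, h⟩ := hP _ (IsManifold.chart_mem_maximalAtlas x)
  have hx := mem_chart_source (EuclideanSpace ℝ (Fin n)) x
  rw [h.apply_eq u hx, h.apply_eq v hx]
  exact diffExpr_congr (eventuallyEq_comp_symm hx huv)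

theorem IsDiffOpOrderTwo.congr_nhds (hP : IsDiffOpOrderTwo P) {u v : SmoothFun n X} {x : X}
    (huv : (u : X → ℂ) =ᶠ[𝓝 x] v) : (P u : X → ℂ) =ᶠ[𝓝 x] P v := by
  filter_upwards [huv.eventuallyEq_nhds] with z hz
  exact hP.congr_at hz

theorem IsDiffOpOrderTwo.tsupport_subset (hP : IsDiffOpOrderTwo P) (u : SmoothFun n X) :
    tsupport (P u : X → ℂ) ⊆ tsupport (u : X → ℂ) := by
  intro x hx
  by_contra h
  have h1 : (u : X → ℂ) =ᶠ[𝓝 x] (0 : SmoothFun n X) := notMem_tsupport_iff_eventuallyEq.mp h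
  have h2 := hP.congr_nhds h1
  rw [map_zero] at h2
  exact (notMem_tsupport_iff_eventuallyEq.mpr h2) hx

end SmoothFunctions

/-! ### Smooth densities in coordinates -/

section Density

theorem eLpNorm_two_eq_lintegral {α : Type*} [MeasurableSpace α] (ν : Measure α) (g : α → ℂ) :
    eLpNorm g 2 ν = (∫⁻ x, ‖g x‖ₑ ^ (2 : ℝ) ∂ν) ^ (1 / (2 : ℝ)) := by
  rw [eLpNorm_eq_lintegral_rpow_enorm_toReal (by norm_num) (by norm_num)]
  simp

theorem aemeasurable_comp_symm {n : ℕ} {X Y : Type*} [TopologicalSpace X] [MeasurableSpace X]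
    [BorelSpace X] [MeasurableSpace Y] {φ : OpenPartialHomeomorph X (EuclideanSpace ℝ (Fin n))}
    {h : X → Y} (hh : Measurable h) :
    AEMeasurable (h ∘ φ.symm) (volume.restrict φ.target) :=
  hh.comp_aemeasurable (φ.continuousOn_symm.aemeasurable φ.open_target.measurableSet)

/-- The change of variables in a chart. -/
theorem lintegral_chart {n : ℕ} {X : Type*} [TopologicalSpace X] [MeasurableSpace X]
    [BorelSpace X] {μ : Measure X} {φ : OpenPartialHomeomorph X (EuclideanSpace ℝ (Fin n))}
    {ρ : EuclideanSpace ℝ (Fin n) → ℝ} (hρ : ContDiffOn ℝ ∞ ρ φ.target)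
    (hmap : (μ.restrict φ.source).map φ =
      (volume.restrict φ.target).withDensity (fun y => ENNReal.ofReal (ρ y)))
    {h : X → ENNReal} (hh : Measurable h) :
    ∫⁻ x in φ.source, h x ∂μ =
      ∫⁻ y in φ.target, ENNReal.ofReal (ρ y) * h (φ.symm y) := by
  have hρm : AEMeasurable (fun y => ENNReal.ofReal (ρ y)) (volume.restrict φ.target) :=
    (hρ.continuousOn.aemeasurable φ.open_target.measurableSet).ennreal_ofReal
  have hφm : AEMeasurable φ (μ.restrict φ.source) :=
    φ.continuousOn.aemeasurable φ.open_source.measurableSet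
  have hs := aemeasurable_comp_symm (φ := φ) hh
  calc ∫⁻ x in φ.source, h x ∂μ = ∫⁻ x in φ.source, (h ∘ φ.symm) (φ x) ∂μ := by
        refine setLIntegral_congr_fun φ.open_source.measurableSet fun x hx => ?_
        rw [Function.comp_apply, φ.left_inv hx]
    _ = ∫⁻ y, (h ∘ φ.symm) y ∂((μ.restrict φ.source).map φ) := by
        refine (lintegral_map' ?_ hφm).symm
        rw [hmap]
        exact hs.mono_ac (withDensity_absolutelyContinuous _ _)
    _ = _ := by
        rw [hmap, lintegral_withDensity_eq_lintegral_mul₀ hρm hs]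
        rfl

variable {n : ℕ} {X : Type*} [TopologicalSpace X]
  [ChartedSpace (EuclideanSpace ℝ (Fin n)) X] [MeasurableSpace X] [BorelSpace X]
  {μ : Measure X} {φ : OpenPartialHomeomorph X (EuclideanSpace ℝ (Fin n))}

theorem IsSmoothDensity.isFiniteMeasure [CompactSpace X] [IsManifold (𝓡 n) ∞ X]
    (hμ : IsSmoothDensity n μ) : IsFiniteMeasure μ := by
  have : IsLocallyFiniteMeasure μ := by
    refine ⟨fun x => ?_⟩
    set φ := chartAt (EuclideanSpace ℝ (Fin n)) x with hφ
    obtain ⟨ρ, hρ, -, hmap⟩ := hμ _ (IsManifold.chart_mem_maximalAtlas x)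
    have hx := mem_chart_source (EuclideanSpace ℝ (Fin n)) x
    obtain ⟨r, hr, hball⟩ := Metric.nhds_basis_closedBall.mem_iff.mp
      (φ.open_target.mem_nhds (φ.map_source hx))
    set V := φ.source ∩ φ ⁻¹' Metric.ball (φ x) r with hV
    have hVo : IsOpen V := φ.isOpen_inter_preimage Metric.isOpen_ball
    refine ⟨V, hVo.mem_nhds ⟨hx, Metric.mem_ball_self hr⟩, ?_⟩
    obtain ⟨M, hM⟩ := (isCompact_closedBall (φ x) r).exists_bound_of_continuousOn
      (hρ.continuousOn.mono hball)
    have h1 : μ V = ∫⁻ z in φ.source, V.indicator 1 z ∂μ := by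
      rw [lintegral_indicator_one hVo.measurableSet, Measure.restrict_apply hVo.measurableSet,
        Set.inter_eq_left.mpr Set.inter_subset_left]
    rw [h1, lintegral_chart hρ hmap (measurable_one.indicator hVo.measurableSet)]
    calc _ ≤ ∫⁻ y in φ.target, (Metric.closedBall (φ x) r).indicator
            (fun _ => ENNReal.ofReal M) y := by
          refine setLIntegral_mono' φ.open_target.measurableSet fun y hy => ?_
          by_cases hyV : φ.symm y ∈ V
          · have hyb : y ∈ Metric.closedBall (φ x) r := by
              have := hyV.2
              rw [Set.mem_preimage, φ.right_inv hy] at this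
              exact Metric.ball_subset_closedBall this
            rw [Set.indicator_of_mem hyV, Set.indicator_of_mem hyb, Pi.one_apply, mul_one]
            exact ENNReal.ofReal_le_ofReal ((le_abs_self _).trans (hM y hyb))
          · rw [Set.indicator_of_notMem hyV, mul_zero]
            exact zero_le
      _ ≤ ∫⁻ y, (Metric.closedBall (φ x) r).indicator (fun _ => ENNReal.ofReal M) y :=
          setLIntegral_le_lintegral _ _
      _ = ENNReal.ofReal M * volume (Metric.closedBall (φ x) r) :=
          lintegral_indicator_const Metric.isClosed_closedBall.measurableSet _
      _ < ⊤ := ENNReal.mul_lt_top ENNReal.ofReal_lt_top measure_closedBall_lt_top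
  infer_instance

theorem IsSmoothDensity.isOpenPosMeasure [IsManifold (𝓡 n) ∞ X]
    (hμ : IsSmoothDensity n μ) : μ.IsOpenPosMeasure := by
  refine ⟨fun O hO hne h0 => ?_⟩
  obtain ⟨x, hxO⟩ := hne
  set φ := chartAt (EuclideanSpace ℝ (Fin n)) x with hφ
  obtain ⟨ρ, hρ, hpos, hmap⟩ := hμ _ (IsManifold.chart_mem_maximalAtlas x)
  have hx := mem_chart_source (EuclideanSpace ℝ (Fin n)) x
  have h1 : ∫⁻ z in φ.source, O.indicator 1 z ∂μ = 0 := by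
    rw [lintegral_indicator_one hO.measurableSet]
    exact le_antisymm ((Measure.restrict_apply_le _ _).trans h0.le) zero_le
  rw [lintegral_chart hρ hmap (measurable_one.indicator hO.measurableSet)] at h1
  set T := φ.target ∩ φ.symm ⁻¹' O with hT
  have hTo : IsOpen T := φ.isOpen_inter_preimage_symm hO
  have hTne : T.Nonempty := ⟨φ x, φ.map_source hx, by
    rw [Set.mem_preimage, φ.left_inv hx]; exact hxO⟩
  have hm : AEMeasurable (fun y => ENNReal.ofReal (ρ y) *
      (O.indicator 1 (φ.symm y) : ENNReal)) (volume.restrict φ.target) :=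
    (hρ.continuousOn.aemeasurable φ.open_target.measurableSet).ennreal_ofReal.mul
      (aemeasurable_comp_symm (measurable_one.indicator hO.measurableSet))
  rw [lintegral_eq_zero_iff' hm] at h1
  have h2 : ∀ᵐ y ∂(volume : Measure (EuclideanSpace ℝ (Fin n))), y ∉ T := by
    rw [Filter.EventuallyEq, ae_restrict_iff' φ.open_target.measurableSet] at h1
    filter_upwards [h1] with y hy hyT
    have h3 := hy hyT.1
    have hyO : φ.symm y ∈ O := hyT.2
    rw [Set.indicator_of_mem hyO] at h3
    simp only [Pi.one_apply, mul_one, Pi.zero_apply, ENNReal.ofReal_eq_zero] at h3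
    exact absurd (hpos y hyT.1) (not_lt.mpr h3)
  have h4 : volume T = 0 := by
    rw [ae_iff] at h2
    simpa using h2
  exact (hTo.measure_pos volume hTne).ne' h4

/-- On functions supported in a compact subset of a coordinate domain, the `L²` norms for a smooth
density and for the Lebesgue measure of the coordinates are equivalent. -/
theorem IsSmoothDensity.eLpNorm_equiv (hμ : IsSmoothDensity n μ)
    (hφ : φ ∈ IsManifold.maximalAtlas (𝓡 n) ∞ X) {K : Set (EuclideanSpace ℝ (Fin n))}
    (hK : IsCompact K) (hKT : K ⊆ φ.target) :
    ∃ C : ENNReal, C ≠ ⊤ ∧ ∀ g : X → ℂ, Measurable g →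
      (∀ x, g x ≠ 0 → x ∈ φ.source ∧ φ x ∈ K) →
      eLpNorm g 2 μ ≤ C * eLpNorm (φ.target.indicator (g ∘ φ.symm)) 2 volume ∧
      eLpNorm (φ.target.indicator (g ∘ φ.symm)) 2 volume ≤ C * eLpNorm g 2 μ := by
  obtain ⟨ρ, hρ, hpos, hmap⟩ := hμ φ hφ
  have hρK := hρ.continuousOn.mono hKT
  obtain ⟨M, hM⟩ := hK.exists_bound_of_continuousOn hρK
  obtain ⟨N, hN⟩ := hK.exists_bound_of_continuousOn
    (hρK.inv₀ fun y hy => (hpos y (hKT hy)).ne')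
  set c : ENNReal := ENNReal.ofReal (max M N) with hc
  refine ⟨c ^ (1 / (2 : ℝ)), ENNReal.rpow_ne_top_of_nonneg (by norm_num) ENNReal.ofReal_ne_top,
    fun g hg hsupp => ?_⟩
  have e1 : ∫⁻ x, ‖g x‖ₑ ^ (2 : ℝ) ∂μ =
      ∫⁻ y in φ.target, ENNReal.ofReal (ρ y) * ‖g (φ.symm y)‖ₑ ^ (2 : ℝ) := by
    rw [← lintegral_chart hρ hmap (h := fun x => ‖g x‖ₑ ^ (2 : ℝ)) (hg.enorm.pow_const _)]
    refine (setLIntegral_eq_of_support_subset ?_).symm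
    intro x hx
    refine (hsupp x fun h0 => hx ?_).1
    simp [h0]
  have e2 : ∫⁻ y, ‖φ.target.indicator (g ∘ φ.symm) y‖ₑ ^ (2 : ℝ) =
      ∫⁻ y in φ.target, ‖g (φ.symm y)‖ₑ ^ (2 : ℝ) := by
    rw [← lintegral_indicator φ.open_target.measurableSet]
    congr 1
    funext y
    by_cases hy : y ∈ φ.target <;> simp [hy]
  have hcase (y) (hy : y ∈ φ.target) : g (φ.symm y) = 0 ∨ y ∈ K := by
    by_cases h0 : g (φ.symm y) = 0
    · exact Or.inl h0
    · right
      have := (hsupp _ h0).2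
      rwa [φ.right_inv hy] at this
  have hρm : AEMeasurable (fun y => ENNReal.ofReal (ρ y)) (volume.restrict φ.target) :=
    (hρ.continuousOn.aemeasurable φ.open_target.measurableSet).ennreal_ofReal
  have i1 : ∫⁻ x, ‖g x‖ₑ ^ (2 : ℝ) ∂μ ≤
      c * ∫⁻ y, ‖φ.target.indicator (g ∘ φ.symm) y‖ₑ ^ (2 : ℝ) := by
    rw [e1, e2, ← lintegral_const_mul' _ _ ENNReal.ofReal_ne_top]
    refine setLIntegral_mono' φ.open_target.measurableSet fun y hy => ?_
    rcases hcase y hy with h0 | hyK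
    · simp [h0]
    · gcongr
      exact (le_abs_self _).trans ((hM y hyK).trans (le_max_left _ _))
  have i2 : ∫⁻ y, ‖φ.target.indicator (g ∘ φ.symm) y‖ₑ ^ (2 : ℝ) ≤
      c * ∫⁻ x, ‖g x‖ₑ ^ (2 : ℝ) ∂μ := by
    rw [e1, e2, ← lintegral_const_mul' _ _ ENNReal.ofReal_ne_top]
    refine setLIntegral_mono' φ.open_target.measurableSet fun y hy => ?_
    rcases hcase y hy with h0 | hyK
    · simp [h0]
    · have hρy := hpos y hy
      have h1 : (ρ y)⁻¹ ≤ max M N := (le_abs_self _).trans ((hN y hyK).trans (le_max_right _ _))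
      have h2 : 1 ≤ max M N * ρ y := by
        calc 1 = (ρ y)⁻¹ * ρ y := (inv_mul_cancel₀ hρy.ne').symm
          _ ≤ _ := by gcongr
      rw [← mul_assoc, ← ENNReal.ofReal_mul (by
        exact le_trans (norm_nonneg _) ((hM y hyK).trans (le_max_left _ _)))]
      refine le_mul_of_one_le_left zero_le ?_
      rw [← ENNReal.ofReal_one]
      exact ENNReal.ofReal_le_ofReal h2
  rw [eLpNorm_two_eq_lintegral, eLpNorm_two_eq_lintegral,
    ← ENNReal.mul_rpow_of_nonneg _ _ (by norm_num), ← ENNReal.mul_rpow_of_nonneg _ _ (by norm_num)]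
  exact ⟨ENNReal.rpow_le_rpow i1 (by norm_num), ENNReal.rpow_le_rpow i2 (by norm_num)⟩

end Density

/-! ### Reality and definiteness of the principal symbol -/

section Symbol

variable {n : ℕ}

/-- A real quadratic form without nontrivial zeros is definite. -/
theorem exists_definite_of_ne_zero {A : Fin n → Fin n → ℝ} (hsymm : ∀ i j, A i j = A j i)
    (h : ∀ ξ : EuclideanSpace ℝ (Fin n), ξ ≠ 0 → quadForm A ξ ≠ 0) :
    ∃ s : ℝ, (s = 1 ∨ s = -1) ∧ ∃ c > 0, ∀ ξ, c * ‖ξ‖ ^ 2 ≤ s * quadForm A ξ := by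
  have hcont : Continuous (quadForm A) := by unfold quadForm; fun_prop
  have hscale (t : ℝ) (ξ : EuclideanSpace ℝ (Fin n)) :
      quadForm A (t • ξ) = t ^ 2 * quadForm A ξ := by
    simp only [quadForm, PiLp.smul_apply, smul_eq_mul, Finset.mul_sum]
    exact Finset.sum_congr rfl fun i _ => Finset.sum_congr rfl fun j _ => by ring
  have hsign : ∃ s : ℝ, (s = 1 ∨ s = -1) ∧ ∀ ξ : EuclideanSpace ℝ (Fin n), ξ ≠ 0 →
      0 < s * quadForm A ξ := by
    by_contra! hcon
    obtain ⟨η, hη0, hη⟩ := hcon 1 (Or.inl rfl)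
    obtain ⟨ξ, hξ0, hξ⟩ := hcon (-1) (Or.inr rfl)
    have hη' : quadForm A η < 0 := lt_of_le_of_ne (by linarith) (h η hη0)
    have hξ' : 0 < quadForm A ξ := lt_of_le_of_ne (by linarith) (h ξ hξ0).symm
    -- The quadratic polynomial `t ↦ A(ξ + t η)` has a positive discriminant, hence a real zero.
    set B := ∑ i, ∑ j, A i j * ξ i * η j with hB
    have hexp (t : ℝ) : quadForm A (ξ + t • η) =
        quadForm A ξ + 2 * t * B + t ^ 2 * quadForm A η := by
      have hB' : B = ∑ i, ∑ j, A i j * η i * ξ j := by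
        rw [hB, Finset.sum_comm]
        exact Finset.sum_congr rfl fun i _ => Finset.sum_congr rfl fun j _ => by
          rw [hsymm j i]; ring
      have : 2 * t * B = t * B + t * ∑ i, ∑ j, A i j * η i * ξ j := by rw [← hB']; ring
      rw [this, hB]
      simp only [quadForm, PiLp.add_apply, PiLp.smul_apply, smul_eq_mul, Finset.mul_sum,
        ← Finset.sum_add_distrib]
      exact Finset.sum_congr rfl fun i _ => Finset.sum_congr rfl fun j _ => by ring
    obtain ⟨t, ht⟩ : ∃ t, quadForm A (ξ + t • η) = 0 := by
      have hd : 0 ≤ B ^ 2 - quadForm A η * quadForm A ξ := by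
        nlinarith [sq_nonneg B, mul_pos hξ' (neg_pos.mpr hη')]
      have hsq := Real.sq_sqrt hd
      set r := √(B ^ 2 - quadForm A η * quadForm A ξ)
      have ht : quadForm A η * ((-B + r) / quadForm A η) = -B + r := mul_div_cancel₀ _ hη'.ne
      -- This is a root by the quadratic formula.
      refine ⟨(-B + r) / quadForm A η, ?_⟩
      rw [hexp]
      refine (mul_eq_zero_iff_left hη'.ne).mp ?_
      set t := (-B + r) / quadForm A η
      linear_combination (quadForm A η * t + B + r) * ht + hsq
    by_cases hz : ξ + t • η = 0
    · have h1 : ξ = (-t) • η := by rw [neg_smul]; exact eq_neg_of_add_eq_zero_left hz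
      rw [h1, hscale] at hξ'
      nlinarith [sq_nonneg (-t)]
    · exact h _ hz ht
  obtain ⟨s, hs, hpos⟩ := hsign
  refine ⟨s, hs, ?_⟩
  rcases (Metric.sphere (0 : EuclideanSpace ℝ (Fin n)) 1).eq_empty_or_nonempty with he | hne
  · refine ⟨1, one_pos, fun ξ => ?_⟩
    have hξ : ξ = 0 := by
      by_contra hξ
      have : ‖ξ‖⁻¹ • ξ ∈ Metric.sphere (0 : EuclideanSpace ℝ (Fin n)) 1 := by
        rw [mem_sphere_zero_iff_norm, norm_smul, norm_inv, norm_norm,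
          inv_mul_cancel₀ (norm_ne_zero_iff.mpr hξ)]
      rw [he] at this
      exact this
    rw [hξ]
    simp [quadForm]
  · obtain ⟨ζ, hζ, hmin⟩ := (isCompact_sphere (0 : EuclideanSpace ℝ (Fin n)) 1).exists_isMinOn hne
      (f := fun ξ => s * quadForm A ξ) (continuous_const.mul hcont).continuousOn
    have hζ0 : ζ ≠ 0 := by
      rintro rfl
      simp at hζ
    refine ⟨s * quadForm A ζ, hpos ζ hζ0, fun ξ => ?_⟩
    by_cases hξ : ξ = 0
    · rw [hξ]
      simp [quadForm]
    · have hn : 0 < ‖ξ‖ := norm_pos_iff.mpr hξ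
      have hmem : ‖ξ‖⁻¹ • ξ ∈ Metric.sphere (0 : EuclideanSpace ℝ (Fin n)) 1 := by
        rw [mem_sphere_zero_iff_norm, norm_smul, norm_inv, norm_norm, inv_mul_cancel₀ hn.ne']
      have h1 : s * quadForm A ζ ≤ s * quadForm A (‖ξ‖⁻¹ • ξ) := hmin hmem
      rw [hscale] at h1
      calc s * quadForm A ζ * ‖ξ‖ ^ 2 ≤ s * (‖ξ‖⁻¹ ^ 2 * quadForm A ξ) * ‖ξ‖ ^ 2 := by gcongr
        _ = _ := by field_simp

variable {X : Type*} [TopologicalSpace X] [ChartedSpace (EuclideanSpace ℝ (Fin n)) X]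

/-- Cutoff functions: `1` near a closed set and supported in a given neighbourhood of it. -/
theorem exists_cutoff [T2Space X] [CompactSpace X] [IsManifold (𝓡 n) ∞ X] {K O : Set X}
    (hK : IsClosed K) (hO : IsOpen O) (hKO : K ⊆ O) :
    ∃ η : X → ℝ, ContMDiff (𝓡 n) 𝓘(ℝ, ℝ) ∞ η ∧ (∀ᶠ x in 𝓝ˢ K, η x = 1) ∧
      tsupport η ⊆ O ∧ ∀ x, η x ∈ Set.Icc (0 : ℝ) 1 := by
  obtain ⟨V, hVo, hKV, hVO⟩ := normal_exists_closure_subset hK hO hKO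
  obtain ⟨f, hf1, hf0, hf⟩ := exists_contMDiffMap_one_nhds_of_subset_interior (n := ⊤) (𝓡 n) hK
    (t := closure V) (hKV.trans (interior_maximal subset_closure hVo))
  refine ⟨f, f.contMDiff, hf1, ?_, hf⟩
  refine (closure_minimal ?_ isClosed_closure).trans hVO
  intro x hx
  by_contra h
  exact hx (hf0 x h)

variable {P : SmoothFun n X →ₗ[ℂ] SmoothFun n X}
  {φ : OpenPartialHomeomorph X (EuclideanSpace ℝ (Fin n))}

/-- The double commutator `[[P, f], f]` applied to `u`. -/
def doubleComm (P : SmoothFun n X →ₗ[ℂ] SmoothFun n X) (f u : SmoothFun n X) : SmoothFun n X :=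
  P (smoothMul f (smoothMul f u)) - (2 : ℂ) • smoothMul f (P (smoothMul f u)) +
    smoothMul f (smoothMul f (P u))

theorem doubleComm_apply (f u : SmoothFun n X) (x : X) :
    (doubleComm P f u : X → ℂ) x = (P (smoothMul f (smoothMul f u)) : X → ℂ) x -
      2 * ((f : X → ℂ) x * (P (smoothMul f u) : X → ℂ) x) +
      (f : X → ℂ) x * ((f : X → ℂ) x * (P u : X → ℂ) x) := rfl

/-- The double commutator of a second order operator with a function is a multiplication
operator. -/
theorem HasLocalForm.doubleComm_eq (hφ : φ ∈ IsManifold.maximalAtlas (𝓡 n) ∞ X)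
    {a : Fin n → Fin n → EuclideanSpace ℝ (Fin n) → ℂ}
    {b : Fin n → EuclideanSpace ℝ (Fin n) → ℂ} {c : EuclideanSpace ℝ (Fin n) → ℂ}
    (h : HasLocalForm P φ a b c) (f u : SmoothFun n X) {x : X} (hx : x ∈ φ.source) :
    (doubleComm P f u : X → ℂ) x = (u : X → ℂ) x *
      gammaExpr a ((f : X → ℂ) ∘ φ.symm) ((f : X → ℂ) ∘ φ.symm) (φ x) := by
  have hy := φ.map_source hx
  have hsm (v : SmoothFun n X) : ContDiffAt ℝ 2 ((v : X → ℂ) ∘ φ.symm) (φ x) :=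
    (SmoothFun.contDiffAt_symm hφ v hy).of_le two_le_infty
  have hd (v : SmoothFun n X) := (hsm v).differentiableAt (by norm_num)
  rw [doubleComm_apply, h.apply_eq _ hx, h.apply_eq _ hx, h.apply_eq _ hx]
  set F := (f : X → ℂ) ∘ φ.symm with hF
  set V := (u : X → ℂ) ∘ φ.symm with hV
  have e1 : (smoothMul f u : X → ℂ) ∘ φ.symm = F * V := rfl
  have e2 : (smoothMul f (smoothMul f u) : X → ℂ) ∘ φ.symm = F * (F * V) := rfl
  have e3 : (f : X → ℂ) x = F (φ x) := by rw [hF, Function.comp_apply, φ.left_inv hx]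
  have e4 : (u : X → ℂ) x = V (φ x) := by rw [hV, Function.comp_apply, φ.left_inv hx]
  have hFV : ContDiffAt ℝ 2 (F * V) (φ x) := (hsm f).mul (hsm u)
  rw [e1, e2, e3, e4, diffExpr_mul (hsm f) hFV, diffExpr_mul (hsm f) (hsm u),
    gammaExpr_mul_right (hd f) (hd u), Pi.mul_apply]
  ring

variable [MeasurableSpace X] [BorelSpace X] [CompactSpace X] [IsManifold (𝓡 n) ∞ X]
  {μ : Measure X}

theorem IsSmoothDensity.integrable_of_continuous {E : Type*} [NormedAddCommGroup E]
    (hμ : IsSmoothDensity n μ) {f : X → E}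
    (hf : Continuous f) : Integrable f μ := by
  have := hμ.isFiniteMeasure
  exact hf.integrable_of_hasCompactSupport (HasCompactSupport.of_compactSpace f)

/-- The double commutator of a formally self-adjoint operator with a real function is real: it is
multiplication by some function, and it is formally self-adjoint itself. -/
theorem doubleComm_one_real (hμ : IsSmoothDensity n μ) (hP : IsDiffOpOrderTwo P)
    (hPsa : IsFormallySelfAdjoint μ P) (f : SmoothFun n X)
    (hf : ∀ x, conj ((f : X → ℂ) x) = (f : X → ℂ) x) (x : X) :
    conj ((doubleComm P f (smoothOne n X) : X → ℂ) x) =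
      (doubleComm P f (smoothOne n X) : X → ℂ) x := by
  have hfin := hμ.isFiniteMeasure
  have hopen := hμ.isOpenPosMeasure
  set M := doubleComm P f (smoothOne n X) with hM
  have hmul (u : SmoothFun n X) (z : X) : (doubleComm P f u : X → ℂ) z =
      (u : X → ℂ) z * (M : X → ℂ) z := by
    obtain ⟨a, b, c, h⟩ := hP _ (IsManifold.chart_mem_maximalAtlas z)
    have hz := mem_chart_source (EuclideanSpace ℝ (Fin n)) z
    rw [hM, h.doubleComm_eq (IsManifold.chart_mem_maximalAtlas z) f u hz,
      h.doubleComm_eq (IsManifold.chart_mem_maximalAtlas z) f _ hz, coe_smoothOne, one_mul]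
  have key (u : SmoothFun n X) : ∫ z, (u : X → ℂ) z * (M : X → ℂ) z ∂μ =
      ∫ z, (u : X → ℂ) z * conj ((M : X → ℂ) z) ∂μ := by
    have hint (v w : SmoothFun n X) :
        Integrable (fun z => (v : X → ℂ) z * (w : X → ℂ) z) μ :=
      hμ.integrable_of_continuous ((SmoothFun.continuous v).mul (SmoothFun.continuous w))
    have hint' (v w : SmoothFun n X) :
        Integrable (fun z => (v : X → ℂ) z * conj ((w : X → ℂ) z)) μ :=
      hμ.integrable_of_continuous ((SmoothFun.continuous v).mul
        (Complex.continuous_conj.comp (SmoothFun.continuous w)))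
    have hlin {p q r : X → ℂ} (hp : Integrable p μ) (hq : Integrable q μ) (hr : Integrable r μ) :
        ∫ z, (p z - 2 * q z + r z) ∂μ = ∫ z, p z ∂μ - 2 * ∫ z, q z ∂μ + ∫ z, r z ∂μ := by
      rw [← integral_const_mul, ← integral_sub hp (hq.const_mul 2)]
      exact integral_add (hp.sub (hq.const_mul 2)) hr
    have s1 := hPsa (smoothMul f (smoothMul f u)) (smoothOne n X)
    have s2 := hPsa (smoothMul f u) f
    have s3 := hPsa u (smoothMul f f)
    have l1 : ∫ z, (u : X → ℂ) z * (M : X → ℂ) z ∂μ =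
        ∫ z, (P (smoothMul f (smoothMul f u)) : X → ℂ) z * conj ((smoothOne n X : X → ℂ) z) ∂μ -
        2 * ∫ z, (P (smoothMul f u) : X → ℂ) z * conj ((f : X → ℂ) z) ∂μ +
        ∫ z, (P u : X → ℂ) z * conj ((smoothMul f f : X → ℂ) z) ∂μ := by
      rw [← hlin (hint' _ _) (hint' _ _) (hint' _ _)]
      refine integral_congr_ae (Filter.Eventually.of_forall fun z => ?_)
      simp only [← hmul u z, doubleComm_apply, coe_smoothMul, Pi.mul_apply, map_mul, hf,
        coe_smoothOne, map_one]
      ring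
    have l2 : ∫ z, (u : X → ℂ) z * conj ((M : X → ℂ) z) ∂μ =
        ∫ z, (smoothMul f (smoothMul f u) : X → ℂ) z *
          conj ((P (smoothOne n X) : X → ℂ) z) ∂μ -
        2 * ∫ z, (smoothMul f u : X → ℂ) z * conj ((P f : X → ℂ) z) ∂μ +
        ∫ z, (u : X → ℂ) z * conj ((P (smoothMul f f) : X → ℂ) z) ∂μ := by
      rw [← hlin (hint' _ _) (hint' _ _) (hint' _ _)]
      refine integral_congr_ae (Filter.Eventually.of_forall fun z => ?_)
      have e1 : smoothMul f (smoothOne n X) = f := by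
        ext w
        rw [coe_smoothMul, Pi.mul_apply, coe_smoothOne, mul_one]
      simp only [hM, doubleComm_apply, e1, coe_smoothMul, Pi.mul_apply, map_mul, map_add, map_sub,
        hf, Complex.conj_ofNat]
      ring
    rw [l1, l2, s1, s2, s3]
  set D := M - smoothConj M with hD
  have hDval (z : X) : (D : X → ℂ) z = (M : X → ℂ) z - conj ((M : X → ℂ) z) := rfl
  have h0 : ∫ z, ‖(D : X → ℂ) z‖ ^ 2 ∂μ = 0 := by
    have h1 := key (smoothConj D)
    have h2 : ∫ z, ((smoothConj D : SmoothFun n X) : X → ℂ) z * (D : X → ℂ) z ∂μ = 0 := by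
      have hc : Continuous fun z => conj ((M : X → ℂ) z) :=
        Complex.continuous_conj.comp (SmoothFun.continuous M)
      simp only [hDval, mul_sub]
      have i1 : Integrable (fun z => (smoothConj D : X → ℂ) z * (M : X → ℂ) z) μ :=
        hμ.integrable_of_continuous
          ((SmoothFun.continuous (smoothConj D)).mul (SmoothFun.continuous M))
      have i2 : Integrable (fun z => (smoothConj D : X → ℂ) z * conj ((M : X → ℂ) z)) μ :=
        hμ.integrable_of_continuous ((SmoothFun.continuous (smoothConj D)).mul hc)
      rw [integral_sub i1 i2, h1, sub_self]
    have h3 : ∫ z, ((‖(D : X → ℂ) z‖ ^ 2 : ℝ) : ℂ) ∂μ = 0 := by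
      rw [← h2]
      refine integral_congr_ae (Filter.Eventually.of_forall fun z => ?_)
      change ((‖(D : X → ℂ) z‖ ^ 2 : ℝ) : ℂ) = conj ((D : X → ℂ) z) * (D : X → ℂ) z
      rw [Complex.conj_mul', Complex.ofReal_pow]
    rw [integral_complex_ofReal] at h3
    exact_mod_cast h3
  have hcont : Continuous fun z => ‖(D : X → ℂ) z‖ ^ 2 := (SmoothFun.continuous D).norm.pow 2
  have hae := (integral_eq_zero_iff_of_nonneg (fun z => by positivity)
    (hcont.integrable_of_hasCompactSupport (HasCompactSupport.of_compactSpace _))).mp h0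
  have hzero := (hcont.ae_eq_iff_eq μ continuous_const).mp hae
  have hx := congrFun hzero x
  have hDx : (D : X → ℂ) x = 0 := by
    have : ‖(D : X → ℂ) x‖ ^ 2 = 0 := hx
    simpa using this
  rw [hDval] at hDx
  exact (sub_eq_zero.mp hDx).symm

/-- The linear form `y ↦ ∑ᵢ ξᵢ yᵢ`, with complex values. -/
def linForm (ξ : Fin n → ℝ) (y : EuclideanSpace ℝ (Fin n)) : ℂ := ((∑ i, ξ i * y i : ℝ) : ℂ)

theorem contDiff_linForm (ξ : Fin n → ℝ) : ContDiff ℝ ∞ (linForm ξ) := by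
  have : ContDiff ℝ ∞ fun y : EuclideanSpace ℝ (Fin n) => ∑ i, ξ i * y i := by fun_prop
  exact Complex.ofRealCLM.contDiff.comp this

theorem partialDeriv_linForm (ξ : Fin n → ℝ) (i : Fin n) (y : EuclideanSpace ℝ (Fin n)) :
    partialDeriv i (linForm ξ) y = ξ i := by
  have h : linForm ξ = Complex.ofRealCLM.comp
      (∑ i, ξ i • (EuclideanSpace.proj i : EuclideanSpace ℝ (Fin n) →L[ℝ] ℝ)) := by
    ext y
    simp [linForm]
  rw [partialDeriv, h, ContinuousLinearMap.fderiv]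
  simp

/-- In every chart, the leading coefficients of a formally self-adjoint operator of order two can be
taken real and symmetric: the double commutator with a function which is a linear form `ξ` near a
point computes the principal symbol at `ξ`. -/
theorem exists_real_localForm [T2Space X] (hμ : IsSmoothDensity n μ) (hP : IsDiffOpOrderTwo P)
    (hPsa : IsFormallySelfAdjoint μ P) (hφ : φ ∈ IsManifold.maximalAtlas (𝓡 n) ∞ X) :
    ∃ (a : Fin n → Fin n → EuclideanSpace ℝ (Fin n) → ℝ) (b : Fin n → EuclideanSpace ℝ (Fin n) → ℂ)
      (c : EuclideanSpace ℝ (Fin n) → ℂ), (∀ i j y, a i j y = a j i y) ∧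
      HasLocalForm P φ (fun i j y => (a i j y : ℂ)) b c := by
  obtain ⟨a₀, b, c, h₀⟩ := hP φ hφ
  have h := h₀.symmetrize hφ
  set a := fun i j y => (1 / 2 : ℂ) * (a₀ i j y + a₀ j i y) with ha
  have hreal (y) (hy : y ∈ φ.target) (ξ : Fin n → ℝ) :
      ∑ i, ∑ j, (a i j y).im * ξ i * ξ j = 0 := by
    obtain ⟨η, hη, hη1, hηs, -⟩ := exists_cutoff (n := n) (isClosed_singleton (x := φ.symm y))
      φ.open_source (Set.singleton_subset_iff.mpr (φ.map_target hy))
    rw [nhdsSet_singleton] at hη1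
    have hs : tsupport (smoothOfReal η hη : X → ℂ) ⊆ φ.source := by
      refine (closure_mono fun x hx => ?_).trans hηs
      rw [Function.mem_support, coe_smoothOfReal] at hx
      exact_mod_cast hx
    set f := smoothLift hφ (smoothOfReal η hη) hs (linForm ξ) (contDiff_linForm ξ) with hf
    have hF : (f : X → ℂ) ∘ φ.symm =ᶠ[𝓝 y] linForm ξ := by
      filter_upwards [φ.open_target.mem_nhds hy,
        ((φ.continuousAt_symm hy).tendsto.eventually hη1)] with z hz hz1
      rw [Function.comp_apply, hf, smoothLift_apply, coe_smoothOfReal, hz1, φ.right_inv hz]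
      simp
    have h1 := doubleComm_one_real hμ hP hPsa f (fun x => by
      rw [hf, smoothLift_apply, coe_smoothOfReal, linForm, map_mul, Complex.conj_ofReal,
        Complex.conj_ofReal]) (φ.symm y)
    rw [h.doubleComm_eq hφ f _ (φ.map_target hy), φ.right_inv hy, coe_smoothOne, one_mul,
      gammaExpr_congr hF hF, Complex.conj_eq_iff_im, gammaExpr] at h1
    simp only [partialDeriv_linForm] at h1
    have h2 : 2 * ∑ i, ∑ j, (a i j y).im * ξ i * ξ j = 0 := by
      rw [← h1, Complex.im_sum, Finset.mul_sum]
      refine Finset.sum_congr rfl fun i _ => ?_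
      rw [Complex.im_sum, Finset.mul_sum]
      refine Finset.sum_congr rfl fun j _ => ?_
      rw [show ((ξ i : ℂ) * ξ j + ξ j * ξ i) = ((2 * (ξ i * ξ j) : ℝ) : ℂ) by push_cast; ring,
        Complex.im_mul_ofReal]
      ring
    linarith
  have him (y) (hy : y ∈ φ.target) (i j : Fin n) : (a i j y).im = 0 := by
    have hd (i : Fin n) : (a i i y).im = 0 := by
      have := hreal y hy (Pi.single i 1)
      simpa [Pi.single_apply] using this
    have h1 := hreal y hy (Pi.single i 1 + Pi.single j 1)
    have h2 : (a i i y).im + (a i j y).im + ((a j i y).im + (a j j y).im) = 0 := by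
      simp only [Pi.add_apply, mul_add, add_mul, Finset.sum_add_distrib] at h1
      simp [Pi.single_apply] at h1
      linarith
    have h3 : a j i y = a i j y := by simp only [ha]; ring
    rw [hd, hd, h3] at h2
    linarith
  have hre (y) (hy : y ∈ φ.target) (i j : Fin n) : (((a i j y).re : ℝ) : ℂ) = a i j y :=
    Complex.ext (by simp) (by simp [him y hy i j])
  refine ⟨fun i j y => (a i j y).re, b, c, fun i j y => by simp only [ha, add_comm], ?_⟩
  refine ⟨fun i j => (h.smooth_a i j).congr fun y hy => hre y hy i j, h.smooth_b, h.smooth_c,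
    fun u y hy => ?_⟩
  rw [h.eq u y hy]
  simp only [hre y hy]

end Symbol

/-! ### Local solvability near elliptic points -/

section Frozen

variable {n : ℕ} {S T : Set (EuclideanSpace ℝ (Fin n))} {y₀ : EuclideanSpace ℝ (Fin n)}
  {a : Fin n → Fin n → EuclideanSpace ℝ (Fin n) → ℝ}
  {b : Fin n → EuclideanSpace ℝ (Fin n) → ℂ} {c : EuclideanSpace ℝ (Fin n) → ℂ}
  {C : Submodule ℂ (Schw n)}

/-- Where `ζ = 1`, the operator is the sum of its frozen leading part and of the perturbation with
coefficients cut off by `ζ`. -/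
theorem diffExpr_frozen {a : Fin n → Fin n → EuclideanSpace ℝ (Fin n) → ℂ}
    {A : Fin n → Fin n → ℂ} {ζ f : EuclideanSpace ℝ (Fin n) → ℂ} {y : EuclideanSpace ℝ (Fin n)}
    (hζ : ζ y = 1) :
    diffExpr (fun i j y => ζ y * (a i j y - A i j)) (fun i y => ζ y * b i y)
        (fun y => ζ y * c y) f y =
      diffExpr a b c f y - ∑ i, ∑ j, A i j * partialDeriv i (partialDeriv j f) y := by
  simp only [diffExpr, hζ, one_mul, sub_mul, Finset.sum_sub_distrib]
  ring

/-- Approximate solvability in a small ball around a point where the operator is elliptic: outside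
of the ball the operator is replaced by its leading part with coefficients frozen at the centre. -/
theorem IsAdaptedCore.exists_approx_solution_near
    (hC : IsAdaptedCore (fun i j => a i j y₀) S C) (hT : IsOpen T) (hy₀ : y₀ ∈ T)
    (ha : ∀ i j, ContinuousOn (fun y => (a i j y : ℂ)) T) (hb : ∀ i, ContinuousOn (b i) T)
    (hc : ContinuousOn c T) (hsymm : ∀ i j, a i j y₀ = a j i y₀)
    (hell : ∀ ξ : EuclideanSpace ℝ (Fin n), ξ ≠ 0 → quadForm (fun i j => a i j y₀) ξ ≠ 0) :
    ∃ r > 0, Metric.closedBall y₀ r ⊆ T ∧ ∃ M > 0, ∃ m₀ ≥ (1 : ℝ), ∀ m : ℝ, m₀ ≤ |m| →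
      ∀ F : EuclideanSpace ℝ (Fin n) → ℂ, MemLp F 2 (volume.restrict S) → ∀ ε > 0,
        ∃ W ∈ C, ∃ R : EuclideanSpace ℝ (Fin n) → ℂ, MemLp R 2 (volume.restrict S) ∧
          l2norm (volume.restrict S) R ≤ ε ∧
          (∀ y ∈ Metric.ball y₀ r, diffExpr (fun i j y => (a i j y : ℂ)) b c W y -
            (m : ℂ) * Complex.I * W y - F y = R y) ∧
          l2norm (volume.restrict S) W ≤ M / √|m| * (l2norm (volume.restrict S) F + ε) ∧
          ∀ i, l2norm (volume.restrict S) (schwPartial i W) ≤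
            M / √|m| * (l2norm (volume.restrict S) F + ε) := by
  obtain ⟨s, hs, c₀, hc₀, hdef⟩ := exists_definite_of_ne_zero hsymm hell
  have hA (ξ : EuclideanSpace ℝ (Fin n)) :
      c₀ * ‖ξ‖ ^ 2 ≤ |quadForm (fun i j => a i j y₀) ξ| := by
    refine (hdef ξ).trans ?_
    rcases hs with rfl | rfl
    · rw [one_mul]
      exact le_abs_self _
    · rw [neg_one_mul]
      exact neg_le_abs _
  -- The leading coefficients may vary by `δ`; the summand `1` covers `n = 0`.
  set δ : ℝ := c₀ / (8 * (n * n + 1)) with hδ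
  have hδpos : 0 < δ := by positivity
  have hδc : δ * (n * n) * (2 * c₀⁻¹) ≤ 1 / 4 := by
    have : δ * (n * n) * (2 * c₀⁻¹) = (n * n) / (n * n + 1) / 4 := by
      rw [hδ]
      field_simp
      ring
    rw [this]
    have h1 : (n * n : ℝ) / (n * n + 1) ≤ 1 := by
      rw [div_le_one (by positivity)]
      linarith
    linarith
  have hev : ∀ᶠ y in 𝓝 y₀, y ∈ T ∧ ∀ i j, ‖(a i j y : ℂ) - a i j y₀‖ ≤ δ := by
    refine Filter.Eventually.and (hT.mem_nhds hy₀) ?_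
    rw [Filter.eventually_all]
    intro i
    rw [Filter.eventually_all]
    intro j
    have h1 := ((ha i j).continuousAt (hT.mem_nhds hy₀)).tendsto
    filter_upwards [Metric.tendsto_nhds.mp h1 δ hδpos] with y hy
    rw [dist_eq_norm] at hy
    exact hy.le
  obtain ⟨ρ, hρ, hball⟩ := Metric.nhds_basis_closedBall.mem_iff.mp hev
  let ζ : ContDiffBump y₀ := ⟨ρ / 2, ρ, by positivity, by linarith⟩
  have hζT : tsupport ζ ⊆ T := by
    rw [ζ.tsupport_eq]
    exact fun y hy => (hball hy).1
  have hζc : Continuous fun y => (ζ y : ℂ) := Complex.continuous_ofReal.comp ζ.continuous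
  have hzero (y) (hy : y ∉ Metric.closedBall y₀ ρ) : ζ y = 0 :=
    ζ.zero_of_le_dist (le_of_lt (by simpa using hy))
  have hcont {g : EuclideanSpace ℝ (Fin n) → ℂ} (hg : ContinuousOn g T) :
      Continuous fun y => (ζ y : ℂ) * g y := by
    refine (hζc.continuousOn.mul hg).continuous_of_tsupport_subset hT ?_
    refine subset_trans (closure_mono fun y hy => ?_) hζT
    intro h0
    exact hy (by simp [h0])
  have hbdd {g : EuclideanSpace ℝ (Fin n) → ℂ} (hg : ContinuousOn g T) :
      ∃ K, ∀ y, ‖(ζ y : ℂ) * g y‖ ≤ K := by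
    refine (hcont hg).bounded_above_of_compact_support ?_
    refine HasCompactSupport.intro (isCompact_closedBall y₀ ρ) fun y hy => ?_
    rw [hzero y hy]
    simp
  choose Kb hKb using fun i => hbdd (hb i)
  obtain ⟨Kc, hKc⟩ := hbdd hc
  set K := ∑ i, |Kb i| + |Kc| with hK
  have hbK (i) (y) : ‖(ζ y : ℂ) * b i y‖ ≤ K := by
    have h1 : |Kb i| ≤ ∑ i, |Kb i| :=
      Finset.single_le_sum (f := fun i => |Kb i|) (fun i _ => abs_nonneg _) (Finset.mem_univ i)
    have := (hKb i y).trans (le_abs_self _)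
    linarith [abs_nonneg Kc]
  have hcK (y) : ‖(ζ y : ℂ) * c y‖ ≤ K := by
    have h1 : 0 ≤ ∑ i, |Kb i| := Finset.sum_nonneg fun i _ => abs_nonneg _
    have := (hKc y).trans (le_abs_self _)
    linarith
  have haδ (i j) (y) : ‖(ζ y : ℂ) * ((a i j y : ℂ) - a i j y₀)‖ ≤ δ := by
    by_cases hy : y ∈ Metric.closedBall y₀ ρ
    · rw [norm_mul, Complex.norm_real, Real.norm_of_nonneg ζ.nonneg]
      calc ζ y * ‖(a i j y : ℂ) - a i j y₀‖ ≤ 1 * δ :=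
            mul_le_mul ζ.le_one ((hball hy).2 i j) (norm_nonneg _) zero_le_one
        _ = δ := one_mul _
    · rw [hzero y hy]
      simpa using hδpos.le
  have hac (i j) : Continuous fun y => (ζ y : ℂ) * ((a i j y : ℂ) - a i j y₀) :=
    hcont ((ha i j).sub continuousOn_const)
  have hK0 : 0 ≤ K := (norm_nonneg _).trans (hcK y₀)
  obtain ⟨M, hM, m₀, hm₀, hsol⟩ := hC.exists_approx_solution hc₀ hA hδpos.le hK0 hδc hac
    (fun i => hcont (hb i)) (hcont hc) haδ hbK hcK
  refine ⟨ρ / 2, by positivity,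
    (Metric.closedBall_subset_closedBall (by linarith)).trans fun y hy => (hball hy).1,
    M, hM, m₀, hm₀, fun m hm F hF ε hε => ?_⟩
  obtain ⟨W, hW, h1, h2, h3⟩ := hsol m hm F hF ε hε
  refine ⟨W, hW, _, ?_, h1, fun y hy => ?_, h2, h3⟩
  · exact ((schw_memLp_restrict S _).add
      (memLp_schwDiffExpr hac (fun i => hcont (hb i)) (hcont hc) haδ hbK hcK W)).sub hF
  · have hζ1 : ζ y = 1 := ζ.one_of_mem_closedBall (Metric.ball_subset_closedBall hy)
    have e1 : constOpShift (fun i j => a i j y₀) m W y =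
        ∑ i, ∑ j, (a i j y₀ : ℂ) * partialDeriv i (partialDeriv j W) y -
          (m : ℂ) * Complex.I * W y := by
      rw [constOpShift_apply, constOp_apply]
      simp only [sub_apply, sum_apply, smul_apply, smul_eq_mul, coe_schwPartial]
    have e2 : schwDiffExpr (fun i j y => (ζ y : ℂ) * ((a i j y : ℂ) - a i j y₀))
        (fun i y => (ζ y : ℂ) * b i y) (fun y => (ζ y : ℂ) * c y) W y = _ :=
      diffExpr_frozen (a := fun i j y => (a i j y : ℂ)) (A := fun i j => (a i j y₀ : ℂ))
        (ζ := fun y => (ζ y : ℂ)) (f := W) (by rw [hζ1, Complex.ofReal_one])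
    rw [Pi.sub_apply, Pi.add_apply, e1, e2]
    ring

end Frozen

section Patches

variable {n : ℕ} {X : Type*} [TopologicalSpace X]
  [ChartedSpace (EuclideanSpace ℝ (Fin n)) X]
  {P : SmoothFun n X →ₗ[ℂ] SmoothFun n X}
  {φ : OpenPartialHomeomorph X (EuclideanSpace ℝ (Fin n))}
  {a : Fin n → Fin n → EuclideanSpace ℝ (Fin n) → ℂ}
  {b : Fin n → EuclideanSpace ℝ (Fin n) → ℂ} {c : EuclideanSpace ℝ (Fin n) → ℂ}

/-- The first order coefficients of the commutator of a second order operator with a function. -/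
def commCoeff (a : Fin n → Fin n → EuclideanSpace ℝ (Fin n) → ℂ)
    (f : EuclideanSpace ℝ (Fin n) → ℂ) (i : Fin n) (y : EuclideanSpace ℝ (Fin n)) : ℂ :=
  ∑ j, (a i j y + a j i y) * partialDeriv j f y

theorem gammaExpr_eq_sum_commCoeff (f g : EuclideanSpace ℝ (Fin n) → ℂ)
    (y : EuclideanSpace ℝ (Fin n)) :
    gammaExpr a f g y = ∑ i, commCoeff a f i y * partialDeriv i g y := by
  have e1 : gammaExpr a f g y = ∑ i, ∑ j, a i j y * (partialDeriv i f y * partialDeriv j g y) +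
      ∑ i, ∑ j, a i j y * (partialDeriv j f y * partialDeriv i g y) := by
    simp only [gammaExpr, ← Finset.sum_add_distrib, mul_add]
  rw [e1, Finset.sum_comm, ← Finset.sum_add_distrib]
  refine Finset.sum_congr rfl fun i _ => ?_
  rw [commCoeff, Finset.sum_mul, ← Finset.sum_add_distrib]
  exact Finset.sum_congr rfl fun j _ => by ring

/-- The zeroth order coefficient of the commutator of a second order operator with a function. -/
def commConst (a : Fin n → Fin n → EuclideanSpace ℝ (Fin n) → ℂ)
    (b : Fin n → EuclideanSpace ℝ (Fin n) → ℂ) (c : EuclideanSpace ℝ (Fin n) → ℂ)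
    (f : EuclideanSpace ℝ (Fin n) → ℂ) (y : EuclideanSpace ℝ (Fin n)) : ℂ :=
  diffExpr a b c f y - c y * f y

theorem diffExpr_mul_eq {f g : EuclideanSpace ℝ (Fin n) → ℂ} {y : EuclideanSpace ℝ (Fin n)}
    (hf : ContDiffAt ℝ 2 f y) (hg : ContDiffAt ℝ 2 g y) :
    diffExpr a b c (f * g) y = f y * diffExpr a b c g y +
      ∑ i, commCoeff a f i y * partialDeriv i g y + commConst a b c f y * g y := by
  rw [diffExpr_mul hf hg, gammaExpr_eq_sum_commCoeff, commConst]
  ring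

theorem HasLocalForm.apply_smoothLift (h : HasLocalForm P φ a b c)
    (hφ : φ ∈ IsManifold.maximalAtlas (𝓡 n) ∞ X) (θ : SmoothFun n X)
    (hθ : tsupport (θ : X → ℂ) ⊆ φ.source) {g : EuclideanSpace ℝ (Fin n) → ℂ}
    (hg : ContDiff ℝ ∞ g) {y : EuclideanSpace ℝ (Fin n)} (hy : y ∈ φ.target) :
    (P (smoothLift hφ θ hθ g hg) : X → ℂ) (φ.symm y) =
      ((θ : X → ℂ) ∘ φ.symm) y * diffExpr a b c g y +
      ∑ i, commCoeff a ((θ : X → ℂ) ∘ φ.symm) i y * partialDeriv i g y +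
      commConst a b c ((θ : X → ℂ) ∘ φ.symm) y * g y := by
  rw [h.apply_symm_eq _ hy, ← diffExpr_mul_eq
    ((SmoothFun.contDiffAt_symm hφ θ hy).of_le two_le_infty)
    (hg.contDiffAt.of_le two_le_infty)]
  refine diffExpr_congr ?_
  filter_upwards [φ.open_target.mem_nhds hy] with z hz
  rw [Function.comp_apply, smoothLift_apply, φ.right_inv hz, Pi.mul_apply, Function.comp_apply]

theorem contDiffOn_partialDeriv {T : Set (EuclideanSpace ℝ (Fin n))} (hT : IsOpen T)
    {f : EuclideanSpace ℝ (Fin n) → ℂ} (hf : ContDiffOn ℝ ∞ f T) (i : Fin n) :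
    ContDiffOn ℝ ∞ (partialDeriv i f) T := fun _ hy =>
  (contDiffAt_partialDeriv (m := ∞) (hf.contDiffAt (hT.mem_nhds hy)) i).contDiffWithinAt

theorem HasLocalForm.continuousOn_commCoeff (h : HasLocalForm P φ a b c)
    {f : EuclideanSpace ℝ (Fin n) → ℂ} (hf : ContDiffOn ℝ ∞ f φ.target) (i : Fin n) :
    ContinuousOn (commCoeff a f i) φ.target :=
  continuousOn_finsetSum _ fun j _ =>
    ((h.smooth_a i j).continuousOn.add (h.smooth_a j i).continuousOn).mul
      (contDiffOn_partialDeriv φ.open_target hf j).continuousOn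

theorem HasLocalForm.continuousOn_commConst (h : HasLocalForm P φ a b c)
    {f : EuclideanSpace ℝ (Fin n) → ℂ} (hf : ContDiffOn ℝ ∞ f φ.target) :
    ContinuousOn (commConst a b c f) φ.target := by
  have h1 := fun i => contDiffOn_partialDeriv φ.open_target hf i
  have h2 := fun i j => contDiffOn_partialDeriv φ.open_target (h1 j) i
  refine ContinuousOn.sub (((continuousOn_finsetSum _ fun i _ => continuousOn_finsetSum _
    fun j _ => (h.smooth_a i j).continuousOn.mul (h2 i j).continuousOn).add
    (continuousOn_finsetSum _ fun i _ => (h.smooth_b i).continuousOn.mul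
      (h1 i).continuousOn)).add (h.smooth_c.continuousOn.mul hf.continuousOn)) ?_
  exact h.smooth_c.continuousOn.mul hf.continuousOn

theorem exists_bound_on_compact {ι : Type*} [Fintype ι] {K : Set (EuclideanSpace ℝ (Fin n))}
    (hK : IsCompact K) {β : ι → EuclideanSpace ℝ (Fin n) → ℂ} (hβ : ∀ i, ContinuousOn (β i) K) :
    ∃ C, 0 ≤ C ∧ ∀ i, ∀ y ∈ K, ‖β i y‖ ≤ C := by
  choose C hC using fun i => hK.exists_bound_of_continuousOn (hβ i)
  refine ⟨∑ i, |C i|, Finset.sum_nonneg fun i _ => abs_nonneg _, fun i y hy => ?_⟩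
  exact ((hC i y hy).trans (le_abs_self _)).trans
    (Finset.single_le_sum (f := fun i => |C i|) (fun i _ => abs_nonneg _) (Finset.mem_univ i))

theorem exists_smooth_cutoff [T2Space X] [CompactSpace X] [IsManifold (𝓡 n) ∞ X] {K O : Set X}
    (hK : IsClosed K) (hO : IsOpen O) (hKO : K ⊆ O) :
    ∃ θ : SmoothFun n X, (∀ᶠ x in 𝓝ˢ K, (θ : X → ℂ) x = 1) ∧ tsupport (θ : X → ℂ) ⊆ O ∧
      ∀ x, ‖(θ : X → ℂ) x‖ ≤ 1 := by
  obtain ⟨η, hη, h1, h2, h3⟩ := exists_cutoff (n := n) hK hO hKO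
  refine ⟨smoothOfReal η hη, ?_, ?_, fun x => ?_⟩
  · filter_upwards [h1] with x hx
    rw [coe_smoothOfReal, hx, Complex.ofReal_one]
  · refine (closure_mono fun x hx => ?_).trans h2
    rw [Function.mem_support, coe_smoothOfReal] at hx
    exact_mod_cast hx
  · rw [coe_smoothOfReal, Complex.norm_real, Real.norm_of_nonneg (h3 x).1]
    exact (h3 x).2

theorem SmoothFun.exists_norm_le [CompactSpace X] (u : SmoothFun n X) :
    ∃ K, 0 ≤ K ∧ ∀ x, ‖(u : X → ℂ) x‖ ≤ K := by
  obtain ⟨K, hK⟩ := isCompact_univ.exists_bound_of_continuousOn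
    (SmoothFun.continuous u).continuousOn
  exact ⟨max K 0, le_max_right _ _, fun x => (hK x (Set.mem_univ x)).trans (le_max_left _ _)⟩

end Patches

section LocalSolvability

variable {n : ℕ} {X : Type*} [TopologicalSpace X]
  [ChartedSpace (EuclideanSpace ℝ (Fin n)) X] [MeasurableSpace X]
  {P : SmoothFun n X →ₗ[ℂ] SmoothFun n X}
  {φ : OpenPartialHomeomorph X (EuclideanSpace ℝ (Fin n))} {μ : Measure X} {U : Set X}
  {D : Submodule ℂ (SmoothFun n X)}

/-- For all large real `m`, the equation `(P - i m) w = η f` in `L²(ν)` can be solved in the domain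
`D`, up to an error which is small uniformly for `f` in the unit ball. Functions `f` are taken
strongly measurable instead of almost everywhere strongly measurable, so that they can be handled
pointwise in charts. -/
def ApproxSolvable (ν : Measure X) (P : SmoothFun n X →ₗ[ℂ] SmoothFun n X)
    (D : Submodule ℂ (SmoothFun n X)) (η : X → ℂ) : Prop :=
  ∀ ε > 0, ∃ m₀ : ℝ, ∀ m : ℝ, m₀ ≤ |m| → ∀ f : X → ℂ, StronglyMeasurable f →
    MemLp f 2 ν → l2norm ν f ≤ 1 → ∃ w ∈ D,
      l2norm ν ((P w : X → ℂ) - ((m : ℂ) * Complex.I) • (w : X → ℂ) - η * f) ≤ ε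

variable [BorelSpace X]

theorem IsSmoothDensity.memLp_of_continuous [CompactSpace X] [IsManifold (𝓡 n) ∞ X]
    (hμ : IsSmoothDensity n μ) {f : X → ℂ} (hf : Continuous f) : MemLp f 2 μ := by
  have := hμ.isFiniteMeasure
  exact hf.memLp_of_hasCompactSupport (HasCompactSupport.of_compactSpace f)

theorem IsSmoothDensity.memLp [CompactSpace X] [IsManifold (𝓡 n) ∞ X]
    (hμ : IsSmoothDensity n μ) (U : Set X) (u : SmoothFun n X) :
    MemLp (u : X → ℂ) 2 (μ.restrict U) :=
  (hμ.memLp_of_continuous (SmoothFun.continuous u)).restrict U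

/-- The real-valued form of `IsSmoothDensity.eLpNorm_equiv`. -/
theorem IsSmoothDensity.l2norm_equiv (hμ : IsSmoothDensity n μ)
    (hφ : φ ∈ IsManifold.maximalAtlas (𝓡 n) ∞ X) {K : Set (EuclideanSpace ℝ (Fin n))}
    (hK : IsCompact K) (hKT : K ⊆ φ.target) :
    ∃ C : ℝ, 0 ≤ C ∧ ∀ g : X → ℂ, Measurable g → MemLp g 2 μ →
      (∀ x, g x ≠ 0 → x ∈ φ.source ∧ φ x ∈ K) →
      MemLp (φ.target.indicator (g ∘ φ.symm)) 2 volume ∧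
      l2norm μ g ≤ C * l2norm volume (φ.target.indicator (g ∘ φ.symm)) ∧
      l2norm volume (φ.target.indicator (g ∘ φ.symm)) ≤ C * l2norm μ g := by
  obtain ⟨C, hC, h⟩ := hμ.eLpNorm_equiv hφ hK hKT
  refine ⟨C.toReal, ENNReal.toReal_nonneg, fun g hg hg2 hsupp => ?_⟩
  obtain ⟨h1, h2⟩ := h g hg hsupp
  have hfin : C * eLpNorm g 2 μ ≠ ⊤ := ENNReal.mul_ne_top hC hg2.2.ne
  have hmem : MemLp (φ.target.indicator (g ∘ φ.symm)) 2 volume :=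
    ⟨(aestronglyMeasurable_indicator_iff φ.open_target.measurableSet).mpr
      (aemeasurable_comp_symm hg).aestronglyMeasurable, h2.trans_lt hfin.lt_top⟩
  refine ⟨hmem, ?_, ?_⟩
  · rw [l2norm, l2norm, ← ENNReal.toReal_mul]
    exact ENNReal.toReal_mono (ENNReal.mul_ne_top hC hmem.2.ne) h1
  · rw [l2norm, l2norm, ← ENNReal.toReal_mul]
    exact ENNReal.toReal_mono hfin h2

theorem aestronglyMeasurable_indicator_of_continuousOn {K : Set (EuclideanSpace ℝ (Fin n))}
    (hK : MeasurableSet K) {β : EuclideanSpace ℝ (Fin n) → ℂ} (hβ : ContinuousOn β K)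
    (ν : Measure (EuclideanSpace ℝ (Fin n))) : AEStronglyMeasurable (K.indicator β) ν :=
  (aestronglyMeasurable_indicator_iff hK).mpr (hβ.aestronglyMeasurable hK)

/-- Near an elliptic point the equation `(P - i m) w = η f` is approximately solvable: a solution
in a chart is cut off, and the commutator of `P` with the cutoff is of lower order, hence small
when `m` is large. The set `S` is the whole space or a half-space, according to the shape of `U` in
the chart. -/
theorem exists_approxSolvable_of_chart [T2Space X] [CompactSpace X] [IsManifold (𝓡 n) ∞ X]
    (hμ : IsSmoothDensity n μ) (hφ : φ ∈ IsManifold.maximalAtlas (𝓡 n) ∞ X)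
    {a : Fin n → Fin n → EuclideanSpace ℝ (Fin n) → ℝ}
    {b : Fin n → EuclideanSpace ℝ (Fin n) → ℂ} {c : EuclideanSpace ℝ (Fin n) → ℂ}
    (h : HasLocalForm P φ (fun i j y => (a i j y : ℂ)) b c) (hP : IsDiffOpOrderTwo P)
    {x₀ : X} (hx₀ : x₀ ∈ φ.source) (hsymm : ∀ i j, a i j (φ x₀) = a j i (φ x₀))
    (hell : ∀ ξ : EuclideanSpace ℝ (Fin n), ξ ≠ 0 → quadForm (fun i j => a i j (φ x₀)) ξ ≠ 0)
    (hU : MeasurableSet U) {S : Set (EuclideanSpace ℝ (Fin n))} (hS : MeasurableSet S)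
    (hUS : ∀ x ∈ φ.source, x ∈ U ↔ φ x ∈ S) {C : Submodule ℂ (Schw n)}
    (hC : IsAdaptedCore (fun i j => a i j (φ x₀)) S C)
    (hD : ∀ W ∈ C, ∀ (η : SmoothFun n X) (hη : tsupport (η : X → ℂ) ⊆ φ.source),
      smoothLift hφ η hη W (W.smooth ⊤) ∈ D) :
    ∃ O, IsOpen O ∧ x₀ ∈ O ∧ ∀ η : SmoothFun n X, tsupport (η : X → ℂ) ⊆ O →
      ApproxSolvable (μ.restrict U) P D η := by
  set y₀ := φ x₀ with hy₀
  obtain ⟨r, hr, hrT, M, hM, m₁, hm₁, hsol⟩ := hC.exists_approx_solution_near φ.open_target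
    (φ.map_source hx₀) (fun i j => (h.smooth_a i j).continuousOn)
    (fun i => (h.smooth_b i).continuousOn) h.smooth_c.continuousOn hsymm hell
  set B := Metric.ball y₀ r with hB
  have hBK : B ⊆ Metric.closedBall y₀ r := Metric.ball_subset_closedBall
  have hBT : B ⊆ φ.target := hBK.trans hrT
  set O := φ.source ∩ φ ⁻¹' B with hO
  have hOo : IsOpen O := φ.isOpen_inter_preimage Metric.isOpen_ball
  refine ⟨O, hOo, ⟨hx₀, Metric.mem_ball_self hr⟩, fun η hη ε hε => ?_⟩
  obtain ⟨θ, hθ1, hθO, hθle⟩ := exists_smooth_cutoff (n := n) (isClosed_tsupport (η : X → ℂ))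
    hOo hη
  have hθs : tsupport (θ : X → ℂ) ⊆ φ.source := hθO.trans Set.inter_subset_left
  set Θ := (θ : X → ℂ) ∘ φ.symm with hΘ
  have hΘs : ContDiffOn ℝ ∞ Θ φ.target := SmoothFun.contDiffOn_symm hφ θ
  have hβc (i) := h.continuousOn_commCoeff hΘs i
  have hγc := h.continuousOn_commConst hΘs
  set β := commCoeff (fun i j y => (a i j y : ℂ)) Θ with hβ
  set γ := commConst (fun i j y => (a i j y : ℂ)) b c Θ with hγ
  obtain ⟨K₁, hK₁, hβK⟩ := exists_bound_on_compact (isCompact_closedBall y₀ r)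
    (fun i => (hβc i).mono hrT)
  obtain ⟨K₂, hγK⟩ := (isCompact_closedBall y₀ r).exists_bound_of_continuousOn (hγc.mono hrT)
  have hK₂ : 0 ≤ K₂ := (norm_nonneg _).trans (hγK y₀ (Metric.mem_closedBall_self hr.le))
  obtain ⟨K₃, hK₃, hηK⟩ := SmoothFun.exists_norm_le η
  obtain ⟨Cr, hCr, hnorm⟩ := hμ.l2norm_equiv hφ (isCompact_closedBall y₀ r) hrT
  set ε' := min 1 (ε / (2 * (Cr + 1))) with hε'
  have hε'pos : 0 < ε' := by positivity
  have hε'1 : ε' ≤ 1 := min_le_left _ _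
  have hε'2 : Cr * ε' ≤ ε / 2 := by
    calc Cr * ε' ≤ (Cr + 1) * (ε / (2 * (Cr + 1))) := by
          gcongr
          · linarith
          · exact min_le_right _ _
      _ = ε / 2 := by field_simp
  set Q := Cr * (n * K₁ + K₂) * M * (Cr * K₃ + 1) / (ε / 2) with hQ
  have hQ0 : 0 ≤ Q := by positivity
  refine ⟨max m₁ (Q ^ 2), fun m hm f hfm hf2 hf1 => ?_⟩
  have hm1 : m₁ ≤ |m| := (le_max_left _ _).trans hm
  have hmpos : 0 < √|m| := Real.sqrt_pos.mpr (by linarith)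
  have hQm : Q ≤ √|m| := Real.le_sqrt_of_sq_le ((le_max_right _ _).trans hm)
  have hηm : Measurable (η : X → ℂ) := (SmoothFun.continuous η).measurable
  have hηf : MemLp ((η : X → ℂ) * f) 2 (μ.restrict U) :=
    memLp_mul_of_bound hηm.aestronglyMeasurable (Filter.Eventually.of_forall hηK) hf2
  have hηO (x) (hx : (η : X → ℂ) x ≠ 0) : x ∈ O := hη (subset_tsupport _ hx)
  set g₂ := U.indicator ((η : X → ℂ) * f) with hg₂
  obtain ⟨hF2, -, hFle⟩ := hnorm g₂ ((hηm.mul hfm.measurable).indicator hU)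
    ((memLp_indicator_iff_restrict hU).mpr hηf) (fun x hx => by
      have hxO := hηO x fun h0 => hx (by simp [hg₂, h0])
      exact ⟨hxO.1, hBK hxO.2⟩)
  set F := φ.target.indicator (g₂ ∘ φ.symm) with hF
  have hFle' : l2norm (volume.restrict S) F ≤ Cr * K₃ := by
    refine (l2norm_restrict_le S hF2).trans (hFle.trans ?_)
    rw [hg₂, l2norm_indicator hU]
    gcongr
    calc _ ≤ K₃ * l2norm (μ.restrict U) f :=
          l2norm_mul_le hK₃ (Filter.Eventually.of_forall hηK) hf2
      _ ≤ K₃ * 1 := by gcongr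
      _ = K₃ := mul_one _
  obtain ⟨W, hW, R, hR2, hRε, hReq, hWle, hdWle⟩ := hsol m hm1 F (hF2.restrict S) ε' hε'pos
  set w := smoothLift hφ θ hθs W (W.smooth ⊤) with hw
  refine ⟨w, hD W hW θ hθs, ?_⟩
  set err := (P w : X → ℂ) - ((m : ℂ) * Complex.I) • (w : X → ℂ) - (η : X → ℂ) * f with herr
  have herrm : Measurable err := ((SmoothFun.continuous (P w)).measurable.sub
    ((SmoothFun.continuous w).measurable.const_smul _)).sub (hηm.mul hfm.measurable)
  have herr2 : MemLp err 2 (μ.restrict U) :=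
    ((hμ.memLp U (P w)).sub ((hμ.memLp U w).const_smul _)).sub hηf
  have hwsupp : tsupport (w : X → ℂ) ⊆ tsupport (θ : X → ℂ) := by
    refine closure_mono fun x hx h0 => hx ?_
    have h0' : (θ : X → ℂ) x = 0 := h0
    rw [hw, smoothLift_apply, h0', zero_mul]
  have herr0 (x) (hx : x ∉ O) : err x = 0 := by
    have hxθ : x ∉ tsupport (θ : X → ℂ) := fun h => hx (hθO h)
    have h1 : (P w : X → ℂ) x = 0 := image_eq_zero_of_notMem_tsupport fun h' =>
      hxθ (hwsupp (hP.tsupport_subset w h'))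
    have h2 : (w : X → ℂ) x = 0 := image_eq_zero_of_notMem_tsupport fun h' => hxθ (hwsupp h')
    have h3 : (η : X → ℂ) x = 0 := by
      by_contra h'
      exact hx (hηO x h')
    simp [herr, h1, h2, h3]
  -- The error in the chart: the cut off error `R` of the local solution, and the commutator of the
  -- operator with `Θ`, applied to `W`.
  set H : EuclideanSpace ℝ (Fin n) → ℂ := B.indicator Θ * R +
    ∑ i, B.indicator (β i) * ⇑(schwPartial i W) + B.indicator γ * ⇑W with hH
  have hgH : φ.target.indicator (U.indicator err ∘ φ.symm) = S.indicator H := by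
    funext y
    by_cases hyB : y ∈ B
    · have hyT := hBT hyB
      rw [Set.indicator_of_mem hyT, Function.comp_apply]
      have hyS : φ.symm y ∈ U ↔ y ∈ S := by
        rw [hUS _ (φ.map_target hyT), φ.right_inv hyT]
      by_cases hyU : y ∈ S
      · rw [Set.indicator_of_mem hyU, Set.indicator_of_mem (hyS.mpr hyU)]
        have e1 := h.apply_smoothLift hφ θ hθs (W.smooth ⊤) hyT
        have e2 : (w : X → ℂ) (φ.symm y) = Θ y * W y := by
          rw [hw, smoothLift_apply, φ.right_inv hyT, hΘ, Function.comp_apply]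
        have e3 : Θ y * F y = (η : X → ℂ) (φ.symm y) * f (φ.symm y) := by
          rw [hF, Set.indicator_of_mem hyT, Function.comp_apply, hg₂,
            Set.indicator_of_mem (hyS.mpr hyU), Pi.mul_apply]
          by_cases h0 : (η : X → ℂ) (φ.symm y) = 0
          · rw [h0, zero_mul, mul_zero]
          · have : (θ : X → ℂ) (φ.symm y) = 1 :=
              hθ1.self_of_nhdsSet _ (subset_tsupport _ h0)
            rw [hΘ, Function.comp_apply, this, one_mul]
        have e4 := hReq y hyB
        simp only [herr, hH, Pi.sub_apply, Pi.smul_apply, Pi.mul_apply, Pi.add_apply,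
          Finset.sum_apply, smul_eq_mul, Set.indicator_of_mem hyB, coe_schwPartial, ← e3, ← e4]
        rw [e1, e2]
        ring
      · rw [Set.indicator_of_notMem hyU, Set.indicator_of_notMem (fun h' => hyU (hyS.mp h'))]
    · have h1 : S.indicator H y = 0 := by
        simp [hH, hyB]
      rw [h1]
      by_cases hyT : y ∈ φ.target
      · rw [Set.indicator_of_mem hyT, Function.comp_apply, Set.indicator_apply_eq_zero]
        intro _
        refine herr0 _ fun h' => hyB ?_
        have := h'.2
        rwa [Set.mem_preimage, φ.right_inv hyT] at this
      · rw [Set.indicator_of_notMem hyT]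
  obtain ⟨-, hgle, -⟩ := hnorm (U.indicator err) (herrm.indicator hU)
    ((memLp_indicator_iff_restrict hU).mpr herr2) (fun x hx => by
      have hxO : x ∈ O := by
        by_contra h'
        exact hx (by simp [herr0 x h'])
      exact ⟨hxO.1, hBK hxO.2⟩)
  rw [hgH, l2norm_indicator hU, l2norm_indicator hS] at hgle
  have hbd {K : ℝ} {g : EuclideanSpace ℝ (Fin n) → ℂ} (hK : 0 ≤ K)
      (hg : ∀ y ∈ Metric.closedBall y₀ r, ‖g y‖ ≤ K) (y) : ‖B.indicator g y‖ ≤ K := by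
    by_cases hy : y ∈ B
    · rw [Set.indicator_of_mem hy]
      exact hg y (hBK hy)
    · rw [Set.indicator_of_notMem hy, norm_zero]
      exact hK
  have hind {g : EuclideanSpace ℝ (Fin n) → ℂ} (hg : ContinuousOn g φ.target) :
      AEStronglyMeasurable (B.indicator g) (volume.restrict S) :=
    aestronglyMeasurable_indicator_of_continuousOn Metric.isOpen_ball.measurableSet
      (hg.mono hBT) _
  have b1 : ∀ᵐ y ∂(volume.restrict S), ‖B.indicator Θ y‖ ≤ 1 :=
    Filter.Eventually.of_forall (hbd zero_le_one fun y _ => hθle _)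
  have b2 (i) : ∀ᵐ y ∂(volume.restrict S), ‖B.indicator (β i) y‖ ≤ K₁ :=
    Filter.Eventually.of_forall (hbd hK₁ (hβK i))
  have b3 : ∀ᵐ y ∂(volume.restrict S), ‖B.indicator γ y‖ ≤ K₂ :=
    Filter.Eventually.of_forall (hbd hK₂ hγK)
  have c1 := memLp_mul_of_bound (hind hΘs.continuousOn) b1 hR2
  have c2 (i) := memLp_mul_of_bound (hind (hβc i)) (b2 i) (schw_memLp_restrict S (schwPartial i W))
  have c2' := memLp_finsetSum' (Finset.univ : Finset (Fin n)) fun i _ => c2 i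
  have c3 := memLp_mul_of_bound (hind hγc) b3 (schw_memLp_restrict S W)
  set t := M / √|m| * (Cr * K₃ + 1) with ht
  have htle : M / √|m| * (l2norm (volume.restrict S) F + ε') ≤ t := by
    rw [ht]
    gcongr
  have hHle : l2norm (volume.restrict S) H ≤ ε' + (n * K₁ + K₂) * t := by
    have d1 : l2norm (volume.restrict S) (B.indicator Θ * R) ≤ 1 * ε' :=
      (l2norm_mul_le zero_le_one b1 hR2).trans (by gcongr)
    have d2 : l2norm (volume.restrict S) (∑ i, B.indicator (β i) * ⇑(schwPartial i W)) ≤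
        n * K₁ * t := by
      refine (l2norm_sum_le _ fun i _ => c2 i).trans ?_
      calc _ ≤ ∑ i : Fin n, K₁ * t := by
            refine Finset.sum_le_sum fun i _ => (l2norm_mul_le hK₁ (b2 i)
              (schw_memLp_restrict S _)).trans ?_
            gcongr
            exact (hdWle i).trans htle
        _ = _ := by simp; ring
    have d3 : l2norm (volume.restrict S) (B.indicator γ * ⇑W) ≤ K₂ * t := by
      refine (l2norm_mul_le hK₂ b3 (schw_memLp_restrict S W)).trans ?_
      gcongr
      exact hWle.trans htle
    have d4 := l2norm_add_le (c1.add c2') c3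
    have d5 := l2norm_add_le c1 c2'
    linarith
  have hfin : Cr * ((n * K₁ + K₂) * t) ≤ ε / 2 := by
    have e1 : Cr * ((n * K₁ + K₂) * t) = Q * (ε / 2) / √|m| := by
      rw [ht, hQ]
      field_simp
    rw [e1, div_le_iff₀ hmpos]
    calc Q * (ε / 2) ≤ √|m| * (ε / 2) := by gcongr
      _ = _ := mul_comm _ _
  calc l2norm (μ.restrict U) err ≤ Cr * l2norm (volume.restrict S) H := hgle
    _ ≤ Cr * (ε' + (n * K₁ + K₂) * t) := by gcongr
    _ = Cr * ε' + Cr * ((n * K₁ + K₂) * t) := by ring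
    _ ≤ ε := by linarith

end LocalSolvability

/-! ### The criterion for essential self-adjointness -/

section Criterion

theorem inner_eq_integral {α : Type*} [MeasurableSpace α] {ν : Measure α} {f g : Lp ℂ 2 ν}
    {u v : α → ℂ} (hf : f =ᵐ[ν] u) (hg : g =ᵐ[ν] v) :
    inner ℂ f g = ∫ x, v x * conj (u x) ∂ν := by
  rw [L2.inner_def]
  refine integral_congr_ae ?_
  filter_upwards [hf, hg] with x hx hx'
  rw [hx, hx', RCLike.inner_apply]

section Abstract

variable {α V : Type*} [MeasurableSpace α] {ν : Measure α} [AddCommMonoid V] [Module ℂ V]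
  {J L : V →ₗ[ℂ] (α → ℂ)} (hJ : ∀ v, MemLp (J v) 2 ν) (hL : ∀ v, MemLp (L v) 2 ν)

theorem norm_shifted_toL2Map_sub (m : ℝ) (v : V) (f : Lp ℂ 2 ν) :
    ‖shifted (toL2Map J hJ) (toL2Map L hL) m v - f‖ =
      l2norm ν (L v - ((m : ℂ) * Complex.I) • J v - f) := by
  rw [← l2norm_coeFn]
  refine l2norm_congr_ae ((Lp.coeFn_sub _ _).trans (Filter.EventuallyEq.sub ?_ .rfl))
  rw [shifted_apply]
  exact (Lp.coeFn_sub _ _).trans ((coeFn_toL2Map L hL v).sub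
    ((Lp.coeFn_smul _ _).trans ((coeFn_toL2Map J hJ v).const_smul _)))

theorem mem_range_toL2Map_prod_iff (p : Lp ℂ 2 ν × Lp ℂ 2 ν) :
    p ∈ LinearMap.range ((toL2Map J hJ).prod (toL2Map L hL)) ↔
      ∃ v, (p.1 : α → ℂ) =ᵐ[ν] J v ∧ (p.2 : α → ℂ) =ᵐ[ν] L v := by
  constructor
  · rintro ⟨v, rfl⟩
    exact ⟨v, coeFn_toL2Map J hJ v, coeFn_toL2Map L hL v⟩
  · rintro ⟨v, h1, h2⟩
    exact ⟨v, Prod.ext (Lp.ext ((coeFn_toL2Map J hJ v).trans h1.symm))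
      (Lp.ext ((coeFn_toL2Map L hL v).trans h2.symm))⟩

/-- A symmetric operator for which `(L - i m) w = f` is approximately solvable is essentially
self-adjoint. -/
theorem isEssentiallySelfAdjoint_of_exists_approx_solution
    (hsym : ∀ u v, ∫ x, L u x * conj (J v x) ∂ν = ∫ x, J u x * conj (L v x) ∂ν) {m₀ : ℝ}
    (h : ∀ m : ℝ, m₀ ≤ |m| → ∀ f : α → ℂ, StronglyMeasurable f → MemLp f 2 ν → l2norm ν f ≤ 1 →
      ∃ v, l2norm ν (L v - ((m : ℂ) * Complex.I) • J v - f) ≤ 1 / 2) :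
    IsEssentiallySelfAdjoint (LinearMap.range ((toL2Map J hJ).prod (toL2Map L hL))) := by
  have key (m : ℝ) (hm : m₀ ≤ |m|) :
      DenseRange (shifted (toL2Map J hJ) (toL2Map L hL) m) := by
    refine denseRange_of_forall_exists_norm_sub_le_half _ fun z => ?_
    by_cases hz : z = 0
    · exact ⟨0, by rw [hz, map_zero]; simp⟩
    have hz' : 0 < ‖z‖ := norm_pos_iff.mpr hz
    set z' : Lp ℂ 2 ν := ((‖z‖⁻¹ : ℝ) : ℂ) • z with hz'def
    have hn : ‖z'‖ = 1 := by
      rw [hz'def, norm_smul, Complex.norm_real, norm_inv, norm_norm, inv_mul_cancel₀ hz'.ne']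
    obtain ⟨w, hle⟩ := h m hm z' (Lp.stronglyMeasurable z') (Lp.memLp z')
      (by rw [l2norm_coeFn, hn])
    rw [← norm_shifted_toL2Map_sub hJ hL m w z'] at hle
    refine ⟨(‖z‖ : ℂ) • w, ?_⟩
    have hzz : z = (‖z‖ : ℂ) • z' := by
      rw [hz'def, smul_smul, ← Complex.ofReal_mul, mul_inv_cancel₀ hz'.ne', Complex.ofReal_one,
        one_smul]
    calc _ = ‖(‖z‖ : ℂ) • (shifted (toL2Map J hJ) (toL2Map L hL) m w - z')‖ := by
          rw [smul_sub, ← hzz, map_smul]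
      _ = ‖z‖ * ‖shifted (toL2Map J hJ) (toL2Map L hL) m w - z'‖ := by
          rw [norm_smul, Complex.norm_real, norm_norm]
      _ ≤ ‖z‖ * (1 / 2) := by gcongr
      _ = _ := mul_comm _ _
  have hm1 : m₀ ≤ |max m₀ 1| := (le_max_left _ _).trans (le_abs_self _)
  have hm2 : max m₀ 1 ≠ 0 := (lt_of_lt_of_le one_pos (le_max_right _ _)).ne'
  refine isEssentiallySelfAdjoint_of_denseRange_shifted (fun u v => ?_) hm2 (key _ hm1)
    (key _ (by rwa [abs_neg]))
  rw [inner_eq_integral (coeFn_toL2Map L hL u) (coeFn_toL2Map J hJ v),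
    inner_eq_integral (coeFn_toL2Map J hJ u) (coeFn_toL2Map L hL v)]
  exact (hsym v u).symm

/-- Essential self-adjointness gives approximate solutions of `(L - i m) w = f` for all `m`, with
estimates. -/
theorem IsEssentiallySelfAdjoint.exists_approx_solution
    (h : IsEssentiallySelfAdjoint (LinearMap.range ((toL2Map J hJ).prod (toL2Map L hL))))
    {m : ℝ} (hm : m ≠ 0) {f : α → ℂ} (hf : MemLp f 2 ν) {ε : ℝ} (hε : 0 < ε) :
    ∃ v, l2norm ν (L v - ((m : ℂ) * Complex.I) • J v - f) ≤ ε ∧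
      |m| * l2norm ν (J v) ≤ l2norm ν f + ε ∧ l2norm ν (L v) ≤ l2norm ν f + ε := by
  obtain ⟨v, hv⟩ := Metric.denseRange_iff.mp (h.denseRange_shifted hm) (hf.toLp f) ε hε
  rw [dist_comm, dist_eq_norm] at hv
  have h1 : ‖shifted (toL2Map J hJ) (toL2Map L hL) m v‖ ≤ l2norm ν f + ε := by
    have := norm_add_le (hf.toLp f) (shifted (toL2Map J hJ) (toL2Map L hL) m v - hf.toLp f)
    rw [add_sub_cancel, norm_toLp_eq_l2norm] at this
    linarith
  refine ⟨v, ?_, ?_, ?_⟩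
  · rw [norm_shifted_toL2Map_sub] at hv
    refine le_trans (le_of_eq (l2norm_congr_ae ?_)) hv.le
    exact Filter.EventuallyEq.sub .rfl hf.coeFn_toLp.symm
  · rw [← norm_toL2Map J hJ v]
    exact (abs_mul_norm_le_norm_shifted h.symmetric m v).trans h1
  · rw [← norm_toL2Map L hL v]
    exact (norm_le_norm_shifted h.symmetric m v).trans h1

end Abstract

variable {n : ℕ} {X : Type*} [TopologicalSpace X]
  [ChartedSpace (EuclideanSpace ℝ (Fin n)) X]
  {P : SmoothFun n X →ₗ[ℂ] SmoothFun n X} {D : Submodule ℂ (SmoothFun n X)}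

/-- A linear operator on smooth functions, restricted to a subspace `D`, as a map to functions. -/
def restrictedFun (P : SmoothFun n X →ₗ[ℂ] SmoothFun n X) (D : Submodule ℂ (SmoothFun n X)) :
    D →ₗ[ℂ] (X → ℂ) where
  toFun v := (P (v : SmoothFun n X) : X → ℂ)
  map_add' u v := by rw [Submodule.coe_add, map_add, Submodule.coe_add]
  map_smul' k v := by rw [Submodule.coe_smul, map_smul, Submodule.coe_smul, RingHom.id_apply]

variable [MeasurableSpace X] {ν : Measure X}

theorem memLp_restrictedFun (hν : ∀ u : SmoothFun n X, MemLp (u : X → ℂ) 2 ν)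
    (P : SmoothFun n X →ₗ[ℂ] SmoothFun n X) (D : Submodule ℂ (SmoothFun n X)) (v : D) :
    MemLp (restrictedFun P D v) 2 ν := hν (P (v : SmoothFun n X))

/-- The graph in `L²(ν) × L²(ν)` of the operator `P` with domain `D`. -/
def opGraph (hν : ∀ u : SmoothFun n X, MemLp (u : X → ℂ) 2 ν)
    (P : SmoothFun n X →ₗ[ℂ] SmoothFun n X) (D : Submodule ℂ (SmoothFun n X)) :
    Submodule ℂ (Lp ℂ 2 ν × Lp ℂ 2 ν) :=
  LinearMap.range ((toL2Map (restrictedFun LinearMap.id D)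
    (memLp_restrictedFun hν LinearMap.id D)).prod
      (toL2Map (restrictedFun P D) (memLp_restrictedFun hν P D)))

theorem mem_opGraph_iff (hν : ∀ u : SmoothFun n X, MemLp (u : X → ℂ) 2 ν)
    (p : Lp ℂ 2 ν × Lp ℂ 2 ν) : p ∈ opGraph hν P D ↔
      ∃ u ∈ D, (p.1 : X → ℂ) =ᵐ[ν] (u : X → ℂ) ∧ (p.2 : X → ℂ) =ᵐ[ν] (P u : X → ℂ) := by
  refine (mem_range_toL2Map_prod_iff _ _ p).trans ⟨?_, ?_⟩
  · rintro ⟨v, h1, h2⟩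
    exact ⟨v, v.2, h1, h2⟩
  · rintro ⟨u, hu, h1, h2⟩
    exact ⟨⟨u, hu⟩, h1, h2⟩

theorem ApproxSolvable.add {η₁ η₂ : X → ℂ} (hν : ∀ u : SmoothFun n X, MemLp (u : X → ℂ) 2 ν)
    (h₁ : ApproxSolvable ν P D η₁) (h₂ : ApproxSolvable ν P D η₂)
    (hb₁ : ∀ f, MemLp f 2 ν → MemLp (η₁ * f) 2 ν) (hb₂ : ∀ f, MemLp f 2 ν → MemLp (η₂ * f) 2 ν) :
    ApproxSolvable ν P D (η₁ + η₂) := by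
  intro ε hε
  obtain ⟨m₁, hm₁⟩ := h₁ (ε / 2) (by positivity)
  obtain ⟨m₂, hm₂⟩ := h₂ (ε / 2) (by positivity)
  refine ⟨max m₁ m₂, fun m hm f hfm hf hf1 => ?_⟩
  obtain ⟨w₁, hw₁, e₁⟩ := hm₁ m ((le_max_left _ _).trans hm) f hfm hf hf1
  obtain ⟨w₂, hw₂, e₂⟩ := hm₂ m ((le_max_right _ _).trans hm) f hfm hf hf1
  refine ⟨w₁ + w₂, D.add_mem hw₁ hw₂, ?_⟩
  have hm (w : SmoothFun n X) {g : X → ℂ} (hg : MemLp g 2 ν) :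
      MemLp ((P w : X → ℂ) - ((m : ℂ) * Complex.I) • (w : X → ℂ) - g) 2 ν :=
    ((hν (P w)).sub ((hν w).const_smul _)).sub hg
  have := l2norm_add_le (hm w₁ (hb₁ f hf)) (hm w₂ (hb₂ f hf))
  have heq : (P (w₁ + w₂) : X → ℂ) - ((m : ℂ) * Complex.I) • ((w₁ + w₂ : SmoothFun n X) : X → ℂ) -
      (η₁ + η₂) * f = ((P w₁ : X → ℂ) - ((m : ℂ) * Complex.I) • (w₁ : X → ℂ) - η₁ * f) +
        ((P w₂ : X → ℂ) - ((m : ℂ) * Complex.I) • (w₂ : X → ℂ) - η₂ * f) := by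
    rw [map_add, Submodule.coe_add, Submodule.coe_add, smul_add, add_mul]
    abel
  rw [heq]
  linarith

theorem approxSolvable_zero : ApproxSolvable ν P D 0 := fun ε hε =>
  ⟨0, fun m _ f _ _ _ => ⟨0, D.zero_mem, by
    rw [map_zero, zero_mul]
    simpa [l2norm_zero] using hε.le⟩⟩

theorem ApproxSolvable.sum {ι : Type*} (s : Finset ι) {η : ι → X → ℂ}
    (hν : ∀ u : SmoothFun n X, MemLp (u : X → ℂ) 2 ν) (h : ∀ i ∈ s, ApproxSolvable ν P D (η i))
    (hb : ∀ i ∈ s, ∀ f, MemLp f 2 ν → MemLp (η i * f) 2 ν) :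
    ApproxSolvable ν P D (∑ i ∈ s, η i) := by
  classical
  induction s using Finset.induction_on with
  | empty => exact approxSolvable_zero
  | insert i s hi ih =>
    have h' : ∀ i ∈ s, ApproxSolvable ν P D (η i) := fun j hj => h j (Finset.mem_insert_of_mem hj)
    have hb' : ∀ i ∈ s, ∀ f, MemLp f 2 ν → MemLp (η i * f) 2 ν :=
      fun j hj => hb j (Finset.mem_insert_of_mem hj)
    rw [Finset.sum_insert hi]
    refine (h i (Finset.mem_insert_self i s)).add hν (ih h' hb') (hb i (Finset.mem_insert_self i s))
      fun f hf => ?_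
    rw [Finset.sum_mul]
    exact memLp_finsetSum' _ fun j hj => hb' j hj f hf

/-- A symmetric operator for which `(P - i m) w = f` is approximately solvable is essentially
self-adjoint. -/
theorem ApproxSolvable.isEssentiallySelfAdjoint
    (hν : ∀ u : SmoothFun n X, MemLp (u : X → ℂ) 2 ν)
    (hsym : ∀ u ∈ D, ∀ v ∈ D, ∫ x, (P u : X → ℂ) x * conj ((v : X → ℂ) x) ∂ν =
      ∫ x, (u : X → ℂ) x * conj ((P v : X → ℂ) x) ∂ν)
    (h : ApproxSolvable ν P D 1) : IsEssentiallySelfAdjoint (opGraph hν P D) := by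
  obtain ⟨m₀, hm₀⟩ := h (1 / 2) (by norm_num)
  refine isEssentiallySelfAdjoint_of_exists_approx_solution _ _ (fun u v => hsym u u.2 v v.2)
    (m₀ := m₀) fun m hm f hfm hf hf1 => ?_
  obtain ⟨w, hw, hle⟩ := hm₀ m hm f hfm hf hf1
  rw [one_mul] at hle
  exact ⟨⟨w, hw⟩, hle⟩

end Criterion

/-! ### Interior and boundary patches -/

section EllipticPatches

/-- In a chart in which `U` is one side of a hyperplane, the frontier lies in the hyperplane. -/
theorem apply_eq_zero_of_mem_frontier {n : ℕ} {X : Type*} [TopologicalSpace X]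
    {φ : OpenPartialHomeomorph X (EuclideanSpace ℝ (Fin n))} {U : Set X} (hU : IsOpen U) {k : Fin n}
    (hk : ∀ x ∈ φ.source, x ∈ U ↔ 0 < φ x k) {x : X} (hx : x ∈ frontier U)
    (hxφ : x ∈ φ.source) : φ x k = 0 := by
  have hxU : x ∉ U := fun h => by
    rw [hU.frontier_eq] at hx
    exact hx.2 h
  refine le_antisymm (not_lt.mp fun h => hxU ((hk x hxφ).mpr h)) (not_lt.mp fun h => ?_)
  have hcl : x ∈ closure U := frontier_subset_closure hx
  have ho : IsOpen (φ.source ∩ φ ⁻¹' {y | y k < 0}) :=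
    φ.isOpen_inter_preimage (isOpen_lt
      (EuclideanSpace.proj k : EuclideanSpace ℝ (Fin n) →L[ℝ] ℝ).continuous continuous_const)
  obtain ⟨z, hz, hzU⟩ := mem_closure_iff.mp hcl _ ho ⟨hxφ, h⟩
  exact lt_asymm hz.2 ((hk z hz.1).mp hzU)

variable {n : ℕ} {X : Type*} [TopologicalSpace X]
  [ChartedSpace (EuclideanSpace ℝ (Fin n)) X]
  {P : SmoothFun n X →ₗ[ℂ] SmoothFun n X}
  {φ : OpenPartialHomeomorph X (EuclideanSpace ℝ (Fin n))} {U : Set X}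

theorem IsEllipticAt.quadForm_ne_zero {x : X} (hx : IsEllipticAt P x)
    (hφ : φ ∈ IsManifold.maximalAtlas (𝓡 n) ∞ X) (hxφ : x ∈ φ.source)
    {a : Fin n → Fin n → EuclideanSpace ℝ (Fin n) → ℝ}
    {b : Fin n → EuclideanSpace ℝ (Fin n) → ℂ} {c : EuclideanSpace ℝ (Fin n) → ℂ}
    (h : HasLocalForm P φ (fun i j y => (a i j y : ℂ)) b c) (ξ : EuclideanSpace ℝ (Fin n))
    (hξ : ξ ≠ 0) : quadForm (fun i j => a i j (φ x)) ξ ≠ 0 := by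
  intro h0
  refine hx φ hφ hxφ _ b c h (fun i => ξ i) (fun h' => hξ ?_) ?_
  · ext i
    exact congrFun h' i
  · rw [quadForm] at h0
    exact_mod_cast congrArg (fun t : ℝ => (t : ℂ)) h0

/-- Smooth functions on `X` which vanish on the boundary of `U`. -/
def dirichletDomain (n : ℕ) {X : Type*} [TopologicalSpace X]
    [ChartedSpace (EuclideanSpace ℝ (Fin n)) X] (U : Set X) : Submodule ℂ (SmoothFun n X) where
  carrier := {u | ∀ x ∈ frontier U, (u : X → ℂ) x = 0}
  zero_mem' := fun _ _ => rfl
  add_mem' := fun {u v} hu hv x hx => by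
    rw [Submodule.coe_add, Pi.add_apply, hu x hx, hv x hx, add_zero]
  smul_mem' := fun k u hu x hx => by
    rw [Submodule.coe_smul, Pi.smul_apply, hu x hx, smul_zero]

/-- Away from the closure of `U` the equation in `L²(U)` is void. -/
theorem approxSolvable_of_tsupport_subset_compl_closure [MeasurableSpace X] [BorelSpace X]
    {μ : Measure X} {D : Submodule ℂ (SmoothFun n X)}
    (hU : IsOpen U) {η : SmoothFun n X} (hη : tsupport (η : X → ℂ) ⊆ (closure U)ᶜ) :
    ApproxSolvable (μ.restrict U) P D η := by
  refine fun ε hε => ⟨0, fun m _ f _ _ _ => ⟨0, D.zero_mem, ?_⟩⟩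
  have h0 : (P 0 : X → ℂ) - ((m : ℂ) * Complex.I) • ((0 : SmoothFun n X) : X → ℂ) -
      (η : X → ℂ) * f =ᵐ[μ.restrict U] 0 := by
    filter_upwards [ae_restrict_mem hU.measurableSet] with x hx
    have hηx : (η : X → ℂ) x = 0 :=
      image_eq_zero_of_notMem_tsupport fun h => hη h (subset_closure hx)
    simp [hηx]
  rw [l2norm_congr_ae h0, l2norm_zero]
  exact hε.le

variable [T2Space X] [CompactSpace X] [IsManifold (𝓡 n) ∞ X]

/-- Smooth partitions of unity on a compact manifold, in the form of a local-to-global principle. -/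
theorem exists_partition {p : SmoothFun n X → Prop}
    (h : ∀ x, ∃ O, IsOpen O ∧ x ∈ O ∧ ∀ η : SmoothFun n X, tsupport (η : X → ℂ) ⊆ O → p η) :
    ∃ (t : Finset X) (η : t → SmoothFun n X), (∀ i, p (η i)) ∧
      (∀ i x, ‖(η i : X → ℂ) x‖ ≤ 1) ∧ (1 : X → ℂ) = ∑ i, (η i : X → ℂ) := by
  choose O hO hxO hsolv using h
  obtain ⟨t, ht⟩ := isCompact_univ.elim_finite_subcover O hO
    fun x _ => Set.mem_iUnion.mpr ⟨x, hxO x⟩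
  obtain ⟨f, hf⟩ := SmoothPartitionOfUnity.exists_isSubordinate (𝓡 n) isClosed_univ
    (fun x : t => O x) (fun x => hO x) fun x hx => by
      have := ht hx
      simp only [Set.mem_iUnion] at this ⊢
      obtain ⟨z, hz, hxz⟩ := this
      exact ⟨⟨z, hz⟩, hxz⟩
  refine ⟨t, fun i => smoothOfReal (f i) (f i).contMDiff, fun i => hsolv i _ ?_, fun i x => ?_, ?_⟩
  · refine (closure_mono fun x hx => ?_).trans (hf i)
    rw [Function.mem_support, coe_smoothOfReal] at hx
    exact_mod_cast hx
  · rw [coe_smoothOfReal, Complex.norm_real, Real.norm_of_nonneg (f.nonneg i x)]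
    exact f.le_one i x
  · funext x
    have h1 := f.sum_eq_one (Set.mem_univ x)
    rw [finsum_eq_sum_of_fintype] at h1
    rw [Finset.sum_apply, Pi.one_apply]
    simp only [coe_smoothOfReal]
    exact_mod_cast h1.symm

/-- Approximate solvability is a local property: the approximate solutions for the members of a
partition of unity add up. -/
theorem approxSolvable_one_of_locally [MeasurableSpace X] [BorelSpace X] {ν : Measure X}
    {D : Submodule ℂ (SmoothFun n X)} (hν : ∀ u : SmoothFun n X, MemLp (u : X → ℂ) 2 ν)
    (h : ∀ x, ∃ O, IsOpen O ∧ x ∈ O ∧ ∀ η : SmoothFun n X, tsupport (η : X → ℂ) ⊆ O →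
      ApproxSolvable ν P D η) : ApproxSolvable ν P D 1 := by
  obtain ⟨t, η, hsolv, hle, hsum⟩ := exists_partition h
  rw [hsum]
  exact ApproxSolvable.sum _ hν (fun i _ => hsolv i) fun i _ g hg => memLp_mul_of_bound
    (SmoothFun.continuous (η i)).measurable.aestronglyMeasurable
    (Filter.Eventually.of_forall (hle i)) hg

variable [MeasurableSpace X] [BorelSpace X] {μ : Measure X}

theorem IsEllipticAt.exists_approxSolvable (hμ : IsSmoothDensity n μ) (hP : IsDiffOpOrderTwo P)
    (hPsa : IsFormallySelfAdjoint μ P) {x : X} (hx : IsEllipticAt P x) :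
    ∃ O, IsOpen O ∧ x ∈ O ∧ ∀ η : SmoothFun n X, tsupport (η : X → ℂ) ⊆ O →
      ApproxSolvable μ P ⊤ η := by
  have hφ := IsManifold.chart_mem_maximalAtlas (I := 𝓡 n) (n := ∞) x
  have hxφ := mem_chart_source (EuclideanSpace ℝ (Fin n)) x
  obtain ⟨a, b, c, hsymm, h⟩ := exists_real_localForm hμ hP hPsa hφ
  have := exists_approxSolvable_of_chart hμ hφ h hP hxφ (fun i j => hsymm i j _)
    (hx.quadForm_ne_zero hφ hxφ h) MeasurableSet.univ MeasurableSet.univ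
    (fun z _ => by simp) (isAdaptedCore_univ _) (D := ⊤) (fun _ _ _ _ => Submodule.mem_top)
  rwa [Measure.restrict_univ] at this

/-- At a boundary point the Dirichlet problem is approximately solvable: odd reflection in the
boundary hyperplane preserves the operator with frozen coefficients. -/
theorem IsEllipticAt.exists_approxSolvable_dirichlet (hμ : IsSmoothDensity n μ)
    (hP : IsDiffOpOrderTwo P) (hPsa : IsFormallySelfAdjoint μ P) (hU : IsOpen U) {x : X}
    (hx : IsEllipticAt P x) (hφ : φ ∈ IsManifold.maximalAtlas (𝓡 n) ∞ X) (hxφ : x ∈ φ.source)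
    {k : Fin n} (hk : ∀ z ∈ φ.source, z ∈ U ↔ 0 < φ z k) :
    ∃ O, IsOpen O ∧ x ∈ O ∧ ∀ η : SmoothFun n X, tsupport (η : X → ℂ) ⊆ O →
      ApproxSolvable (μ.restrict U) P (dirichletDomain n U) η := by
  obtain ⟨a, b, c, hsymm, h⟩ := exists_real_localForm hμ hP hPsa hφ
  have hell := hx.quadForm_ne_zero hφ hxφ h
  have hkk : (fun i j => a i j (φ x)) k k ≠ 0 := by
    have := hell (EuclideanSpace.single k 1) (by simp)
    simpa [quadForm, Pi.single_apply] using this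
  refine exists_approxSolvable_of_chart hμ hφ h hP hxφ (fun i j => hsymm i j _) hell
    hU.measurableSet (isOpen_halfSpace k).measurableSet hk
    (isAdaptedCore_halfSpace hkk fun i j => hsymm i j _) fun W hW η hη z hz => ?_
  rw [smoothLift_apply]
  by_cases hzφ : z ∈ φ.source
  · rw [oddSchw_apply_eq_zero hW (apply_eq_zero_of_mem_frontier hU hk hz hzφ), mul_zero]
  · rw [image_eq_zero_of_notMem_tsupport fun h' => hzφ (hη h'), zero_mul]

end EllipticPatches

/-! ### The energy estimate -/

section Energy

theorem integral_norm_mul_norm_le {α : Type*} [MeasurableSpace α] {ν : Measure α} {f g : α → ℂ}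
    (hf : MemLp f 2 ν) (hg : MemLp g 2 ν) :
    ∫ x, ‖f x‖ * ‖g x‖ ∂ν ≤ l2norm ν f * l2norm ν g := by
  have h := integral_mul_norm_le_Lp_mul_Lq (μ := ν) (f := f) (g := g) (p := 2) (q := 2)
    Real.HolderConjugate.two_two (by simpa using hf) (by simpa using hg)
  refine h.trans (le_of_eq ?_)
  have e (u : α → ℂ) (hu : MemLp u 2 ν) :
      (∫ a, ‖u a‖ ^ (2 : ℝ) ∂ν) ^ (1 / (2 : ℝ)) = l2norm ν u := by
    have h1 : ∫ a, ‖u a‖ ^ (2 : ℝ) ∂ν = l2norm ν u ^ 2 := by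
      rw [l2norm_sq hu]
      exact integral_congr_ae (Filter.Eventually.of_forall fun x => by norm_num)
    rw [h1, ← Real.sqrt_eq_rpow, Real.sqrt_sq l2norm_nonneg]
  rw [e f hf, e g hg]

variable {n : ℕ}

/-- The Hermitian form of a real matrix is the sum of the quadratic forms of the real and imaginary
parts. -/
theorem re_sum_mul_conj (a : Fin n → Fin n → ℝ) (d : Fin n → ℂ) :
    (∑ i, ∑ j, (a i j : ℂ) * (d i * conj (d j) + d j * conj (d i))).re =
      2 * (quadForm a (WithLp.toLp 2 fun i => (d i).re) +
        quadForm a (WithLp.toLp 2 fun i => (d i).im)) := by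
  simp only [quadForm, Complex.re_sum, ← Finset.sum_add_distrib, Finset.mul_sum]
  refine Finset.sum_congr rfl fun i _ => Finset.sum_congr rfl fun j _ => ?_
  rw [Complex.re_ofReal_mul]
  simp only [Complex.add_re, Complex.mul_re, Complex.conj_re, Complex.conj_im]
  ring

/-- The pointwise inequality behind the energy estimate: a definite quadratic form controls the
gradient `d`, up to terms of lower order. For `v`, `d` and `p` the values of a function `w`, of its
gradient and of `P w`, the expression multiplied by `s` is the value of `P(|w|²)`. -/
theorem energy_pointwise {a : Fin n → Fin n → ℝ} {b : Fin n → ℂ} {c : ℂ} {s κ B : ℝ}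
    (hs : |s| = 1) (hκ : 0 < κ) (hdef : ∀ ξ, κ * ‖ξ‖ ^ 2 ≤ s * quadForm a ξ)
    (hb : ∀ i, ‖b i‖ ≤ B) (hc : ‖c‖ ≤ B) (p v : ℂ) (d : Fin n → ℂ) :
    κ * ∑ i, ‖d i‖ ^ 2 ≤
      s * (v * (conj p + ∑ i, (b i - conj (b i)) * conj (d i) + (c - conj c) * conj v) +
        ∑ i, ∑ j, (a i j : ℂ) * (d i * conj (d j) + d j * conj (d i)) +
        conj v * (p - c * v)).re +
      2 * (‖v‖ * ‖p‖) + (n * (B ^ 2 / κ) + 3 * B) * ‖v‖ ^ 2 := by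
  have hG : 2 * (κ * ∑ i, ‖d i‖ ^ 2) ≤
      s * (∑ i, ∑ j, (a i j : ℂ) * (d i * conj (d j) + d j * conj (d i))).re := by
    rw [re_sum_mul_conj]
    have h1 := hdef (WithLp.toLp 2 fun i => (d i).re)
    have h2 := hdef (WithLp.toLp 2 fun i => (d i).im)
    have h3 : ∑ i, ‖d i‖ ^ 2 = ‖(WithLp.toLp 2 fun i => (d i).re : EuclideanSpace ℝ (Fin n))‖ ^ 2 +
        ‖(WithLp.toLp 2 fun i => (d i).im : EuclideanSpace ℝ (Fin n))‖ ^ 2 := by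
      rw [EuclideanSpace.norm_sq_eq, EuclideanSpace.norm_sq_eq, ← Finset.sum_add_distrib]
      refine Finset.sum_congr rfl fun i _ => ?_
      rw [Complex.sq_norm, Complex.normSq_apply]
      simp only [Real.norm_eq_abs, sq_abs]
      ring
    rw [h3]
    linarith
  set G := ∑ i, ∑ j, (a i j : ℂ) * (d i * conj (d j) + d j * conj (d i)) with hGdef
  set r := v * (conj p + ∑ i, (b i - conj (b i)) * conj (d i) + (c - conj c) * conj v) +
    conj v * (p - c * v) with hr
  have hsplit : v * (conj p + ∑ i, (b i - conj (b i)) * conj (d i) + (c - conj c) * conj v) + G +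
      conj v * (p - c * v) = G + r := by
    rw [hr]
    ring
  have h2 (z : ℂ) (hz : ‖z‖ ≤ B) : ‖z - conj z‖ ≤ 2 * B := by
    refine (norm_sub_le _ _).trans ?_
    rw [Complex.norm_conj]
    linarith
  have hsum : ‖v‖ * ‖∑ i, (b i - conj (b i)) * conj (d i)‖ ≤
      κ * ∑ i, ‖d i‖ ^ 2 + n * (B ^ 2 / κ) * ‖v‖ ^ 2 := by
    calc ‖v‖ * ‖∑ i, (b i - conj (b i)) * conj (d i)‖
        ≤ ‖v‖ * ∑ i, 2 * B * ‖d i‖ := by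
          gcongr
          refine (norm_sum_le _ _).trans (Finset.sum_le_sum fun i _ => ?_)
          rw [norm_mul, Complex.norm_conj]
          gcongr
          exact h2 _ (hb i)
      _ = ∑ i, 2 * (‖v‖ * B) * ‖d i‖ := by
          rw [Finset.mul_sum]
          exact Finset.sum_congr rfl fun i _ => by ring
      _ ≤ ∑ i, (κ * ‖d i‖ ^ 2 + B ^ 2 / κ * ‖v‖ ^ 2) := by
          refine Finset.sum_le_sum fun i _ => ?_
          have h := sq_nonneg (κ * ‖d i‖ - ‖v‖ * B)
          have e : κ * ‖d i‖ ^ 2 + B ^ 2 / κ * ‖v‖ ^ 2 - 2 * (‖v‖ * B) * ‖d i‖ =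
              (κ * ‖d i‖ - ‖v‖ * B) ^ 2 / κ := by
            field_simp
            ring
          have := div_nonneg h hκ.le
          linarith
      _ = _ := by
          rw [Finset.sum_add_distrib, ← Finset.mul_sum]
          simp
          ring
  have hrle : ‖r‖ ≤ 2 * (‖v‖ * ‖p‖) + (κ * ∑ i, ‖d i‖ ^ 2 + n * (B ^ 2 / κ) * ‖v‖ ^ 2) +
      3 * B * ‖v‖ ^ 2 := by
    have e : r = v * conj p + v * (∑ i, (b i - conj (b i)) * conj (d i)) +
        v * ((c - conj c) * conj v) + conj v * p - conj v * (c * v) := by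
      rw [hr]
      ring
    rw [e]
    refine (norm_sub_le _ _).trans ?_
    refine (add_le_add_left ((norm_add_le _ _).trans (add_le_add_left ((norm_add_le _ _).trans
      (add_le_add_left (norm_add_le _ _) _)) _)) _).trans ?_
    simp only [norm_mul, Complex.norm_conj]
    have e1 : ‖v‖ * (‖c - conj c‖ * ‖v‖) ≤ 2 * B * ‖v‖ ^ 2 := by
      calc _ ≤ ‖v‖ * (2 * B * ‖v‖) := by
            gcongr
            exact h2 c hc
        _ = _ := by ring
    have e2 : ‖v‖ * (‖c‖ * ‖v‖) ≤ B * ‖v‖ ^ 2 := by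
      calc _ ≤ ‖v‖ * (B * ‖v‖) := by gcongr
        _ = _ := by ring
    linarith
  rw [hsplit, Complex.add_re, mul_add]
  have hre : -‖r‖ ≤ s * r.re := by
    have h1 : |s * r.re| ≤ ‖r‖ := by
      rw [abs_mul, hs, one_mul]
      exact Complex.abs_re_le_norm r
    exact (abs_le.mp h1).1 |>.trans' (le_refl _)
  linarith

/-- A first order expression is controlled by the function and its gradient. -/
theorem norm_sq_commutator_le {β : Fin n → ℂ} {γ : ℂ} {K : ℝ} (hβ : ∀ i, ‖β i‖ ≤ K)
    (hγ : ‖γ‖ ≤ K) (v : ℂ) (d : Fin n → ℂ) :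
    ‖∑ i, β i * d i + γ * v‖ ^ 2 ≤ K ^ 2 * (n + 1) * (∑ i, ‖d i‖ ^ 2 + ‖v‖ ^ 2) := by
  have hK : 0 ≤ K := (norm_nonneg _).trans hγ
  have h1 : ‖∑ i, β i * d i + γ * v‖ ≤ K * (∑ i, ‖d i‖ + ‖v‖) := by
    refine (norm_add_le _ _).trans ?_
    rw [mul_add, Finset.mul_sum]
    refine add_le_add ((norm_sum_le _ _).trans (Finset.sum_le_sum fun i _ => ?_)) ?_
    · rw [norm_mul]
      gcongr
      exact hβ i
    · rw [norm_mul]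
      gcongr
  have h2 : (∑ i, ‖d i‖ + ‖v‖) ^ 2 ≤ (n + 1) * (∑ i, ‖d i‖ ^ 2 + ‖v‖ ^ 2) := by
    have := sq_sum_le_card_mul_sum_sq (s := (Finset.univ : Finset (Option (Fin n))))
      (f := fun o => o.elim ‖v‖ fun i => ‖d i‖)
    rw [Fintype.sum_option, Fintype.sum_option] at this
    simp only [Option.elim, Finset.card_univ, Fintype.card_option, Fintype.card_fin] at this
    push_cast at this
    linarith [this]
  calc _ ≤ (K * (∑ i, ‖d i‖ + ‖v‖)) ^ 2 := by gcongr
    _ = K ^ 2 * (∑ i, ‖d i‖ + ‖v‖) ^ 2 := by ring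
    _ ≤ K ^ 2 * ((n + 1) * (∑ i, ‖d i‖ ^ 2 + ‖v‖ ^ 2)) := by gcongr
    _ = _ := by ring

theorem quadForm_sub_le {a a' : Fin n → Fin n → ℝ} {δ : ℝ} (h : ∀ i j, |a i j - a' i j| ≤ δ)
    (ξ : EuclideanSpace ℝ (Fin n)) :
    |quadForm a ξ - quadForm a' ξ| ≤ n * n * δ * ‖ξ‖ ^ 2 := by
  have e : quadForm a ξ - quadForm a' ξ = ∑ i, ∑ j, (a i j - a' i j) * ξ i * ξ j := by
    simp only [quadForm, sub_mul, Finset.sum_sub_distrib]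
  rw [e]
  calc _ ≤ ∑ i : Fin n, ∑ j : Fin n, δ * ‖ξ‖ * ‖ξ‖ := by
        refine (Finset.abs_sum_le_sum_abs _ _).trans (Finset.sum_le_sum fun i _ =>
          (Finset.abs_sum_le_sum_abs _ _).trans (Finset.sum_le_sum fun j _ => ?_))
        rw [abs_mul, abs_mul]
        have hδ : 0 ≤ δ := (abs_nonneg _).trans (h i j)
        exact mul_le_mul (mul_le_mul (h i j) (abs_apply_le_norm ξ i) (abs_nonneg _) hδ)
          (abs_apply_le_norm ξ j) (abs_nonneg _) (by positivity)
    _ = _ := by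
        simp
        ring

/-- Definiteness of the principal symbol is an open condition. -/
theorem eventually_definite {a : Fin n → Fin n → EuclideanSpace ℝ (Fin n) → ℝ}
    {y₀ : EuclideanSpace ℝ (Fin n)} (ha : ∀ i j, ContinuousAt (a i j) y₀)
    (hsymm : ∀ i j, a i j y₀ = a j i y₀)
    (hell : ∀ ξ : EuclideanSpace ℝ (Fin n), ξ ≠ 0 → quadForm (fun i j => a i j y₀) ξ ≠ 0) :
    ∃ s : ℝ, |s| = 1 ∧ ∃ κ > 0, ∀ᶠ y in 𝓝 y₀, ∀ ξ,
      κ * ‖ξ‖ ^ 2 ≤ s * quadForm (fun i j => a i j y) ξ := by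
  obtain ⟨s, hs, c, hc, hdef⟩ := exists_definite_of_ne_zero hsymm hell
  have hs1 : |s| = 1 := by rcases hs with rfl | rfl <;> simp
  refine ⟨s, hs1, c / 2, by positivity, ?_⟩
  set δ := c / (2 * (n * n + 1)) with hδ
  have hδpos : 0 < δ := by positivity
  have hev : ∀ᶠ y in 𝓝 y₀, ∀ i j, |a i j y - a i j y₀| ≤ δ := by
    rw [Filter.eventually_all]
    intro i
    rw [Filter.eventually_all]
    intro j
    filter_upwards [Metric.tendsto_nhds.mp (ha i j).tendsto δ hδpos] with y hy
    exact hy.le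
  filter_upwards [hev] with y hy ξ
  have h1 := quadForm_sub_le hy ξ
  have h2 : n * n * δ * ‖ξ‖ ^ 2 ≤ c / 2 * ‖ξ‖ ^ 2 := by
    gcongr
    rw [hδ, mul_div_assoc', div_le_div_iff₀ (by positivity) (by norm_num)]
    nlinarith
  have h3 : s * quadForm (fun i j => a i j y₀) ξ - s * quadForm (fun i j => a i j y) ξ ≤
      |quadForm (fun i j => a i j y) ξ - quadForm (fun i j => a i j y₀) ξ| := by
    rw [← mul_sub]
    refine (le_abs_self _).trans ?_
    rw [abs_mul, hs1, one_mul, abs_sub_comm]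
  have := hdef ξ
  linarith

end Energy

section Commutator

variable {n : ℕ} {X : Type*} [TopologicalSpace X]
  [ChartedSpace (EuclideanSpace ℝ (Fin n)) X]
  {P : SmoothFun n X →ₗ[ℂ] SmoothFun n X}
  {φ : OpenPartialHomeomorph X (EuclideanSpace ℝ (Fin n))} {U : Set X}
  {a : Fin n → Fin n → EuclideanSpace ℝ (Fin n) → ℂ}
  {b : Fin n → EuclideanSpace ℝ (Fin n) → ℂ} {c : EuclideanSpace ℝ (Fin n) → ℂ}

/-- The commutator `[P, χ]` applied to `w`. -/
def commutator (P : SmoothFun n X →ₗ[ℂ] SmoothFun n X) (χ w : SmoothFun n X) : SmoothFun n X :=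
  P (smoothMul χ w) - smoothMul χ (P w)

theorem commutator_apply (χ w : SmoothFun n X) (x : X) :
    (commutator P χ w : X → ℂ) x =
      (P (smoothMul χ w) : X → ℂ) x - (χ : X → ℂ) x * (P w : X → ℂ) x := rfl

theorem HasLocalForm.commutator_eq (h : HasLocalForm P φ a b c)
    (hφ : φ ∈ IsManifold.maximalAtlas (𝓡 n) ∞ X) (χ w : SmoothFun n X) {x : X}
    (hx : x ∈ φ.source) :
    (commutator P χ w : X → ℂ) x =
      ∑ i, commCoeff a ((χ : X → ℂ) ∘ φ.symm) i (φ x) *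
        partialDeriv i ((w : X → ℂ) ∘ φ.symm) (φ x) +
      commConst a b c ((χ : X → ℂ) ∘ φ.symm) (φ x) * (w : X → ℂ) x := by
  have hy := φ.map_source hx
  have hsm (v : SmoothFun n X) : ContDiffAt ℝ 2 ((v : X → ℂ) ∘ φ.symm) (φ x) :=
    (SmoothFun.contDiffAt_symm hφ v hy).of_le two_le_infty
  have e (v : SmoothFun n X) : (v : X → ℂ) x = ((v : X → ℂ) ∘ φ.symm) (φ x) := by
    rw [Function.comp_apply, φ.left_inv hx]
  have e1 : (smoothMul χ w : X → ℂ) ∘ φ.symm =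
      ((χ : X → ℂ) ∘ φ.symm) * ((w : X → ℂ) ∘ φ.symm) := rfl
  rw [commutator_apply, h.apply_eq _ hx, h.apply_eq _ hx, e1, diffExpr_mul_eq (hsm χ) (hsm w),
    e χ, e w]
  ring

theorem partialDeriv_conj {f : EuclideanSpace ℝ (Fin n) → ℂ} {y : EuclideanSpace ℝ (Fin n)}
    (hf : DifferentiableAt ℝ f y) (i : Fin n) :
    partialDeriv i (fun z => conj (f z)) y = conj (partialDeriv i f y) := by
  have h := (Complex.conjCLE.toContinuousLinearMap.hasFDerivAt (x := f y)).comp y hf.hasFDerivAt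
  have h' : fderiv ℝ (fun z => conj (f z)) y =
      Complex.conjCLE.toContinuousLinearMap.comp (fderiv ℝ f y) := h.fderiv
  rw [partialDeriv, h']
  rfl

theorem partialDeriv_partialDeriv_conj {f : EuclideanSpace ℝ (Fin n) → ℂ}
    {y : EuclideanSpace ℝ (Fin n)} (hf : ContDiffAt ℝ 2 f y) (i j : Fin n) :
    partialDeriv i (partialDeriv j fun z => conj (f z)) y =
      conj (partialDeriv i (partialDeriv j f) y) := by
  have h1 : partialDeriv j (fun z => conj (f z)) =ᶠ[𝓝 y] fun z => conj (partialDeriv j f z) := by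
    filter_upwards [hf.eventually (by simp)] with z hz
    exact partialDeriv_conj (hz.differentiableAt (by norm_num)) j
  rw [(partialDeriv_congr h1 i).eq_of_nhds]
  exact partialDeriv_conj
    ((contDiffAt_partialDeriv (m := 1) (by simpa [one_add_one_eq_two] using hf) j).differentiableAt
      (by norm_num)) i

/-- An operator with real leading coefficients commutes with complex conjugation up to terms of
order one. -/
theorem diffExpr_conj {a : Fin n → Fin n → EuclideanSpace ℝ (Fin n) → ℝ}
    {f : EuclideanSpace ℝ (Fin n) → ℂ} {y : EuclideanSpace ℝ (Fin n)} (hf : ContDiffAt ℝ 2 f y) :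
    diffExpr (fun i j y => (a i j y : ℂ)) b c (fun z => conj (f z)) y =
      conj (diffExpr (fun i j y => (a i j y : ℂ)) b c f y) +
        ∑ i, (b i y - conj (b i y)) * conj (partialDeriv i f y) +
        (c y - conj (c y)) * conj (f y) := by
  simp only [diffExpr, partialDeriv_partialDeriv_conj hf,
    partialDeriv_conj (hf.differentiableAt (by norm_num)), map_add, map_sum, map_mul,
    Complex.conj_ofReal, sub_mul, Finset.sum_sub_distrib]
  ring

/-- Some chart around `x` shows that the operator `P` is elliptic at `x`, with real symmetric
leading coefficients. In contrast to `IsEllipticAt`, a single chart is required, so that this is an open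
condition without a comparison of different charts. -/
def HasEllipticChart (P : SmoothFun n X →ₗ[ℂ] SmoothFun n X) (x : X) : Prop :=
  ∃ φ ∈ IsManifold.maximalAtlas (𝓡 n) ∞ X, x ∈ φ.source ∧
    ∃ (a : Fin n → Fin n → EuclideanSpace ℝ (Fin n) → ℝ)
      (b : Fin n → EuclideanSpace ℝ (Fin n) → ℂ) (c : EuclideanSpace ℝ (Fin n) → ℂ),
      (∀ i j y, a i j y = a j i y) ∧ HasLocalForm P φ (fun i j y => (a i j y : ℂ)) b c ∧
        ∀ ξ : EuclideanSpace ℝ (Fin n), ξ ≠ 0 → quadForm (fun i j => a i j (φ x)) ξ ≠ 0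

theorem continuousOn_of_ofReal {T : Set (EuclideanSpace ℝ (Fin n))}
    {f : EuclideanSpace ℝ (Fin n) → ℝ} (hf : ContinuousOn (fun y => (f y : ℂ)) T) :
    ContinuousOn f T := Complex.continuous_re.comp_continuousOn hf

theorem isOpen_hasEllipticChart : IsOpen {x | HasEllipticChart P x} := by
  rw [isOpen_iff_mem_nhds]
  rintro x ⟨φ, hφ, hx, a, b, c, hsymm, h, hell⟩
  obtain ⟨s, -, κ, hκ, hev⟩ := eventually_definite (fun i j =>
    (continuousOn_of_ofReal (h.smooth_a i j).continuousOn).continuousAt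
      (φ.open_target.mem_nhds (φ.map_source hx))) (fun i j => hsymm i j _) hell
  filter_upwards [φ.open_source.mem_nhds hx, (φ.continuousAt hx).eventually hev] with z hz hdef
  refine ⟨φ, hφ, hz, a, b, c, hsymm, h, fun ξ hξ h0 => ?_⟩
  have := hdef ξ
  rw [h0, mul_zero] at this
  have h1 : 0 < κ * ‖ξ‖ ^ 2 := by
    have := norm_pos_iff.mpr hξ
    positivity
  linarith

variable [MeasurableSpace X] [BorelSpace X] [T2Space X] [CompactSpace X] [IsManifold (𝓡 n) ∞ X]
  {μ : Measure X}

theorem IsEllipticAt.hasEllipticChart (hμ : IsSmoothDensity n μ) (hP : IsDiffOpOrderTwo P)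
    (hPsa : IsFormallySelfAdjoint μ P) {x : X} (hx : IsEllipticAt P x) :
    HasEllipticChart P x := by
  have hφ := IsManifold.chart_mem_maximalAtlas (I := 𝓡 n) (n := ∞) x
  have hxφ := mem_chart_source (EuclideanSpace ℝ (Fin n)) x
  obtain ⟨a, b, c, hsymm, h⟩ := exists_real_localForm hμ hP hPsa hφ
  exact ⟨_, hφ, hxφ, a, b, c, hsymm, h, hx.quadForm_ne_zero hφ hxφ h⟩

/-- The Caccioppoli inequality for the commutator of `P` with a smooth function, near a point
where `P` is elliptic. By the identity `∫ P(|w|²) θ² = ∫ |w|² conj(P(θ²))` no derivatives of `w`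
remain on the right-hand side. -/
theorem HasEllipticChart.exists_local_energy (hμ : IsSmoothDensity n μ) (hP : IsDiffOpOrderTwo P)
    (hPsa : IsFormallySelfAdjoint μ P) (hU : IsOpen U) (χ : SmoothFun n X) {x₀ : X}
    (hx₀U : x₀ ∈ U) (hell : HasEllipticChart P x₀) :
    ∃ θ : X → ℝ, Continuous θ ∧ (∀ᶠ x in 𝓝 x₀, θ x = 1) ∧ ∃ C, 0 ≤ C ∧ ∀ w : SmoothFun n X,
      ∫ x, θ x ^ 2 * ‖(commutator P χ w : X → ℂ) x‖ ^ 2 ∂μ ≤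
        C * (l2norm (μ.restrict U) (P w : X → ℂ) * l2norm (μ.restrict U) (w : X → ℂ) +
          l2norm (μ.restrict U) (w : X → ℂ) ^ 2) := by
  obtain ⟨φ, hφ, hxφ, a, b, c, hsymm, h, hell⟩ := hell
  obtain ⟨s, hs, κ, hκ, hev⟩ := eventually_definite (fun i j =>
    (continuousOn_of_ofReal (h.smooth_a i j).continuousOn).continuousAt
      (φ.open_target.mem_nhds (φ.map_source hxφ))) (fun i j => hsymm i j _) hell
  obtain ⟨r, hr, hball⟩ := Metric.nhds_basis_closedBall.mem_iff.mp
    (Filter.inter_mem (φ.open_target.mem_nhds (φ.map_source hxφ)) hev)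
  have hballT : Metric.closedBall (φ x₀) r ⊆ φ.target := fun y hy => (hball hy).1
  have hK := isCompact_closedBall (φ x₀) r
  set O := (φ.source ∩ φ ⁻¹' Metric.ball (φ x₀) r) ∩ U with hO
  have hOo : IsOpen O := (φ.isOpen_inter_preimage Metric.isOpen_ball).inter hU
  obtain ⟨θ, hθ, hθ1, hθO, hθI⟩ := exists_cutoff (n := n) (isClosed_singleton (x := x₀)) hOo
    (Set.singleton_subset_iff.mpr ⟨⟨hxφ, Metric.mem_ball_self hr⟩, hx₀U⟩)
  rw [nhdsSet_singleton] at hθ1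
  refine ⟨θ, hθ.continuous, hθ1, ?_⟩
  obtain ⟨Bb, hBb, hb⟩ := exists_bound_on_compact hK
    (fun i => (h.smooth_b i).continuousOn.mono hballT)
  obtain ⟨Bc, hc⟩ := hK.exists_bound_of_continuousOn (h.smooth_c.continuousOn.mono hballT)
  set B := max Bb Bc with hB
  have hχs := SmoothFun.contDiffOn_symm hφ χ
  obtain ⟨Kb, -, hβ⟩ := exists_bound_on_compact hK
    (fun i => (h.continuousOn_commCoeff hχs i).mono hballT)
  obtain ⟨Kc, hγ⟩ := hK.exists_bound_of_continuousOn ((h.continuousOn_commConst hχs).mono hballT)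
  set K := max Kb Kc with hKdef
  set θc := smoothOfReal θ hθ with hθc
  set θ₂ := smoothMul θc θc with hθ₂
  have hθ₂val (x) : (θ₂ : X → ℂ) x = ((θ x ^ 2 : ℝ) : ℂ) := by
    rw [hθ₂, coe_smoothMul, Pi.mul_apply, coe_smoothOfReal]
    push_cast
    ring
  obtain ⟨K₄, hK₄, hPθ⟩ := SmoothFun.exists_norm_le (P θ₂)
  set C₁ := K ^ 2 * (n + 1) / κ with hC₁
  set C₂ := n * (B ^ 2 / κ) + 3 * B with hC₂
  set C₃ := K ^ 2 * (n + 1) with hC₃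
  have hB0 : 0 ≤ B := hBb.trans (le_max_left _ _)
  have hC₁0 : 0 ≤ C₁ := by positivity
  have hC₂0 : 0 ≤ C₂ := by positivity
  have hC₃0 : 0 ≤ C₃ := by positivity
  refine ⟨C₁ * 2 + (C₁ * K₄ + (C₁ * C₂ + C₃)), by positivity, fun w => ?_⟩
  set q := smoothMul w (smoothConj w) with hq
  have hθ0 (x) (hx : x ∉ O) : θ x = 0 := image_eq_zero_of_notMem_tsupport fun h' => hx (hθO h')
  have hpt (x) : θ x ^ 2 * ‖(commutator P χ w : X → ℂ) x‖ ^ 2 ≤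
      C₁ * (s * ((P q : X → ℂ) x * conj ((θ₂ : X → ℂ) x)).re) +
      C₁ * 2 * (θ x ^ 2 * (‖(P w : X → ℂ) x‖ * ‖(w : X → ℂ) x‖)) +
      (C₁ * C₂ + C₃) * (θ x ^ 2 * ‖(w : X → ℂ) x‖ ^ 2) := by
    by_cases hx : x ∈ O
    · have hxs := hx.1.1
      have hxb : φ x ∈ Metric.closedBall (φ x₀) r := Metric.ball_subset_closedBall hx.1.2
      set W := (w : X → ℂ) ∘ φ.symm with hW
      have hWs : ContDiffAt ℝ 2 W (φ x) :=
        (SmoothFun.contDiffAt_symm hφ w (φ.map_source hxs)).of_le two_le_infty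
      have hWs' : ContDiffAt ℝ 2 (fun y => conj (W y)) (φ x) :=
        (SmoothFun.contDiffAt_symm hφ (smoothConj w) (φ.map_source hxs)).of_le two_le_infty
      have hWx : W (φ x) = (w : X → ℂ) x := by rw [hW, Function.comp_apply, φ.left_inv hxs]
      have e1 := energy_pointwise (a := fun i j => a i j (φ x)) (b := fun i => b i (φ x))
        (c := c (φ x)) hs hκ (hball hxb).2 (B := B)
        (fun i => (hb i _ hxb).trans (le_max_left _ _)) ((hc _ hxb).trans (le_max_right _ _))
        ((P w : X → ℂ) x) ((w : X → ℂ) x) (fun i => partialDeriv i W (φ x))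
      have e2 := norm_sq_commutator_le (K := K)
        (fun i => (hβ i _ hxb).trans (le_max_left _ _)) ((hγ _ hxb).trans (le_max_right _ _))
        ((w : X → ℂ) x) (fun i => partialDeriv i W (φ x))
      rw [← h.commutator_eq hφ χ w hxs] at e2
      have e3 : (P q : X → ℂ) x = (w : X → ℂ) x * (conj ((P w : X → ℂ) x) +
          ∑ i, (b i (φ x) - conj (b i (φ x))) * conj (partialDeriv i W (φ x)) +
          (c (φ x) - conj (c (φ x))) * conj ((w : X → ℂ) x)) +
          ∑ i, ∑ j, (a i j (φ x) : ℂ) * (partialDeriv i W (φ x) * conj (partialDeriv j W (φ x)) +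
            partialDeriv j W (φ x) * conj (partialDeriv i W (φ x))) +
          conj ((w : X → ℂ) x) * ((P w : X → ℂ) x - c (φ x) * (w : X → ℂ) x) := by
        have hqW : (q : X → ℂ) ∘ φ.symm = W * fun y => conj (W y) := rfl
        rw [h.apply_eq q hxs, hqW, diffExpr_mul hWs hWs', diffExpr_conj hWs, h.apply_eq w hxs,
          ← hW, hWx, gammaExpr]
        simp only [partialDeriv_conj (hWs.differentiableAt (by norm_num))]
      rw [← e3] at e1
      have e4 : ((P q : X → ℂ) x * conj ((θ₂ : X → ℂ) x)).re = θ x ^ 2 * ((P q : X → ℂ) x).re := by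
        rw [hθ₂val, Complex.conj_ofReal, Complex.re_mul_ofReal, mul_comm]
      rw [e4]
      set G := ∑ i, ‖partialDeriv i W (φ x)‖ ^ 2 with hG
      have e5 : ‖(commutator P χ w : X → ℂ) x‖ ^ 2 ≤ C₁ * (s * ((P q : X → ℂ) x).re +
          2 * (‖(w : X → ℂ) x‖ * ‖(P w : X → ℂ) x‖) + C₂ * ‖(w : X → ℂ) x‖ ^ 2) +
          C₃ * ‖(w : X → ℂ) x‖ ^ 2 := by
        calc _ ≤ C₃ * (G + ‖(w : X → ℂ) x‖ ^ 2) := e2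
          _ = C₁ * (κ * G) + C₃ * ‖(w : X → ℂ) x‖ ^ 2 := by
            rw [hC₁, hC₃]
            field_simp
          _ ≤ _ := by gcongr
      have e6 := mul_le_mul_of_nonneg_left e5 (sq_nonneg (θ x))
      refine e6.trans (le_of_eq ?_)
      ring
    · rw [hθ₂val, hθ0 x hx]
      simp
  have cw := SmoothFun.continuous w
  have cPw := SmoothFun.continuous (P w)
  have cθ := hθ.continuous
  have cPq := SmoothFun.continuous (P q)
  have cθ₂ := SmoothFun.continuous θ₂
  have i0 : Integrable (fun x => θ x ^ 2 * ‖(commutator P χ w : X → ℂ) x‖ ^ 2) μ :=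
    hμ.integrable_of_continuous
      ((cθ.pow 2).mul ((SmoothFun.continuous (commutator P χ w)).norm.pow 2))
  have i1' : Integrable (fun x => (P q : X → ℂ) x * conj ((θ₂ : X → ℂ) x)) μ :=
    hμ.integrable_of_continuous (cPq.mul (Complex.continuous_conj.comp cθ₂))
  have i1 : Integrable
      (fun x => C₁ * (s * ((P q : X → ℂ) x * conj ((θ₂ : X → ℂ) x)).re)) μ :=
    (i1'.re.const_mul s).const_mul C₁
  have i2' : Integrable (fun x => ‖(P w : X → ℂ) x‖ * ‖(w : X → ℂ) x‖) μ :=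
    hμ.integrable_of_continuous (cPw.norm.mul cw.norm)
  have i2 : Integrable (fun x => θ x ^ 2 * (‖(P w : X → ℂ) x‖ * ‖(w : X → ℂ) x‖)) μ :=
    hμ.integrable_of_continuous ((cθ.pow 2).mul (cPw.norm.mul cw.norm))
  have i3' : Integrable (fun x => ‖(w : X → ℂ) x‖ ^ 2) μ :=
    hμ.integrable_of_continuous (cw.norm.pow 2)
  have i3 : Integrable (fun x => θ x ^ 2 * ‖(w : X → ℂ) x‖ ^ 2) μ :=
    hμ.integrable_of_continuous ((cθ.pow 2).mul (cw.norm.pow 2))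
  have hθle (x) : θ x ^ 2 ≤ 1 := pow_le_one₀ (hθI x).1 (hθI x).2
  have hθU (x) (hx : x ∉ U) : θ x = 0 := hθ0 x fun h' => hx h'.2
  have hcut {g : X → ℝ} (hg : Integrable g μ) (hg0 : ∀ x, 0 ≤ g x)
      (hθg : Integrable (fun x => θ x ^ 2 * g x) μ) :
      ∫ x, θ x ^ 2 * g x ∂μ ≤ ∫ x in U, g x ∂μ := by
    rw [← setIntegral_eq_integral_of_forall_compl_eq_zero (s := U)
      (fun x hx => by rw [hθU x hx]; simp)]
    exact integral_mono hθg.integrableOn hg.integrableOn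
      fun x => mul_le_of_le_one_left (hg0 x) (hθle x)
  set N := l2norm (μ.restrict U) (w : X → ℂ) with hN
  set N' := l2norm (μ.restrict U) (P w : X → ℂ) with hN'
  have hN2 : ∫ x in U, ‖(w : X → ℂ) x‖ ^ 2 ∂μ = N ^ 2 := (l2norm_sq (hμ.memLp U w)).symm
  have b2 : ∫ x, θ x ^ 2 * (‖(P w : X → ℂ) x‖ * ‖(w : X → ℂ) x‖) ∂μ ≤ N' * N :=
    (hcut i2' (fun x => by positivity) i2).trans
      (integral_norm_mul_norm_le (hμ.memLp U (P w)) (hμ.memLp U w))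
  have b3 : ∫ x, θ x ^ 2 * ‖(w : X → ℂ) x‖ ^ 2 ∂μ ≤ N ^ 2 :=
    (hcut i3' (fun x => by positivity) i3).trans hN2.le
  have b1 : ∫ x, s * ((P q : X → ℂ) x * conj ((θ₂ : X → ℂ) x)).re ∂μ ≤ K₄ * N ^ 2 := by
    rw [integral_const_mul]
    have e1 : ∫ x, ((P q : X → ℂ) x * conj ((θ₂ : X → ℂ) x)).re ∂μ =
        (∫ x, (q : X → ℂ) x * conj ((P θ₂ : X → ℂ) x) ∂μ).re := by
      rw [← hPsa q θ₂]
      exact integral_re i1'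
    rw [e1]
    have e2 : ‖∫ x, (q : X → ℂ) x * conj ((P θ₂ : X → ℂ) x) ∂μ‖ ≤ K₄ * N ^ 2 := by
      have hsupp (x) (hx : x ∉ U) : (P θ₂ : X → ℂ) x = 0 := by
        refine image_eq_zero_of_notMem_tsupport fun h' => hx ?_
        have h1 : tsupport (θ₂ : X → ℂ) ⊆ tsupport θ := by
          refine closure_mono fun z hz h0 => hz ?_
          rw [hθ₂val, h0]
          simp
        exact (hθO (h1 (hP.tsupport_subset θ₂ h'))).2
      rw [← setIntegral_eq_integral_of_forall_compl_eq_zero (s := U)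
        (fun x hx => by rw [hsupp x hx]; simp), ← hN2, ← integral_const_mul]
      refine norm_integral_le_of_norm_le (i3'.integrableOn.const_mul K₄)
        (Filter.Eventually.of_forall fun x => ?_)
      have e3 : ‖(q : X → ℂ) x‖ = ‖(w : X → ℂ) x‖ ^ 2 := by
        rw [hq, coe_smoothMul, Pi.mul_apply, coe_smoothConj, norm_mul, Complex.norm_conj]
        ring
      rw [norm_mul, Complex.norm_conj, e3, mul_comm]
      gcongr
      exact hPθ x
    refine (le_abs_self _).trans ?_
    rw [abs_mul, hs, one_mul]
    exact (Complex.abs_re_le_norm _).trans e2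
  calc ∫ x, θ x ^ 2 * ‖(commutator P χ w : X → ℂ) x‖ ^ 2 ∂μ
      ≤ ∫ x, (C₁ * (s * ((P q : X → ℂ) x * conj ((θ₂ : X → ℂ) x)).re) +
        C₁ * 2 * (θ x ^ 2 * (‖(P w : X → ℂ) x‖ * ‖(w : X → ℂ) x‖)) +
        (C₁ * C₂ + C₃) * (θ x ^ 2 * ‖(w : X → ℂ) x‖ ^ 2)) ∂μ :=
        integral_mono i0 ((i1.add (i2.const_mul _)).add (i3.const_mul _)) hpt
    _ = C₁ * ∫ x, s * ((P q : X → ℂ) x * conj ((θ₂ : X → ℂ) x)).re ∂μ +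
        C₁ * 2 * ∫ x, θ x ^ 2 * (‖(P w : X → ℂ) x‖ * ‖(w : X → ℂ) x‖) ∂μ +
        (C₁ * C₂ + C₃) * ∫ x, θ x ^ 2 * ‖(w : X → ℂ) x‖ ^ 2 ∂μ := by
        rw [← integral_const_mul, ← integral_const_mul, ← integral_const_mul,
          ← integral_add i1 (i2.const_mul _)]
        exact integral_add (i1.add (i2.const_mul _)) (i3.const_mul _)
    _ ≤ C₁ * (K₄ * N ^ 2) + C₁ * 2 * (N' * N) + (C₁ * C₂ + C₃) * N ^ 2 := by gcongr
    _ ≤ (C₁ * 2 + (C₁ * K₄ + (C₁ * C₂ + C₃))) * (N' * N + N ^ 2) := by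
        have h1 : 0 ≤ N' * N := mul_nonneg l2norm_nonneg l2norm_nonneg
        have h2 : 0 ≤ C₁ * K₄ + (C₁ * C₂ + C₃) := by positivity
        nlinarith [mul_nonneg h2 h1, mul_nonneg hC₁0 (sq_nonneg N)]

/-- The Caccioppoli inequality for the commutator of `P` with a function which is `1` near the
points where `P` is not elliptic. With `‖P w‖ = O(1)` and `‖w‖ = O(1 / |m|)` the right-hand side is
`O(1 / |m|)`. -/
theorem exists_commutator_energy (hμ : IsSmoothDensity n μ) (hP : IsDiffOpOrderTwo P)
    (hPsa : IsFormallySelfAdjoint μ P) (hU : IsOpen U) {χ : SmoothFun n X}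
    (hχU : tsupport (χ : X → ℂ) ⊆ U)
    (hχ : ∀ x, ¬ HasEllipticChart P x → (χ : X → ℂ) =ᶠ[𝓝 x] 1) :
    ∃ C, 0 ≤ C ∧ ∀ w : SmoothFun n X,
      l2norm μ (commutator P χ w : X → ℂ) ^ 2 ≤
        C * (l2norm (μ.restrict U) (P w : X → ℂ) * l2norm (μ.restrict U) (w : X → ℂ) +
          l2norm (μ.restrict U) (w : X → ℂ) ^ 2) := by
  -- The commutator vanishes near points where `χ` is locally constant.
  have key (x₀ : X) : ∃ θ : X → ℝ, Continuous θ ∧ (∀ᶠ x in 𝓝 x₀, θ x = 1) ∧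
      ∃ C, 0 ≤ C ∧ ∀ w : SmoothFun n X,
        ∫ x, θ x ^ 2 * ‖(commutator P χ w : X → ℂ) x‖ ^ 2 ∂μ ≤
          C * (l2norm (μ.restrict U) (P w : X → ℂ) * l2norm (μ.restrict U) (w : X → ℂ) +
            l2norm (μ.restrict U) (w : X → ℂ) ^ 2) := by
    have hconst (k : ℂ) (hk : (χ : X → ℂ) =ᶠ[𝓝 x₀] fun _ => k) : ∃ θ : X → ℝ, Continuous θ ∧
        (∀ᶠ x in 𝓝 x₀, θ x = 1) ∧ ∃ C, 0 ≤ C ∧ ∀ w : SmoothFun n X,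
        ∫ x, θ x ^ 2 * ‖(commutator P χ w : X → ℂ) x‖ ^ 2 ∂μ ≤
          C * (l2norm (μ.restrict U) (P w : X → ℂ) * l2norm (μ.restrict U) (w : X → ℂ) +
            l2norm (μ.restrict U) (w : X → ℂ) ^ 2) := by
      obtain ⟨V, hV, hVo, hxV⟩ := mem_nhds_iff.mp hk
      obtain ⟨θ, hθ, hθ1, hθV, -⟩ := exists_cutoff (n := n) (isClosed_singleton (x := x₀)) hVo
        (Set.singleton_subset_iff.mpr hxV)
      rw [nhdsSet_singleton] at hθ1
      refine ⟨θ, hθ.continuous, hθ1, 0, le_rfl, fun w => ?_⟩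
      have h0 (x) : θ x ^ 2 * ‖(commutator P χ w : X → ℂ) x‖ ^ 2 = 0 := by
        by_cases hx : x ∈ V
        · have h1 : (smoothMul χ w : X → ℂ) =ᶠ[𝓝 x] (k • w : SmoothFun n X) := by
            filter_upwards [hVo.mem_nhds hx] with z hz
            have : (χ : X → ℂ) z = k := hV hz
            rw [coe_smoothMul, Pi.mul_apply, this]
            rfl
          have hχx : (χ : X → ℂ) x = k := hV hx
          have h2 : (commutator P χ w : X → ℂ) x = 0 := by
            rw [commutator_apply, hP.congr_at h1, map_smul, hχx]
            exact sub_self _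
          rw [h2]
          simp
        · rw [image_eq_zero_of_notMem_tsupport fun h' => hx (hθV h')]
          simp
      simp [h0]
    by_cases h1 : HasEllipticChart P x₀
    · by_cases h2 : x₀ ∈ tsupport (χ : X → ℂ)
      · exact h1.exists_local_energy hμ hP hPsa hU χ (hχU h2)
      · exact hconst 0 (notMem_tsupport_iff_eventuallyEq.mp h2)
    · exact hconst 1 (hχ x₀ h1)
  choose θ hθc hθ1 C hC hle using key
  obtain ⟨t, -, ht⟩ := isCompact_univ.elim_nhds_subcover (fun x => {z | θ x z = 1})
    fun x _ => hθ1 x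
  refine ⟨∑ x ∈ t, C x, Finset.sum_nonneg fun x _ => hC x, fun w => ?_⟩
  have hi (x) : Integrable (fun z => θ x z ^ 2 * ‖(commutator P χ w : X → ℂ) z‖ ^ 2) μ :=
    hμ.integrable_of_continuous
      (((hθc x).pow 2).mul ((SmoothFun.continuous (commutator P χ w)).norm.pow 2))
  have hint : Integrable (fun z => ‖(commutator P χ w : X → ℂ) z‖ ^ 2) μ :=
    hμ.integrable_of_continuous ((SmoothFun.continuous (commutator P χ w)).norm.pow 2)
  rw [l2norm_sq (hμ.memLp_of_continuous (SmoothFun.continuous (commutator P χ w))), Finset.sum_mul]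
  calc _ ≤ ∫ z, ∑ x ∈ t, θ x z ^ 2 * ‖(commutator P χ w : X → ℂ) z‖ ^ 2 ∂μ := by
        refine integral_mono hint (integrable_finsetSum _ fun x _ => hi x) fun z => ?_
        obtain ⟨x, hx, hxz⟩ := Set.mem_iUnion₂.mp (ht (Set.mem_univ z))
        have h1 : θ x z = 1 := hxz
        have h2 := Finset.single_le_sum
          (f := fun x => θ x z ^ 2 * ‖(commutator P χ w : X → ℂ) z‖ ^ 2)
          (fun x _ => by positivity) hx
        simpa only [h1, one_pow, one_mul] using h2
    _ = ∑ x ∈ t, ∫ z, θ x z ^ 2 * ‖(commutator P χ w : X → ℂ) z‖ ^ 2 ∂μ :=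
        integral_finsetSum _ fun x _ => hi x
    _ ≤ _ := Finset.sum_le_sum fun x _ => hle x w

end Commutator

/-! ### Transfer of approximate solvability -/

section Transfer

theorem l2norm_eq_restrict {α : Type*} [MeasurableSpace α] {ν : Measure α} {s : Set α}
    (hs : MeasurableSet s) {f : α → ℂ} (hf : ∀ x, x ∉ s → f x = 0) :
    l2norm ν f = l2norm (ν.restrict s) f := by
  rw [← l2norm_indicator hs]
  congr 1
  funext x
  by_cases hx : x ∈ s
  · rw [Set.indicator_of_mem hx]
  · rw [Set.indicator_of_notMem hx, hf x hx]

variable {n : ℕ} {X : Type*} [TopologicalSpace X]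
  [ChartedSpace (EuclideanSpace ℝ (Fin n)) X]
  {P : SmoothFun n X →ₗ[ℂ] SmoothFun n X} {U : Set X} [MeasurableSpace X] [BorelSpace X]
  [T2Space X] [CompactSpace X] [IsManifold (𝓡 n) ∞ X] {μ : Measure X}

/-- If `P` with domain `D₁` in `L²(ν₁)` is essentially self-adjoint, then the equation
`(P - i m) w = χ f` with `χ` supported in `U` is approximately solvable in any other domain which
coincides with `D₁` inside `U`: a solution is multiplied by a cutoff `χ'`, and the commutator
`[P, χ']` is controlled by the energy estimate. -/
theorem approxSolvable_of_isEssentiallySelfAdjoint (hμ : IsSmoothDensity n μ)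
    (hP : IsDiffOpOrderTwo P) (hPsa : IsFormallySelfAdjoint μ P) (hU : IsOpen U)
    (hell : ∀ x, x ∉ U → HasEllipticChart P x) {ν₁ ν₂ : Measure X}
    (h₁ : ν₁.restrict U = μ.restrict U) (h₂ : ν₂.restrict U = μ.restrict U)
    (hν₁ : ∀ u : SmoothFun n X, MemLp (u : X → ℂ) 2 ν₁) {D₁ D₂ : Submodule ℂ (SmoothFun n X)}
    (hD : ∀ χ w : SmoothFun n X, tsupport (χ : X → ℂ) ⊆ U → w ∈ D₁ → smoothMul χ w ∈ D₂)
    (hesa : IsEssentiallySelfAdjoint (opGraph hν₁ P D₁)) {χ : SmoothFun n X}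
    (hχ : tsupport (χ : X → ℂ) ⊆ U) : ApproxSolvable ν₂ P D₂ χ := by
  set Z := {x | HasEllipticChart P x}ᶜ with hZ
  have hZU : Z ⊆ U := fun x hx => by
    by_contra hxU
    exact hx (hell x hxU)
  -- `χ'` is `1` near the support of `χ`, so that `χ' χ f = χ f`, and near `Z`, so that the
  -- commutator `[P, χ']` vanishes where `P` is not elliptic.
  obtain ⟨χ', hχ'1, hχ'U, hχ'le⟩ := exists_smooth_cutoff (n := n)
    ((isClosed_tsupport (χ : X → ℂ)).union isOpen_hasEllipticChart.isClosed_compl) hU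
    (Set.union_subset hχ hZU)
  obtain ⟨C, hC, hen⟩ := exists_commutator_energy hμ hP hPsa hU hχ'U fun x hx =>
    hχ'1.filter_mono (nhds_le_nhdsSet (Set.mem_union_right _ hx))
  obtain ⟨K, hK, hχK⟩ := SmoothFun.exists_norm_le χ
  intro ε hε
  refine ⟨max 1 (8 * C * (K + 1) ^ 2 / ε ^ 2), fun m hm f hfm hf hf1 => ?_⟩
  have hm1 : 1 ≤ |m| := (le_max_left _ _).trans hm
  have hm2 : 8 * C * (K + 1) ^ 2 / ε ^ 2 ≤ |m| := (le_max_right _ _).trans hm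
  have hm0 : m ≠ 0 := by
    rintro rfl
    norm_num at hm1
  have hχ0 (x) (hx : x ∉ U) : (χ : X → ℂ) x = 0 :=
    image_eq_zero_of_notMem_tsupport fun h' => hx (hχ h')
  have hχf0 (x) (hx : x ∉ U) : ((χ : X → ℂ) * f) x = 0 := by
    rw [Pi.mul_apply, hχ0 x hx, zero_mul]
  have hχf₂ : MemLp ((χ : X → ℂ) * f) 2 ν₂ :=
    memLp_mul_of_bound (SmoothFun.continuous χ).measurable.aestronglyMeasurable
      (Filter.Eventually.of_forall hχK) hf
  have hχf : MemLp ((χ : X → ℂ) * f) 2 (μ.restrict U) := by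
    rw [← h₂]
    exact hχf₂.restrict U
  have hχf₁ : MemLp ((χ : X → ℂ) * f) 2 ν₁ := by
    rw [← h₁, ← memLp_indicator_iff_restrict hU.measurableSet] at hχf
    refine hχf.congr_norm ?_ (Filter.Eventually.of_forall fun x => ?_)
    · exact ((SmoothFun.continuous χ).measurable.mul hfm.measurable).aestronglyMeasurable
    · by_cases hx : x ∈ U
      · rw [Set.indicator_of_mem hx]
      · rw [Set.indicator_of_notMem hx, hχf0 x hx]
  have hnorm₁ : l2norm ν₁ ((χ : X → ℂ) * f) ≤ K := by
    rw [l2norm_eq_restrict hU.measurableSet hχf0, h₁, ← h₂]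
    refine (l2norm_restrict_le U hχf₂).trans ?_
    calc _ ≤ K * l2norm ν₂ f := l2norm_mul_le hK (Filter.Eventually.of_forall hχK) hf
      _ ≤ K * 1 := by gcongr
      _ = K := mul_one K
  obtain ⟨⟨w, hw⟩, e1, e2, e3⟩ :=
    IsEssentiallySelfAdjoint.exists_approx_solution (memLp_restrictedFun hν₁ LinearMap.id D₁)
      (memLp_restrictedFun hν₁ P D₁) hesa hm0 hχf₁ (ε := min 1 (ε / 2)) (by positivity)
  change l2norm ν₁ ((P w : X → ℂ) - ((m : ℂ) * Complex.I) • (w : X → ℂ) - (χ : X → ℂ) * f) ≤ _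
    at e1
  change |m| * l2norm ν₁ (w : X → ℂ) ≤ _ at e2
  change l2norm ν₁ (P w : X → ℂ) ≤ _ at e3
  have hmin1 : min 1 (ε / 2) ≤ 1 := min_le_left _ _
  have hmin2 : min 1 (ε / 2) ≤ ε / 2 := min_le_right _ _
  have hres {g : X → ℂ} (hg : MemLp g 2 ν₁) : l2norm (μ.restrict U) g ≤ l2norm ν₁ g := by
    rw [← h₁]
    exact l2norm_restrict_le U hg
  set N := l2norm (μ.restrict U) (w : X → ℂ) with hN
  have hN0 : 0 ≤ N := l2norm_nonneg
  have hmN : |m| * N ≤ K + 1 := by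
    calc |m| * N ≤ |m| * l2norm ν₁ (w : X → ℂ) := by
          gcongr
          exact hres (hν₁ w)
      _ ≤ K + 1 := by linarith
  have hN' : l2norm (μ.restrict U) (P w : X → ℂ) ≤ K + 1 := (hres (hν₁ (P w))).trans (by linarith)
  have hcomm : l2norm μ (commutator P χ' w : X → ℂ) ≤ ε / 2 := by
    refine le_of_sq_le_sq ((hen w).trans ?_) (by positivity)
    have hN1 : N ≤ (K + 1) / |m| := by
      rw [le_div_iff₀ (by linarith)]
      linarith
    have hN2 : N ≤ K + 1 := hN1.trans (div_le_self (by linarith) hm1)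
    calc _ ≤ C * ((K + 1) * ((K + 1) / |m|) + (K + 1) * ((K + 1) / |m|)) := by
          rw [sq]
          gcongr
      _ = (8 * C * (K + 1) ^ 2 / ε ^ 2) / |m| * (ε / 2) ^ 2 := by
          field_simp
          ring
      _ ≤ 1 * (ε / 2) ^ 2 := by
          gcongr
          rw [div_le_one (by linarith)]
          exact hm2
      _ = _ := one_mul _
  refine ⟨smoothMul χ' w, hD χ' w hχ'U hw, ?_⟩
  set err := (P w : X → ℂ) - ((m : ℂ) * Complex.I) • (w : X → ℂ) - (χ : X → ℂ) * f with herr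
  have herrm : MemLp err 2 ν₁ := ((hν₁ (P w)).sub ((hν₁ w).const_smul _)).sub hχf₁
  have heq : (P (smoothMul χ' w) : X → ℂ) -
      ((m : ℂ) * Complex.I) • (smoothMul χ' w : X → ℂ) - (χ : X → ℂ) * f =
      (χ' : X → ℂ) * err + (commutator P χ' w : X → ℂ) := by
    funext x
    have h1 : (χ' : X → ℂ) x * (χ : X → ℂ) x = (χ : X → ℂ) x := by
      by_cases h0 : (χ : X → ℂ) x = 0
      · rw [h0, mul_zero]
      · rw [hχ'1.self_of_nhdsSet x (Or.inl (subset_tsupport _ h0)), one_mul]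
    simp only [herr, Pi.add_apply, Pi.sub_apply, Pi.mul_apply, Pi.smul_apply, smul_eq_mul,
      commutator_apply, coe_smoothMul]
    linear_combination f x * h1
  have hχ'0 (x) (hx : x ∉ U) : (χ' : X → ℂ) x = 0 :=
    image_eq_zero_of_notMem_tsupport fun h' => hx (hχ'U h')
  have hcomm0 (x) (hx : x ∉ U) : (commutator P χ' w : X → ℂ) x = 0 := by
    have h1 : (P (smoothMul χ' w) : X → ℂ) x = 0 :=
      image_eq_zero_of_notMem_tsupport fun h' => hx (hχ'U
        (tsupport_mul_subset_left (hP.tsupport_subset _ h')))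
    rw [commutator_apply, h1, hχ'0 x hx, zero_mul, sub_zero]
  have herrU : MemLp err 2 (μ.restrict U) := by
    rw [← h₁]
    exact herrm.restrict U
  have hχ'm : MemLp ((χ' : X → ℂ) * err) 2 (μ.restrict U) :=
    memLp_mul_of_bound (SmoothFun.continuous χ').measurable.aestronglyMeasurable
      (Filter.Eventually.of_forall hχ'le) herrU
  rw [heq, l2norm_eq_restrict hU.measurableSet fun x hx => by
    rw [Pi.add_apply, Pi.mul_apply, hχ'0 x hx, hcomm0 x hx, zero_mul, add_zero], h₂]
  calc _ ≤ l2norm (μ.restrict U) ((χ' : X → ℂ) * err) +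
        l2norm (μ.restrict U) (commutator P χ' w : X → ℂ) :=
        l2norm_add_le hχ'm (hμ.memLp U _)
    _ ≤ 1 * l2norm (μ.restrict U) err + l2norm μ (commutator P χ' w : X → ℂ) := by
        gcongr
        · exact l2norm_mul_le zero_le_one (Filter.Eventually.of_forall hχ'le) herrU
        · exact l2norm_restrict_le U (hμ.memLp_of_continuous (SmoothFun.continuous _))
    _ ≤ ε / 2 + ε / 2 := by
        rw [one_mul]
        exact add_le_add (((hres herrm).trans e1).trans hmin2) hcomm
    _ = ε := add_halves ε

end Transfer

/-! ### Green's formula for the Dirichlet domain -/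

section Green

/-- A smooth step function. The last two bounds are invariant under dilations of the line. -/
theorem exists_step : ∃ H : ℝ → ℂ, ContDiff ℝ ∞ H ∧ (∀ s ≤ 1, H s = 0) ∧ (∀ s, 2 ≤ s → H s = 1) ∧
    (∀ s, ‖H s‖ ≤ 1) ∧ ∃ M, 0 ≤ M ∧ (∀ s, |s| * ‖deriv H s‖ ≤ M) ∧
      ∀ s, s ^ 2 * ‖deriv (deriv H) s‖ ≤ M := by
  obtain ⟨H, hH⟩ : ∃ H : ℝ → ℂ, ∀ s, H s = (Real.smoothTransition (s - 1) : ℂ) :=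
    ⟨_, fun _ => rfl⟩
  have hs : ContDiff ℝ ∞ H := by
    rw [funext hH]
    exact Complex.ofRealCLM.contDiff.comp
      (Real.smoothTransition.contDiff.comp (contDiff_id.sub contDiff_const))
  have h0 (s) (h : s ≤ 1) : H s = 0 := by
    rw [hH, Real.smoothTransition.zero_of_nonpos (by linarith), Complex.ofReal_zero]
  have h1 (s) (h : 2 ≤ s) : H s = 1 := by
    rw [hH, Real.smoothTransition.one_of_one_le (by linarith), Complex.ofReal_one]
  have hd : HasCompactSupport (deriv H) := by
    refine HasCompactSupport.intro (isCompact_Icc (a := (1 : ℝ)) (b := 2)) fun s hs => ?_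
    rw [Set.mem_Icc, not_and_or, not_le, not_le] at hs
    rcases hs with hs | hs
    · have : H =ᶠ[𝓝 s] fun _ => 0 := by
        filter_upwards [isOpen_Iio.mem_nhds hs] with t ht using h0 t (le_of_lt ht)
      rw [this.deriv_eq, deriv_const]
    · have : H =ᶠ[𝓝 s] fun _ => 1 := by
        filter_upwards [isOpen_Ioi.mem_nhds hs] with t ht using h1 t (le_of_lt ht)
      rw [this.deriv_eq, deriv_const]
  have hs1 : ContDiff ℝ ∞ (deriv H) := (contDiff_infty_iff_deriv.mp hs).2
  have hs2 : ContDiff ℝ ∞ (deriv (deriv H)) := (contDiff_infty_iff_deriv.mp hs1).2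
  have c1 : HasCompactSupport fun s : ℝ => (s : ℂ) * deriv H s := hd.mul_left
  have c2 : HasCompactSupport fun s : ℝ => (s : ℂ) ^ 2 * deriv (deriv H) s := hd.deriv.mul_left
  have k1 : Continuous fun s : ℝ => (s : ℂ) * deriv H s :=
    Complex.continuous_ofReal.mul hs1.continuous
  have k2 : Continuous fun s : ℝ => (s : ℂ) ^ 2 * deriv (deriv H) s :=
    (Complex.continuous_ofReal.pow 2).mul hs2.continuous
  obtain ⟨M₁, hM₁⟩ := k1.bounded_above_of_compact_support c1
  obtain ⟨M₂, hM₂⟩ := k2.bounded_above_of_compact_support c2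
  refine ⟨H, hs, h0, h1, fun s => ?_, max (max M₁ M₂) 0, le_max_right _ _, fun s => ?_, fun s => ?_⟩
  · rw [hH, Complex.norm_real, Real.norm_of_nonneg (Real.smoothTransition.nonneg _)]
    exact Real.smoothTransition.le_one _
  · have := hM₁ s
    rw [norm_mul, Complex.norm_real, Real.norm_eq_abs] at this
    exact this.trans ((le_max_left _ _).trans (le_max_left _ _))
  · have := hM₂ s
    rw [norm_mul, norm_pow, Complex.norm_real, Real.norm_eq_abs, sq_abs] at this
    exact this.trans ((le_max_right _ _).trans (le_max_left _ _))

variable {n : ℕ}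

theorem partialDeriv_comp_coord {f : ℝ → ℂ} {k : Fin n} {y : EuclideanSpace ℝ (Fin n)}
    (hf : DifferentiableAt ℝ f (y k)) (i : Fin n) :
    partialDeriv i (fun z => f (z k)) y = if i = k then deriv f (y k) else 0 := by
  have h1 : HasFDerivAt (fun z : EuclideanSpace ℝ (Fin n) => z k)
      (EuclideanSpace.proj k : EuclideanSpace ℝ (Fin n) →L[ℝ] ℝ) y :=
    (EuclideanSpace.proj k : EuclideanSpace ℝ (Fin n) →L[ℝ] ℝ).hasFDerivAt
  have h2 := (hf.hasDerivAt.hasFDerivAt.comp y h1).fderiv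
  have h3 : fderiv ℝ (fun z : EuclideanSpace ℝ (Fin n) => f (z k)) y = _ := h2
  rw [partialDeriv, h3]
  by_cases hik : i = k
  · subst hik
    simp
  · simp [hik, Ne.symm hik]

section Bounds

variable {H : ℝ → ℂ} {M : ℝ} (hH : ContDiff ℝ ∞ H) (h₁ : ∀ s, |s| * ‖deriv H s‖ ≤ M)
  (h₂ : ∀ s, s ^ 2 * ‖deriv (deriv H) s‖ ≤ M) (l : ℝ) {k : Fin n}
  {y : EuclideanSpace ℝ (Fin n)}

include hH in
theorem deriv_dilation (t : ℝ) : deriv (fun t => H (l * t)) t = (l : ℂ) * deriv H (l * t) := by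
  have h := ((hH.differentiable (by simp)) (l * t)).hasDerivAt.scomp t
    ((hasDerivAt_id t).const_mul l)
  have h' : deriv (fun t => H (l * t)) t = _ := h.deriv
  rw [h']
  simp

include hH h₁ in
/-- A dilated step function of `yₖ` has first derivatives of size `1 / |yₖ|`, uniformly in the
dilation. -/
theorem norm_partialDeriv_dilation_le (i : Fin n) :
    |y k| * ‖partialDeriv i (fun z => H (l * z k)) y‖ ≤ M := by
  have hd : DifferentiableAt ℝ (fun t => H (l * t)) (y k) := by
    have := hH.differentiable (by simp)
    fun_prop
  rw [partialDeriv_comp_coord (f := fun t => H (l * t)) hd]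
  split_ifs with hi
  · rw [deriv_dilation hH, norm_mul, Complex.norm_real, Real.norm_eq_abs, ← mul_assoc, ← abs_mul,
      mul_comm (y k)]
    exact h₁ _
  · rw [norm_zero, mul_zero]
    exact le_trans (by positivity) (h₁ 0)

include hH h₁ h₂ in
theorem norm_partialDeriv_partialDeriv_dilation_le (i j : Fin n) :
    y k ^ 2 * ‖partialDeriv i (partialDeriv j fun z => H (l * z k)) y‖ ≤ M := by
  have hM : 0 ≤ M := le_trans (by positivity) (h₁ 0)
  have hd : Differentiable ℝ H := hH.differentiable (by simp)
  have hs1 : ContDiff ℝ ∞ (deriv H) := (contDiff_infty_iff_deriv.mp hH).2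
  have hd1 : Differentiable ℝ (deriv H) := hs1.differentiable (by simp)
  by_cases hj : j = k
  · have e : (partialDeriv j fun z => H (l * z k)) =
        fun z : EuclideanSpace ℝ (Fin n) => (l : ℂ) * deriv H (l * z k) := by
      funext z
      rw [partialDeriv_comp_coord (f := fun t => H (l * t)) (by fun_prop), if_pos hj,
        deriv_dilation hH]
    have hdd : DifferentiableAt ℝ (fun t => (l : ℂ) * deriv H (l * t)) (y k) := by fun_prop
    rw [e, partialDeriv_comp_coord (f := fun t => (l : ℂ) * deriv H (l * t)) hdd]
    split_ifs with hi
    · rw [deriv_const_mul_field, deriv_dilation hs1, norm_mul, norm_mul, Complex.norm_real,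
        Real.norm_eq_abs]
      calc _ = (l * y k) ^ 2 * ‖deriv (deriv H) (l * y k)‖ := by
            rw [mul_pow, ← sq_abs l]
            ring
        _ ≤ M := h₂ _
    · rw [norm_zero, mul_zero]
      exact hM
  · have e : (partialDeriv j fun z => H (l * z k)) =
        fun _ : EuclideanSpace ℝ (Fin n) => (0 : ℂ) := by
      funext z
      rw [partialDeriv_comp_coord (f := fun t => H (l * t)) (by fun_prop), if_neg hj]
    rw [e]
    simpa [partialDeriv] using hM

include hH h₁ h₂ in
theorem norm_diffExpr_dilation_le {a : Fin n → Fin n → EuclideanSpace ℝ (Fin n) → ℂ}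
    {b : Fin n → EuclideanSpace ℝ (Fin n) → ℂ} {c : EuclideanSpace ℝ (Fin n) → ℂ} {B R : ℝ}
    (ha : ∀ i j, ‖a i j y‖ ≤ B) (hb : ∀ i, ‖b i y‖ ≤ B) (hc : ‖c y‖ ≤ B) (hR : |y k| ≤ R)
    (hH1 : ∀ s, ‖H s‖ ≤ 1) :
    y k ^ 2 * ‖diffExpr a b c (fun z => H (l * z k)) y‖ ≤
      n * n * (B * M) + R * (n * (B * M)) + R ^ 2 * B := by
  have hB : 0 ≤ B := (norm_nonneg _).trans hc
  have hR0 : 0 ≤ R := (abs_nonneg _).trans hR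
  set g : EuclideanSpace ℝ (Fin n) → ℂ := fun z => H (l * z k) with hg
  have e1 : y k ^ 2 * ‖∑ i, ∑ j, a i j y * partialDeriv i (partialDeriv j g) y‖ ≤
      n * n * (B * M) := by
    calc _ ≤ y k ^ 2 * ∑ i, ∑ j, B * ‖partialDeriv i (partialDeriv j g) y‖ := by
          gcongr
          refine (norm_sum_le _ _).trans (Finset.sum_le_sum fun i _ => (norm_sum_le _ _).trans
            (Finset.sum_le_sum fun j _ => ?_))
          rw [norm_mul]
          gcongr
          exact ha i j
      _ = ∑ i, ∑ j, B * (y k ^ 2 * ‖partialDeriv i (partialDeriv j g) y‖) := by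
          simp only [Finset.mul_sum]
          exact Finset.sum_congr rfl fun i _ => Finset.sum_congr rfl fun j _ => by ring
      _ ≤ ∑ _i : Fin n, ∑ _j : Fin n, B * M := by
          gcongr with i _ j _
          exact norm_partialDeriv_partialDeriv_dilation_le hH h₁ h₂ l i j
      _ = _ := by simp; ring
  have e2 : y k ^ 2 * ‖∑ i, b i y * partialDeriv i g y‖ ≤ R * (n * (B * M)) := by
    calc _ ≤ y k ^ 2 * ∑ i, B * ‖partialDeriv i g y‖ := by
          gcongr
          refine (norm_sum_le _ _).trans (Finset.sum_le_sum fun i _ => ?_)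
          rw [norm_mul]
          gcongr
          exact hb i
      _ = |y k| * ∑ i, B * (|y k| * ‖partialDeriv i g y‖) := by
          rw [← sq_abs, sq, mul_assoc]
          simp only [Finset.mul_sum]
          exact Finset.sum_congr rfl fun i _ => by ring
      _ ≤ R * ∑ _i : Fin n, B * M := by
          have (i : Fin n) := norm_partialDeriv_dilation_le hH h₁ l (y := y) (k := k) i
          gcongr with i _
          exact this i
      _ = _ := by simp
  have e3 : y k ^ 2 * ‖c y * g y‖ ≤ R ^ 2 * B := by
    rw [norm_mul, ← sq_abs]
    calc _ ≤ R ^ 2 * (B * 1) := by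
          gcongr
          exact hH1 _
      _ = _ := by ring
  rw [diffExpr]
  calc _ ≤ y k ^ 2 * (‖∑ i, ∑ j, a i j y * partialDeriv i (partialDeriv j g) y‖ +
        ‖∑ i, b i y * partialDeriv i g y‖ + ‖c y * g y‖) := by
        gcongr
        exact (norm_add_le _ _).trans (by gcongr; exact norm_add_le _ _)
    _ ≤ _ := by
        rw [mul_add, mul_add]
        linarith

end Bounds

/-- A smooth function which vanishes on a hyperplane is bounded by the distance to it. -/
theorem exists_norm_le_abs_coord {T : Set (EuclideanSpace ℝ (Fin n))} (hT : IsOpen T)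
    {V : EuclideanSpace ℝ (Fin n) → ℂ} (hV : ContDiffOn ℝ ∞ V T) {k : Fin n}
    {y₀ : EuclideanSpace ℝ (Fin n)} (hy₀ : y₀ k = 0) {r : ℝ}
    (hr : Metric.closedBall y₀ r ⊆ T) (hV0 : ∀ y ∈ Metric.closedBall y₀ r, y k = 0 → V y = 0) :
    ∃ L, 0 ≤ L ∧ ∀ y ∈ Metric.closedBall y₀ r, ‖V y‖ ≤ L * |y k| := by
  have hc : ContinuousOn (fderiv ℝ V) T := hV.continuousOn_fderiv_of_isOpen hT (by simp)
  obtain ⟨L, hL⟩ := (isCompact_closedBall y₀ r).exists_bound_of_continuousOn (hc.mono hr)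
  refine ⟨max L 0, le_max_right _ _, fun y hy => ?_⟩
  set z := y - y k • EuclideanSpace.single k (1 : ℝ) with hz
  have hzk : z k = 0 := by simp [hz]
  have hzb : z ∈ Metric.closedBall y₀ r := by
    rw [Metric.mem_closedBall, dist_eq_norm] at hy ⊢
    refine le_trans ?_ hy
    rw [EuclideanSpace.norm_eq, EuclideanSpace.norm_eq]
    refine Real.sqrt_le_sqrt (Finset.sum_le_sum fun i _ => ?_)
    by_cases hi : i = k
    · rw [hi, PiLp.sub_apply, hzk, hy₀, sub_zero, norm_zero, zero_pow two_ne_zero]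
      exact sq_nonneg _
    · simp [hz, hi]
  have h1 := (convex_closedBall y₀ r).norm_image_sub_le_of_norm_fderiv_le (𝕜 := ℝ) (f := V)
    (fun x hx => (hV.contDiffAt (hT.mem_nhds (hr hx))).differentiableAt (by simp))
    (fun x hx => hL x hx) hzb hy
  rw [hV0 z hzb hzk, sub_zero] at h1
  have h2 : ‖y - z‖ = |y k| := by
    rw [hz, sub_sub_cancel, norm_smul, PiLp.norm_single, norm_one, mul_one, Real.norm_eq_abs]
  rw [h2] at h1
  exact h1.trans (by gcongr; exact le_max_left _ _)

end Green

section GreenFormula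

/-- In a chart in which `U` is one side of a hyperplane, the hyperplane lies in the frontier. -/
theorem mem_frontier_of_apply_eq_zero {n : ℕ} {X : Type*} [TopologicalSpace X]
    {φ : OpenPartialHomeomorph X (EuclideanSpace ℝ (Fin n))} {U : Set X} {k : Fin n}
    (hk : ∀ x ∈ φ.source, x ∈ U ↔ 0 < φ x k) {x : X} (hx : x ∈ φ.source) (h0 : φ x k = 0) :
    x ∈ frontier U := by
  have hxU : x ∉ U := fun h => by
    have := (hk x hx).mp h
    linarith
  refine ⟨?_, fun h => hxU (interior_subset h)⟩
  have hline : Filter.Tendsto (fun t : ℝ => φ x + t • EuclideanSpace.single k (1 : ℝ)) (𝓝[>] 0)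
      (𝓝 (φ x)) := by
    have : Continuous fun t : ℝ => φ x + t • EuclideanSpace.single k (1 : ℝ) := by fun_prop
    have h := this.tendsto 0
    rw [zero_smul, add_zero] at h
    exact h.mono_left nhdsWithin_le_nhds
  refine mem_closure_of_tendsto (b := 𝓝[>] (0 : ℝ)) ((φ.tendsto_symm hx).comp hline) ?_
  filter_upwards [hline.eventually (φ.open_target.mem_nhds (φ.map_source hx)),
    self_mem_nhdsWithin] with t ht htpos
  rw [Function.comp_apply, hk _ (φ.map_target ht), φ.right_inv ht]
  simpa [h0] using htpos

variable {n : ℕ} {X : Type*} [TopologicalSpace X]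
  [ChartedSpace (EuclideanSpace ℝ (Fin n)) X]
  {P : SmoothFun n X →ₗ[ℂ] SmoothFun n X}
  {φ : OpenPartialHomeomorph X (EuclideanSpace ℝ (Fin n))} {U : Set X} [MeasurableSpace X]
  [BorelSpace X] [CompactSpace X] [IsManifold (𝓡 n) ∞ X] {μ : Measure X}

/-- Green's formula for functions supported near a boundary point. The function `v` is multiplied
by a step function of `(j + 1) yₖ`; derivatives of the step function cost powers of `1 / yₖ`, which
are compensated by the vanishing of `u` and `v` for `yₖ = 0`, so that the limit `j → ∞` can be taken
by dominated convergence. -/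
theorem exists_green_of_boundary_chart (hμ : IsSmoothDensity n μ) (hP : IsDiffOpOrderTwo P)
    (hPsa : IsFormallySelfAdjoint μ P) (hU : IsOpen U)
    (hφ : φ ∈ IsManifold.maximalAtlas (𝓡 n) ∞ X) {k : Fin n}
    (hk : ∀ z ∈ φ.source, z ∈ U ↔ 0 < φ z k) {x₀ : X} (hx₀ : x₀ ∈ φ.source)
    (hx₀k : φ x₀ k = 0) :
    ∃ O, IsOpen O ∧ x₀ ∈ O ∧ ∀ u ∈ dirichletDomain n U, ∀ v ∈ dirichletDomain n U,
      tsupport (v : X → ℂ) ⊆ O →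
      ∫ x in U, (P u : X → ℂ) x * conj ((v : X → ℂ) x) ∂μ =
        ∫ x in U, (u : X → ℂ) x * conj ((P v : X → ℂ) x) ∂μ := by
  obtain ⟨a, b, c, h⟩ := hP φ hφ
  obtain ⟨r, hr, hrT⟩ := Metric.nhds_basis_closedBall.mem_iff.mp
    (φ.open_target.mem_nhds (φ.map_source hx₀))
  have hK := isCompact_closedBall (φ x₀) r
  set O := φ.source ∩ φ ⁻¹' Metric.ball (φ x₀) r with hO
  refine ⟨O, φ.isOpen_inter_preimage Metric.isOpen_ball, ⟨hx₀, Metric.mem_ball_self hr⟩,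
    fun u hu v hv hvO => ?_⟩
  have hvs : tsupport (v : X → ℂ) ⊆ φ.source := hvO.trans Set.inter_subset_left
  obtain ⟨Ba, hBa, ha⟩ := exists_bound_on_compact hK (β := fun ij : Fin n × Fin n => a ij.1 ij.2)
    (fun ij => (h.smooth_a ij.1 ij.2).continuousOn.mono hrT)
  obtain ⟨Bb, -, hb⟩ := exists_bound_on_compact hK
    (fun i => (h.smooth_b i).continuousOn.mono hrT)
  obtain ⟨Bc, hc⟩ := hK.exists_bound_of_continuousOn (h.smooth_c.continuousOn.mono hrT)
  set B := max Ba (max Bb Bc) with hB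
  set V := (v : X → ℂ) ∘ φ.symm with hV
  have hVs := SmoothFun.contDiffOn_symm hφ v
  obtain ⟨Kb, hKb, hβ⟩ := exists_bound_on_compact hK
    (fun i => (h.continuousOn_commCoeff hVs i).mono hrT)
  obtain ⟨Kc, hγ⟩ := hK.exists_bound_of_continuousOn ((h.continuousOn_commConst hVs).mono hrT)
  have hKc : 0 ≤ Kc := (norm_nonneg _).trans (hγ _ (Metric.mem_closedBall_self hr.le))
  have hvanish (w : SmoothFun n X) (hw : w ∈ dirichletDomain n U) :
      ∀ y ∈ Metric.closedBall (φ x₀) r, y k = 0 → ((w : X → ℂ) ∘ φ.symm) y = 0 := by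
    intro y hy hyk
    refine hw _ (mem_frontier_of_apply_eq_zero hk (φ.map_target (hrT hy)) ?_)
    rw [φ.right_inv (hrT hy), hyk]
  obtain ⟨Lu, hLu, hule⟩ := exists_norm_le_abs_coord φ.open_target
    (SmoothFun.contDiffOn_symm hφ u) hx₀k hrT (hvanish u hu)
  obtain ⟨Lv, hLv, hvle⟩ := exists_norm_le_abs_coord φ.open_target hVs hx₀k hrT (hvanish v hv)
  obtain ⟨Ku, hKu, hukle⟩ := SmoothFun.exists_norm_le u
  obtain ⟨H, hH, hH0, hH1, hHle, M, hM, hM1, hM2⟩ := exists_step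
  have hHs (l : ℝ) : ContDiff ℝ ∞ fun y : EuclideanSpace ℝ (Fin n) => H (l * y k) := by
    have : ContDiff ℝ ∞ fun y : EuclideanSpace ℝ (Fin n) => l * y k := by fun_prop
    exact hH.comp this
  set vl : ℕ → SmoothFun n X := fun j => smoothLift hφ v hvs _ (hHs (j + 1)) with hvl
  have hvl_apply (j : ℕ) (x : X) :
      (vl j : X → ℂ) x = (v : X → ℂ) x * H ((j + 1) * φ x k) := rfl
  have hcoord {x : X} (hx : x ∈ φ.source) : ContinuousAt (fun z => φ z k) x :=
    (EuclideanSpace.proj k : EuclideanSpace ℝ (Fin n) →L[ℝ] ℝ).continuous.continuousAt.comp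
      (φ.continuousAt hx)
  have hout {x : X} (hx : x ∉ O) (j : ℕ) : (vl j : X → ℂ) =ᶠ[𝓝 x] (0 : SmoothFun n X) ∧
      (v : X → ℂ) =ᶠ[𝓝 x] (0 : SmoothFun n X) := by
    have h1 : (v : X → ℂ) =ᶠ[𝓝 x] (0 : SmoothFun n X) :=
      notMem_tsupport_iff_eventuallyEq.mp fun h' => hx (hvO h')
    refine ⟨?_, h1⟩
    filter_upwards [h1] with z hz
    rw [hvl_apply, hz]
    exact zero_mul _
  have hoff (j : ℕ) {x : X} (hx : x ∉ U) : (vl j : X → ℂ) =ᶠ[𝓝 x] (0 : SmoothFun n X) := by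
    by_cases hxO : x ∈ O
    · have hxk : φ x k ≤ 0 := not_lt.mp fun h' => hx ((hk x hxO.1).mpr h')
      have h1 : ∀ᶠ z in 𝓝 x, ((j : ℝ) + 1) * φ z k < 1 := by
        refine ((hcoord hxO.1).const_mul ((j : ℝ) + 1)).eventually_lt continuousAt_const ?_
        have : ((j : ℝ) + 1) * φ x k ≤ 0 := mul_nonpos_of_nonneg_of_nonpos (by positivity) hxk
        linarith
      filter_upwards [h1] with z hz
      rw [hvl_apply, hH0 _ hz.le]
      exact mul_zero _
    · exact (hout hxO j).1
  have hon {x : X} (hx : x ∈ U) : ∀ᶠ j : ℕ in Filter.atTop, (vl j : X → ℂ) =ᶠ[𝓝 x] v := by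
    by_cases hxO : x ∈ O
    · have hxk : 0 < φ x k := (hk x hxO.1).mp hx
      filter_upwards [Filter.eventually_ge_atTop ⌈4 / φ x k⌉₊] with j hj
      have hj' : 4 / φ x k ≤ (j : ℝ) + 1 :=
        (Nat.le_ceil _).trans ((Nat.cast_le.mpr hj).trans (by linarith))
      have h1 : ∀ᶠ z in 𝓝 x, φ x k / 2 < φ z k :=
        continuousAt_const.eventually_lt (hcoord hxO.1) (by linarith)
      filter_upwards [h1] with z hz
      have h2 : 2 ≤ ((j : ℝ) + 1) * φ z k := by
        calc (2 : ℝ) = 4 / φ x k * (φ x k / 2) := by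
              field_simp
              norm_num
          _ ≤ _ := by gcongr
      rw [hvl_apply, hH1 _ h2, mul_one]
    · filter_upwards with j
      exact (hout hxO j).1.trans (hout hxO j).2.symm
  set Q := Lu * (Lv * (n * n * (B * M) + r * (n * (B * M)) + r ^ 2 * B)) +
    Lu * (n * (Kb * M)) + Ku * Kc with hQ
  have hB0 : 0 ≤ B := hBa.trans (le_max_left _ _)
  have hQ0 : 0 ≤ Q := by positivity
  have hbound (j : ℕ) {x : X} (hx : x ∈ U) :
      ‖(u : X → ℂ) x‖ * ‖(P (vl j) : X → ℂ) x‖ ≤ Q := by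
    by_cases hxO : x ∈ O
    · have hxk : 0 < φ x k := (hk x hxO.1).mp hx
      have hyK : φ x ∈ Metric.closedBall (φ x₀) r := Metric.ball_subset_closedBall hxO.2
      have hxr : |φ x k| ≤ r := by
        have h1 : ‖φ x - φ x₀‖ ≤ r := by
          rw [← dist_eq_norm]
          exact hyK
        have h2 := (abs_apply_le_norm (φ x - φ x₀) k).trans h1
        rwa [PiLp.sub_apply, hx₀k, sub_zero] at h2
      have e0 := h.apply_smoothLift hφ v hvs (hHs (j + 1)) (φ.map_source hxO.1)
      rw [φ.left_inv hxO.1] at e0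
      have e1 : (P (vl j) : X → ℂ) x = _ := e0
      have d1 := norm_diffExpr_dilation_le hH hM1 hM2 (j + 1) (k := k) (y := φ x) (R := r)
        (a := a) (b := b) (c := c) (B := B)
        (fun i j => (ha (i, j) _ hyK).trans (le_max_left _ _))
        (fun i => (hb i _ hyK).trans ((le_max_left _ _).trans (le_max_right _ _)))
        ((hc _ hyK).trans ((le_max_right _ _).trans (le_max_right _ _))) hxr hHle
      have d2 (i) := norm_partialDeriv_dilation_le hH hM1 (j + 1) (k := k) (y := φ x) i
      set g : EuclideanSpace ℝ (Fin n) → ℂ := fun z => H (((j : ℝ) + 1) * z k) with hg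
      have hux : ‖(u : X → ℂ) x‖ ≤ Lu * |φ x k| := by
        have := hule _ hyK
        rwa [Function.comp_apply, φ.left_inv hxO.1] at this
      have hVx : ‖V (φ x)‖ ≤ Lv * |φ x k| := hvle _ hyK
      have t1 : ‖(u : X → ℂ) x‖ * ‖V (φ x) * diffExpr a b c g (φ x)‖ ≤
          Lu * (Lv * (n * n * (B * M) + r * (n * (B * M)) + r ^ 2 * B)) := by
        rw [norm_mul]
        calc _ ≤ Lu * |φ x k| * (Lv * |φ x k| * ‖diffExpr a b c g (φ x)‖) := by gcongr
          _ = Lu * (Lv * (φ x k ^ 2 * ‖diffExpr a b c g (φ x)‖)) := by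
              rw [← sq_abs (φ x k)]
              ring
          _ ≤ _ := by gcongr
      have t2 : ‖(u : X → ℂ) x‖ * ‖∑ i, commCoeff a V i (φ x) * partialDeriv i g (φ x)‖ ≤
          Lu * (n * (Kb * M)) := by
        calc _ ≤ Lu * |φ x k| * ∑ i, Kb * ‖partialDeriv i g (φ x)‖ := by
              gcongr
              refine (norm_sum_le _ _).trans (Finset.sum_le_sum fun i _ => ?_)
              rw [norm_mul]
              gcongr
              exact hβ i _ hyK
          _ = Lu * ∑ i, Kb * (|φ x k| * ‖partialDeriv i g (φ x)‖) := by
              rw [mul_assoc, Finset.mul_sum]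
              congr 1
              exact Finset.sum_congr rfl fun i _ => by ring
          _ ≤ Lu * ∑ _i : Fin n, Kb * M := by
              gcongr with i _
              exact d2 i
          _ = _ := by simp
      have t3 : ‖(u : X → ℂ) x‖ * ‖commConst a b c V (φ x) * g (φ x)‖ ≤ Ku * Kc := by
        rw [norm_mul]
        calc _ ≤ Ku * (Kc * 1) := by
              gcongr
              · exact hukle x
              · exact hγ _ hyK
              · exact hHle _
          _ = _ := by ring
      rw [e1]
      calc _ ≤ ‖(u : X → ℂ) x‖ * (‖V (φ x) * diffExpr a b c g (φ x)‖ +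
            ‖∑ i, commCoeff a V i (φ x) * partialDeriv i g (φ x)‖ +
            ‖commConst a b c V (φ x) * g (φ x)‖) := by
            gcongr
            exact (norm_add_le _ _).trans (by gcongr; exact norm_add_le _ _)
        _ ≤ _ := by
            rw [mul_add, mul_add]
            linarith
    · rw [hP.congr_at (hout hxO j).1, map_zero]
      simpa using hQ0
  have hfin := hμ.isFiniteMeasure
  have hint (w w' : SmoothFun n X) :
      Integrable (fun x => (w : X → ℂ) x * conj ((w' : X → ℂ) x)) μ :=
    hμ.integrable_of_continuous ((SmoothFun.continuous w).mul
      (Complex.continuous_conj.comp (SmoothFun.continuous w')))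
  -- `vl j` is supported in `U`, so that formal self-adjointness on `X` applies.
  have hgreen (j : ℕ) : ∫ x in U, (P u : X → ℂ) x * conj ((vl j : X → ℂ) x) ∂μ =
      ∫ x in U, (u : X → ℂ) x * conj ((P (vl j) : X → ℂ) x) ∂μ := by
    rw [setIntegral_eq_integral_of_forall_compl_eq_zero fun x hx => by
        rw [(hoff j hx).eq_of_nhds]
        simp,
      setIntegral_eq_integral_of_forall_compl_eq_zero fun x hx => by
        rw [hP.congr_at (hoff j hx), map_zero]
        simp]
    exact hPsa u (vl j)
  have lim1 : Filter.Tendsto (fun j => ∫ x in U, (P u : X → ℂ) x * conj ((vl j : X → ℂ) x) ∂μ)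
      Filter.atTop (𝓝 (∫ x in U, (P u : X → ℂ) x * conj ((v : X → ℂ) x) ∂μ)) := by
    refine tendsto_integral_of_dominated_convergence
      (fun x => ‖(P u : X → ℂ) x * conj ((v : X → ℂ) x)‖)
      (fun j => (hint _ _).aestronglyMeasurable.restrict) (hint _ _).integrableOn.norm
      (fun j => Filter.Eventually.of_forall fun x => ?_) ?_
    · rw [norm_mul, norm_mul, Complex.norm_conj, Complex.norm_conj, hvl_apply, norm_mul]
      gcongr
      exact mul_le_of_le_one_right (norm_nonneg _) (hHle _)
    · filter_upwards [ae_restrict_mem hU.measurableSet] with x hx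
      refine tendsto_const_nhds.congr' ?_
      filter_upwards [hon hx] with j hj
      rw [hj.eq_of_nhds]
  have lim2 : Filter.Tendsto (fun j => ∫ x in U, (u : X → ℂ) x * conj ((P (vl j) : X → ℂ) x) ∂μ)
      Filter.atTop (𝓝 (∫ x in U, (u : X → ℂ) x * conj ((P v : X → ℂ) x) ∂μ)) := by
    refine tendsto_integral_of_dominated_convergence (fun _ => Q)
      (fun j => (hint _ _).aestronglyMeasurable.restrict) (integrable_const Q) (fun j => ?_) ?_
    · filter_upwards [ae_restrict_mem hU.measurableSet] with x hx
      rw [norm_mul, Complex.norm_conj]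
      exact hbound j hx
    · filter_upwards [ae_restrict_mem hU.measurableSet] with x hx
      refine tendsto_const_nhds.congr' ?_
      filter_upwards [hon hx] with j hj
      rw [hP.congr_at hj]
  simp only [hgreen] at lim1
  exact tendsto_nhds_unique lim1 lim2

/-- Green's formula: the Dirichlet restriction of a formally self-adjoint operator is symmetric. -/
theorem integral_green_dirichlet [T2Space X] (hμ : IsSmoothDensity n μ) (hP : IsDiffOpOrderTwo P)
    (hPsa : IsFormallySelfAdjoint μ P) (hU : IsOpen U) (hUb : HasSmoothBoundary n U)
    {u v : SmoothFun n X} (hu : u ∈ dirichletDomain n U) (hv : v ∈ dirichletDomain n U) :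
    ∫ x in U, (P u : X → ℂ) x * conj ((v : X → ℂ) x) ∂μ =
      ∫ x in U, (u : X → ℂ) x * conj ((P v : X → ℂ) x) ∂μ := by
  have hmul (η : SmoothFun n X) : smoothMul η v ∈ dirichletDomain n U := fun x hx => by
    rw [coe_smoothMul, Pi.mul_apply, hv x hx, mul_zero]
  have hsub (η : SmoothFun n X) : tsupport (smoothMul η v : X → ℂ) ⊆ tsupport (η : X → ℂ) :=
    tsupport_mul_subset_left
  -- Only `v` is localized, so a single partition of unity suffices.
  have hloc (x : X) : ∃ O, IsOpen O ∧ x ∈ O ∧ ∀ η : SmoothFun n X, tsupport (η : X → ℂ) ⊆ O →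
      ∫ x in U, (P u : X → ℂ) x * conj ((smoothMul η v : X → ℂ) x) ∂μ =
        ∫ x in U, (u : X → ℂ) x * conj ((P (smoothMul η v) : X → ℂ) x) ∂μ := by
    by_cases hxU : x ∈ U
    · refine ⟨U, hU, hxU, fun η hη => ?_⟩
      have h0 {z} (hz : z ∉ U) : z ∉ tsupport (smoothMul η v : X → ℂ) :=
        fun h' => hz (hη (hsub η h'))
      rw [setIntegral_eq_integral_of_forall_compl_eq_zero fun z hz => by
          rw [image_eq_zero_of_notMem_tsupport (h0 hz)]
          simp,
        setIntegral_eq_integral_of_forall_compl_eq_zero fun z hz => by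
          rw [image_eq_zero_of_notMem_tsupport fun h' => h0 hz (hP.tsupport_subset _ h')]
          simp]
      exact hPsa u _
    by_cases hxc : x ∈ closure U
    · have hxf : x ∈ frontier U := ⟨hxc, fun h' => hxU (interior_subset h')⟩
      obtain ⟨φ, hφ, hxφ, k, hk⟩ := hUb x hxf
      obtain ⟨O, hO, hxO, hgreen⟩ := exists_green_of_boundary_chart hμ hP hPsa hU hφ hk hxφ
        (apply_eq_zero_of_mem_frontier hU hk hxf hxφ)
      exact ⟨O, hO, hxO, fun η hη => hgreen u hu _ (hmul η) ((hsub η).trans hη)⟩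
    · refine ⟨(closure U)ᶜ, isClosed_closure.isOpen_compl, hxc, fun η hη => ?_⟩
      have h0 {z} (hz : z ∈ U) : z ∉ tsupport (smoothMul η v : X → ℂ) :=
        fun h' => hη (hsub η h') (subset_closure hz)
      rw [setIntegral_eq_zero_of_forall_eq_zero fun z hz => by
          rw [image_eq_zero_of_notMem_tsupport (h0 hz)]
          simp,
        setIntegral_eq_zero_of_forall_eq_zero fun z hz => by
          rw [image_eq_zero_of_notMem_tsupport fun h' => h0 hz (hP.tsupport_subset _ h')]
          simp]
  obtain ⟨t, η, hη, -, hsum⟩ := exists_partition hloc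
  have hv' : v = ∑ i, smoothMul (η i) v := by
    apply Subtype.ext
    funext x
    have h1 := congrFun hsum x
    rw [Pi.one_apply, Finset.sum_apply] at h1
    rw [AddSubmonoidClass.coe_finsetSum, Finset.sum_apply]
    simp only [coe_smoothMul, Pi.mul_apply]
    rw [← Finset.sum_mul, ← h1, one_mul]
  have hint (w w' : SmoothFun n X) :
      Integrable (fun x => (w : X → ℂ) x * conj ((w' : X → ℂ) x)) (μ.restrict U) :=
    (hμ.integrable_of_continuous ((SmoothFun.continuous w).mul
      (Complex.continuous_conj.comp (SmoothFun.continuous w')))).integrableOn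
  rw [hv', map_sum]
  simp only [AddSubmonoidClass.coe_finsetSum, Finset.sum_apply, map_sum, Finset.mul_sum]
  rw [integral_finsetSum _ fun i _ => hint _ _, integral_finsetSum _ fun i _ => hint _ _]
  exact Finset.sum_congr rfl fun i _ => hη i

end GreenFormula

/-! ### Localization of essential self-adjointness -/

section Localization

variable {n : ℕ} {X : Type*} [TopologicalSpace X] [ChartedSpace (EuclideanSpace ℝ (Fin n)) X]
  {P : SmoothFun n X →ₗ[ℂ] SmoothFun n X} {U : Set X}

theorem isEllipticAt_of_notMem (hZU : nonEllipticSet P ⊆ U) {x : X} (hx : x ∉ U) :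
    IsEllipticAt P x := by
  by_contra h
  exact hx (hZU h)

theorem smoothMul_mem_dirichletDomain (hU : IsOpen U) {χ w : SmoothFun n X}
    (hχ : tsupport (χ : X → ℂ) ⊆ U) : smoothMul χ w ∈ dirichletDomain n U := fun x hx => by
  rw [hU.frontier_eq] at hx
  rw [coe_smoothMul, Pi.mul_apply, image_eq_zero_of_notMem_tsupport fun h' => hx.2 (hχ h'),
    zero_mul]

variable [MeasurableSpace X] {μ : Measure X}

theorem graphL2_eq_opGraph (hν : ∀ u : SmoothFun n X, MemLp (u : X → ℂ) 2 μ) :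
    graphL2 μ P = opGraph hν P ⊤ := by
  ext p
  rw [mem_opGraph_iff]
  exact exists_congr fun u => (and_iff_right Submodule.mem_top).symm

theorem dirichletGraphL2_eq_opGraph (hν : ∀ u : SmoothFun n X, MemLp (u : X → ℂ) 2 (μ.restrict U)) :
    dirichletGraphL2 μ P U = opGraph hν P (dirichletDomain n U) := by
  ext p
  rw [mem_opGraph_iff]
  rfl

variable [BorelSpace X] [T2Space X] [CompactSpace X] [IsManifold (𝓡 n) ∞ X]

/-- Points of `U` are covered by the transfer from `L²(U)`, and the other points are elliptic. -/
theorem isEssentiallySelfAdjoint_of_dirichlet (hμ : IsSmoothDensity n μ) (hP : IsDiffOpOrderTwo P)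
    (hPsa : IsFormallySelfAdjoint μ P) (hU : IsOpen U) (hZU : nonEllipticSet P ⊆ U)
    (h : IsEssentiallySelfAdjoint (dirichletGraphL2 μ P U)) :
    IsEssentiallySelfAdjoint (graphL2 μ P) := by
  have hν (u : SmoothFun n X) : MemLp (u : X → ℂ) 2 μ :=
    hμ.memLp_of_continuous (SmoothFun.continuous u)
  rw [dirichletGraphL2_eq_opGraph (hμ.memLp U)] at h
  rw [graphL2_eq_opGraph hν]
  refine ApproxSolvable.isEssentiallySelfAdjoint hν (fun u _ v _ => hPsa u v)
    (approxSolvable_one_of_locally hν fun x => ?_)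
  by_cases hx : x ∈ U
  · refine ⟨U, hU, hx, fun η hη => ?_⟩
    exact approxSolvable_of_isEssentiallySelfAdjoint hμ hP hPsa hU
      (fun y hy => (isEllipticAt_of_notMem hZU hy).hasEllipticChart hμ hP hPsa)
      (by rw [Measure.restrict_restrict hU.measurableSet, Set.inter_self]) rfl (hμ.memLp U)
      (fun _ _ _ _ => Submodule.mem_top) h hη
  · exact (isEllipticAt_of_notMem hZU hx).exists_approxSolvable hμ hP hPsa

/-- Points of `U` are covered by the transfer from `L²(X)`, points of the boundary by odd
reflection, and outside of the closure of `U` there is nothing to solve. -/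
theorem isEssentiallySelfAdjoint_dirichlet (hμ : IsSmoothDensity n μ) (hP : IsDiffOpOrderTwo P)
    (hPsa : IsFormallySelfAdjoint μ P) (hU : IsOpen U) (hZU : nonEllipticSet P ⊆ U)
    (hUb : HasSmoothBoundary n U) (h : IsEssentiallySelfAdjoint (graphL2 μ P)) :
    IsEssentiallySelfAdjoint (dirichletGraphL2 μ P U) := by
  have hν (u : SmoothFun n X) : MemLp (u : X → ℂ) 2 μ :=
    hμ.memLp_of_continuous (SmoothFun.continuous u)
  rw [graphL2_eq_opGraph hν] at h
  rw [dirichletGraphL2_eq_opGraph (hμ.memLp U)]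
  refine ApproxSolvable.isEssentiallySelfAdjoint (hμ.memLp U)
    (fun u hu v hv => integral_green_dirichlet hμ hP hPsa hU hUb hu hv)
    (approxSolvable_one_of_locally (hμ.memLp U) fun x => ?_)
  by_cases hx : x ∈ U
  · refine ⟨U, hU, hx, fun η hη => ?_⟩
    exact approxSolvable_of_isEssentiallySelfAdjoint hμ hP hPsa hU
      (fun y hy => (isEllipticAt_of_notMem hZU hy).hasEllipticChart hμ hP hPsa) rfl
      (by rw [Measure.restrict_restrict hU.measurableSet, Set.inter_self]) hν
      (fun _ _ hχ _ => smoothMul_mem_dirichletDomain hU hχ) h hη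
  · by_cases hxc : x ∈ closure U
    · obtain ⟨φ, hφ, hxφ, k, hk⟩ := hUb x ⟨hxc, fun h' => hx (interior_subset h')⟩
      exact (isEllipticAt_of_notMem hZU hx).exists_approxSolvable_dirichlet hμ hP hPsa hU hφ hxφ hk
    · exact ⟨(closure U)ᶜ, isClosed_closure.isOpen_compl, hxc, fun η hη =>
        approxSolvable_of_tsupport_subset_compl_closure hU hη⟩

end Localization

end ESALoc

end

theorem mainTheorem6 (n : ℕ) (X : Type*) [TopologicalSpace X] [T2Space X] [CompactSpace X]
    [ChartedSpace (EuclideanSpace ℝ (Fin n)) X] [IsManifold (𝓡 n) ∞ X]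
    [MeasurableSpace X] [BorelSpace X]
    (μ : Measure X) (hμ : ESALoc.IsSmoothDensity n μ)
    (P : ESALoc.SmoothFun n X →ₗ[ℂ] ESALoc.SmoothFun n X)
    (hP : ESALoc.IsDiffOpOrderTwo P) (hPsa : ESALoc.IsFormallySelfAdjoint μ P)
    (U : Set X) (hUopen : IsOpen U) (hZU : ESALoc.nonEllipticSet P ⊆ U)
    (hUbdry : ESALoc.HasSmoothBoundary n U) :
    ESALoc.IsEssentiallySelfAdjoint (ESALoc.graphL2 μ P) ↔
      ESALoc.IsEssentiallySelfAdjoint (ESALoc.dirichletGraphL2 μ P U) :=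
  ⟨ESALoc.isEssentiallySelfAdjoint_dirichlet hμ hP hPsa hUopen hZU hUbdry,
    ESALoc.isEssentiallySelfAdjoint_of_dirichlet hμ hP hPsa hUopen hZU⟩
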